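/- Let $d\ge 2$. Let $(Z_i,\delta_i,\epsilon_i)$, $i=1,2,\dots$, be i.i.d. with $Z_i,\delta_i$ ($\mathbb R^d$-valued) and $\epsilon_i$ (real) independent, $\mathbb E\epsilon_i=0$, $\mathbb E\epsilon_i^2<\infty$, where $Z_i$ and $\delta_i$ have Lebesgue densities $f_Z$ and $f_\delta$ ($f_\delta$ known). In the Berkson errors-in-variables model one observes $(U_i,Z_i)$, $i=1,\dots,n$, with $U_i=h(Z_i+\delta_i)+\epsilon_i$. Write $\phi_{\mathbf j}(x)=\exp(i\sum_k j_kx_k)$ for $\mathbf j\in\mathbb Z^d$, $f^{\mathrm{ft}}(\mathbf j)=\int f\,\phi_{\mathbf j}\,d\lambda$, and $\tilde f_\delta(x)=f_\delta(-x)$; $\|\cdot\|$ is the Euclidean norm. Assumptions. $A\subset(-\pi,\pi)^d$ is compact and $f_\delta$ is supported in $A$; $f_Z$ vanishes outside a compact convex set $S\subset\mathbb R^d$ and is bounded and bounded away from $0$ on $S$; $S^*$ is a compact subset of the interior of $S$; and $f_\delta$ is ordinary smooth of order $\gamma>d/2$, i.e. $c_\delta(1+\|\mathbf j\|)^{-\gamma}\le|f_\delta^{\mathrm{ft}}(\mathbf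 j)|\le C_\delta(1+\|\mathbf j\|)^{-\gamma}$ for all $\mathbf j\in\mathbb Z^d$, with constants $c_\delta,C_\delta>0$. For $\alpha,C^*_\alpha>0$ with $4(\alpha-1)(\alpha+\gamma)\ge d(2\alpha+2\gamma+d)$ let $\mathcal H$ be the class of all integrable functions $h:\mathbb R^d\to\mathbb R$ supported in $A$, such that $h*\tilde f_\delta$ is supported in $S^*$ and $\sum_{\mathbf j\in\mathbb Z^d}|h^{\mathrm{ft}}(\mathbf j)|^2(1+\|\mathbf j\|^{2\alpha})\le C^*_\alpha$. Estimator. For integers $L\ge 0$, $K\ge1$ put $\mathcal K=\{\kappa\in\mathbb N_0^d:|\kappa|\le L\}$, $\xi(z,w)=\big(\prod_k(w_k-z_k)^{\kappa_k}\big)_{\kappa\in\mathcal K}$, and for $J\subseteq\{1,\dots,n\}$ with $\#J=K$ put $C(J)=\{z\in S^*:\|z-Z_j\|<\|z-Z_k\|\ \forall j\in J,\,k\notin J\}$ and $\mathcal M_J(z)=\sum_{j\in J}\xi(z,Z_j)\xi(z,Z_j)^\top$. Let $$\hat\Psi_{\mathbf j}=\sum_{\#J=K}\int_{C(J)}\sum_{i\in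 J}U_i\,\phi_{\mathbf j}(Z_i)\,\mathbf e_0^\top\mathcal M_J(z)^{-1}\xi(z,Z_i)\,dz,$$ where $\mathbf e_0$ is the unit vector with index $\kappa=0$ (so the integrand is the value at $z$ of the least squares polynomial of degree $L$ fitted to the points $(Z_i,U_i\phi_{\mathbf j}(Z_i))$, $i\in J$), and $$\hat h=(2\pi)^{-d}\sum_{\mathbf j\in\{-J_n,\dots,J_n\}^d}\hat\Psi_{\mathbf j}\,\phi_{-\mathbf j}/f_\delta^{\mathrm{ft}}(-\mathbf j).$$ Choose $J_n\in\mathbb N_0$ with $J_n\asymp n^{1/(2\alpha+2\gamma+d)}$, $L=\lceil\alpha\rceil-1$, and a fixed $K\ge 2+(2D+1)K^*$ if $L\ge1$ ($K\ge1$ if $L=0$), where $K^*=\#\mathcal K$ and $D=\sum_{l=1}^L l\binom{d+l-1}{l}$. Claim. There is a constant $C$, not depending on $n$ or $h$, such that for all $h\in\mathcal H$ and all $n\ge1$ $$\mathbb E\Big[\int_{[-\pi,\pi]^d}|\hat h(x)-h(x)|^2\,dx\Big]\le C\,n^{-2\alpha/(2\alpha+2\gamma+d)}.$$ -/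

import Mathlib

open MeasureTheory ProbabilityTheory Filter Asymptotics

noncomputable section

namespace Berkson

/-- `d`-dimensional Euclidean space. -/
abbrev Space (d : ℕ) : Type := EuclideanSpace ℝ (Fin d)

/-- An integer multi-index regarded as a vector; `‖intVec j‖` is its Euclidean norm. -/
def intVec {d : ℕ} (j : Fin d → ℤ) : Space d := WithLp.toLp 2 fun k => (j k : ℝ)

/-- The Fourier basis function `φ_j(x) = exp (i ∑ₖ jₖ xₖ)`. -/
def basisFun {d : ℕ} (j : Fin d → ℤ) (x : Space d) : ℂ :=
  Complex.exp (Complex.I * ((∑ k, (j k : ℝ) * x k : ℝ) : ℂ))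

/-- The Fourier coefficient `f^ft(j) = ⟨f, φ_j⟩ = ∫ f(x) φ_j(x) dx` (bilinear pairing) of a real
function `f`; it is used for integrable functions which vanish outside `(-π, π)^d`. -/
def fourierCoef {d : ℕ} (f : Space d → ℝ) (j : Fin d → ℤ) : ℂ :=
  ∫ x, (f x : ℂ) * basisFun j x

/-- The open cube `(-π, π)^d`. -/
def openCube (d : ℕ) : Set (Space d) := {x | ∀ k, x k ∈ Set.Ioo (-Real.pi) Real.pi}

/-- The closed cube `[-π, π]^d`. -/
def closedCube (d : ℕ) : Set (Space d) := {x | ∀ k, x k ∈ Set.Icc (-Real.pi) Real.pi}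

/-- The convolution `h * f̃` where `f̃(x) = f(-x)`. -/
def calibrated {d : ℕ} (h f : Space d → ℝ) : Space d → ℝ :=
  convolution h (fun x => f (-x)) (ContinuousLinearMap.mul ℝ ℝ) volume

/-! ### The estimator of the integral functional -/

/-- The multi-indices `κ ∈ ℕ₀^d` with `|κ| ≤ L`. -/
def multiIndices (d L : ℕ) : Finset (Fin d → ℕ) :=
  (Fintype.piFinset fun _ => Finset.range (L + 1)).filter fun κ => ∑ k, κ k ≤ L

/-- The multi-index `0`. -/
def zeroIndex (d L : ℕ) : multiIndices d L :=
  ⟨0, by simp [multiIndices]⟩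

/-- The vector `ξ(z, w)` of all monomials in `w` of degree at most `L`, centred at `z`. -/
def monomials {d : ℕ} (L : ℕ) (z w : Space d) : multiIndices d L → ℝ :=
  fun κ => ∏ k, (w k - z k) ^ (κ.1 k)

/-- The `K`-th order Voronoi cell `C(J)` within `Sstar` of the points `Z j`, `j ∈ J`. -/
def cell {d n : ℕ} (Sstar : Set (Space d)) (Z : Fin n → Space d) (J : Finset (Fin n)) :
    Set (Space d) :=
  {z | z ∈ Sstar ∧ ∀ j ∈ J, ∀ k ∉ J, ‖z - Z j‖ < ‖z - Z k‖}

/-- The matrix `M_J(z) = ∑_{j ∈ J} ξ(z, Z j) ξ(z, Z j)ᵀ`. -/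
def designMatrix {d n : ℕ} (L : ℕ) (Z : Fin n → Space d) (J : Finset (Fin n)) (z : Space d) :
    Matrix (multiIndices d L) (multiIndices d L) ℝ :=
  ∑ j ∈ J, Matrix.vecMulVec (monomials L z (Z j)) (monomials L z (Z j))

/-- The value at `z` of the least squares polynomial of degree `L` in the regression of `Y j` on
`Z j`, `j ∈ J`, that is `∑_{j ∈ J} Y j · e₀ᵀ M_J(z)⁻¹ ξ(z, Z j)`. -/
def localFit {d n : ℕ} (L : ℕ) (Z : Fin n → Space d) (Y : Fin n → ℂ) (J : Finset (Fin n))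
    (z : Space d) : ℂ :=
  ∑ j ∈ J, Y j *
    (((designMatrix L Z J z)⁻¹.mulVec (monomials L z (Z j)) (zeroIndex d L) : ℝ) : ℂ)

/-- The estimator `Ψ̂(L, K)` of `∫_{Sstar} E[g(U, Z) | Z = z] dz` from the data `(U j, Z j)`. -/
def psiHat {d n : ℕ} (Sstar : Set (Space d)) (L K : ℕ) (g : ℝ → Space d → ℂ)
    (U : Fin n → ℝ) (Z : Fin n → Space d) : ℂ :=
  ∑ J ∈ Finset.powersetCard K (Finset.univ : Finset (Fin n)),
    ∫ z in cell Sstar Z J, localFit L Z (fun j => g (U j) (Z j)) J z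

/-- `K* = #{κ : |κ| ≤ L}`. -/
def polyDim (d L : ℕ) : ℕ := (multiIndices d L).card

/-- `D = ∑_{l=1}^L l · binom(d + l - 1, l)`. -/
def degreeSum (d L : ℕ) : ℕ := ∑ l ∈ Finset.Icc 1 L, l * (d + l - 1).choose l

/-- The admissible numbers `K` of neighbours for the polynomial degree `L`. -/
def AdmissibleOrder (d L K : ℕ) : Prop :=
  (L = 0 ∧ 1 ≤ K) ∨ (1 ≤ L ∧ 2 + (2 * degreeSum d L + 1) * polyDim d L ≤ K)

/-- The Fourier series deconvolution estimator
`ĥ = (2π)^{-d} ∑_{j ∈ {-m,…,m}^d} Ψ̂_j φ_{-j} / f_δ^ft(-j)`,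
where `Ψ̂_j` is the estimator `Ψ̂(L, K)` for `g(u, z) = u φ_j(z)`. -/
def hHat {d n : ℕ} (Sstar : Set (Space d)) (fδ : Space d → ℝ) (L K m : ℕ)
    (U : Fin n → ℝ) (Z : Fin n → Space d) (x : Space d) : ℂ :=
  ((2 * Real.pi : ℝ) : ℂ)⁻¹ ^ d *
    ∑ j ∈ Fintype.piFinset (fun _ : Fin d => Finset.Icc (-(m : ℤ)) (m : ℤ)),
      psiHat Sstar L K (fun u z => (u : ℂ) * basisFun j z) U Z * basisFun (-j) x
        / fourierCoef fδ (-j)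

/-! ### The model -/

/-- `fZ` is a density with compact convex support `S` (on which it is bounded and bounded away
from zero), and the compact set `Sstar` lies in the interior of `S`. -/
structure DesignDensity {d : ℕ} (fZ : Space d → ℝ) (S Sstar : Set (Space d)) : Prop where
  measurable : Measurable fZ
  compact : IsCompact S
  convex : Convex ℝ S
  support_subset : Function.support fZ ⊆ S
  bounds : ∃ ρ ρ' : ℝ, 0 < ρ ∧ ∀ z ∈ S, ρ ≤ fZ z ∧ fZ z ≤ ρ'
  compact_star : IsCompact Sstar
  star_subset : Sstar ⊆ interior S

/-- `fδ` is a nonnegative function supported in `A`, ordinary smooth of order `γ`. -/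
structure OrdinarySmoothDensity {d : ℕ} (fδ : Space d → ℝ) (A : Set (Space d)) (γ : ℝ) :
    Prop where
  measurable : Measurable fδ
  nonneg : ∀ x, 0 ≤ fδ x
  support_subset : Function.support fδ ⊆ A
  smooth : ∃ c C : ℝ, 0 < c ∧ ∀ j : Fin d → ℤ,
    c * (1 + ‖intVec j‖) ^ (-γ) ≤ ‖fourierCoef fδ j‖ ∧
      ‖fourierCoef fδ j‖ ≤ C * (1 + ‖intVec j‖) ^ (-γ)

/-- `(Z i, δ i, ε i)`, `i = 0, 1, …`, are independent and identically distributed; for each `i`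
the variables `Z i`, `δ i`, `ε i` are mutually independent, `Z i` and `δ i` have the Lebesgue
densities `fZ` and `fδ`, and `ε i` is centred and square-integrable. -/
structure ErrorsInVariables {d : ℕ} {Ω : Type*} [MeasurableSpace Ω] (P : Measure Ω)
    (fZ fδ : Space d → ℝ) (Z δ : ℕ → Ω → Space d) (ε : ℕ → Ω → ℝ) : Prop where
  measurable_Z : ∀ i, Measurable (Z i)
  measurable_δ : ∀ i, Measurable (δ i)
  measurable_ε : ∀ i, Measurable (ε i)
  indep : iIndepFun (fun i ω => (Z i ω, δ i ω, ε i ω)) P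
  indep_Z : ∀ i, IndepFun (Z i) (fun ω => (δ i ω, ε i ω)) P
  indep_δ : ∀ i, IndepFun (δ i) (ε i) P
  law_Z : ∀ i, P.map (Z i) = volume.withDensity fun z => ENNReal.ofReal (fZ z)
  law_δ : ∀ i, P.map (δ i) = volume.withDensity fun z => ENNReal.ofReal (fδ z)
  ident_ε : ∀ i, IdentDistrib (ε i) (ε 0) P P
  memLp_ε : MemLp (ε 0) 2 P
  centred_ε : ∫ ω, ε 0 ω ∂P = 0

/-- The class of regression functions: `h` is supported in `A`, the convolution `h * f̃_δ` is
supported in `Sstar`, and `∑_j |h^ft(j)|² (1 + ‖j‖^{2α}) ≤ R`. -/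
structure SobolevClass {d : ℕ} (fδ : Space d → ℝ) (A Sstar : Set (Space d)) (α R : ℝ)
    (h : Space d → ℝ) : Prop where
  measurable : Measurable h
  integrable : Integrable h
  support_subset : Function.support h ⊆ A
  support_conv : Function.support (calibrated h fδ) ⊆ Sstar
  summable : Summable fun j : Fin d → ℤ =>
    ‖fourierCoef h j‖ ^ 2 * (1 + ‖intVec j‖ ^ (2 * α))
  sum_le : ∑' j : Fin d → ℤ, ‖fourierCoef h j‖ ^ 2 * (1 + ‖intVec j‖ ^ (2 * α)) ≤ R

/-- The response `U i = h (Z i + δ i) + ε i`. -/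
def response {d : ℕ} {Ω : Type*} (h : Space d → ℝ) (Z δ : ℕ → Ω → Space d) (ε : ℕ → Ω → ℝ)
    (i : ℕ) (ω : Ω) : ℝ :=
  h (Z i ω + δ i ω) + ε i ω

/-- The mean integrated squared error over `[-π, π]^d` of `ĥ` computed from the first `n`
observations `(U i, Z i)`. It takes values in `[0, ∞]`. -/
def risk {d : ℕ} {Ω : Type*} [MeasurableSpace Ω] (P : Measure Ω) (Sstar : Set (Space d))
    (fδ : Space d → ℝ) (L K m n : ℕ) (h : Space d → ℝ) (Z δ : ℕ → Ω → Space d)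
    (ε : ℕ → Ω → ℝ) : ENNReal :=
  ∫⁻ ω, (∫⁻ x in closedCube d,
    ‖hHat Sstar fδ L K m (fun i : Fin n => response h Z δ ε i ω) (fun i : Fin n => Z i ω) x
      - (h x : ℂ)‖ₑ ^ 2) ∂P

end Berkson

end

noncomputable section

namespace Berkson

/-! ### Negative powers of polynomials -/

/-! Given `Z = z`, the response has mean `g(z) = (h * f̃_δ)(z)`. As `g` vanishes off `Sstar`, the
convolution theorem gives `∫_{Sstar} g φ_j = h^ft(j) f_δ^ft(-j)`, and this is what `Ψ̂_j` estimates.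
Parseval on the cube (`lintegral_hHat_sub_sq_le`) bounds the integrated squared error by the
coefficient errors, inflated by `(1 + ‖j‖)^{2γ}` on the frequency box, plus a tail of order
`J_n^{-2α}`. With `τ = n^{1/d}`, the inverse of the typical spacing of the design points, it remains
to show that the mean squared error of `Ψ̂_j` is at most a constant times `1/n + (1 + ‖j‖)^{2L}
n^{-2L/d}` (`exists_coefficient_risk_le`). Summed over the box, the first term has exactly the
claimed rate, and `4(α-1)(α+γ) ≥ d(2α+2γ+d)` with `L ≥ α - 1` makes the second no larger
(`exists_rate_le`).

Almost surely `Ψ̂_j = ∑ U_i φ_j(Z_i) w_i`, where `w_i` is the integral over `z` of the weight of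
observation `i` in the local fit at `z`. Conditionally on the design, the variance is at most a
constant times `∑ w_i²`, and the bias is the integral of the local polynomial approximation errors
of `g φ_j`. Both are controlled by the expectation, uniform in `z ∈ Sstar` and `n ≥ K`, of `(1 + τ
R)^N` times the sum of squared local weights, where `R` is the distance from `z` to its `K`-th
nearest design point (`nnMoment`). For the variance, the weights at `z` and `z'` share an
observation only if `‖z - z'‖ ≤ R + R'`, so the double integral expressing `∑ w_i²` lives on `‖z -
z'‖` of order `1/τ` and has size `τ^{-d} = 1/n` (`sum_totalWeight_mul_le`). For the bias, the
weights reproduce polynomials, so only Taylor remainders of order `R^L` survive (`fit_error_sq_le`).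

The heart is the moment bound `exists_lintegral_fitSqTop_le`, because nearly degenerate designs make
the weights arbitrarily large. Least squares weights have the smallest sum of squares among all
weights reproducing polynomials at `z`. The `K` neighbours contain `m = 2D + 1` disjoint groups of
`K*` points; interpolation on one group costs at most a constant over its squared Vandermonde
determinant. The optimal weights beat all groups, hence their geometric mean, which is the power
`-2/m` of the product of the determinants (`fitSq_le_vandermonde`). The groups being disjoint, this
product has degree at most `L` in each coordinate for every `m`, so that power is locally integrable
as soon as `2L < m` (`lintegral_mvPolynomial_lt_top`). Large `R` is exponentially unlikely, since
balls around points of `Sstar` carry mass of order `ρ^d`.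

The analytic input is `exists_regressionBounds`. Summable Fourier coefficients make `h` bounded, and
the decay of `f_δ^ft` with `2γ > d` gives the transform of `g` an integrable moment of order `L`,
hence Taylor approximations. Passing from integer frequencies to the transform on all of `ℝ^d` is
done by a sampling expansion with a smooth cutoff (`IsCutoff.hasSum_ft`). -/

lemma enorm_rpow_neg_mul (a b s : ℝ) (hs : 0 < s) :
    ‖a * b‖ₑ ^ (-s) ≤ ‖a‖ₑ ^ (-s) * ‖b‖ₑ ^ (-s) := by
  rcases eq_or_ne a 0 with rfl | ha
  · rcases eq_or_ne b 0 with rfl | hb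
    · simp [hs]
    · have : ‖b‖ₑ ^ (-s) ≠ 0 := by
        simp [ENNReal.rpow_eq_zero_iff, hs, not_lt.2 hs.le]
      simp only [enorm_zero, ENNReal.zero_rpow_of_neg (neg_lt_zero.2 hs), ENNReal.top_mul this]
      exact le_top
  · rw [enorm_mul, ENNReal.mul_rpow_of_ne_top (by simp) (by simp)]

/-- Either no factor exceeds `1`, or the largest one raised to the power `m` dominates the product.
This replaces Hölder's inequality: a product over at most `m` roots is reduced to single-root terms
whose exponent is `m` times as large. -/
lemma multiset_prod_le_one_add_sum {ι : Type*} (S : Multiset ι) (c : ι → ENNReal) {m : ℕ}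
    (hS : Multiset.card S ≤ m) :
    (S.map c).prod ≤ 1 + (S.map fun r => c r ^ m).sum := by
  by_cases h : ∀ r ∈ S, c r ≤ 1
  · have : (S.map c).prod ≤ 1 ^ (Multiset.card (S.map c)) :=
      Multiset.prod_le_pow_card _ _ (by simpa using h)
    exact (this.trans (by simp)).trans le_self_add
  · push Not at h
    obtain ⟨r₀, hr₀, h₀⟩ := h
    classical
    obtain ⟨r, hr, hmax⟩ := Finset.exists_max_image S.toFinset c ⟨r₀, by simpa using hr₀⟩
    have h1 : 1 ≤ c r := h₀.le.trans (hmax _ (by simpa using hr₀))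
    have : (S.map c).prod ≤ c r ^ (Multiset.card (S.map c)) :=
      Multiset.prod_le_pow_card _ _ (by simpa using hmax)
    rw [Multiset.card_map] at this
    refine (this.trans (pow_le_pow_right₀ h1 hS)).trans (le_add_left ?_)
    exact Multiset.single_le_sum (by simp) _
      (Multiset.mem_map_of_mem (fun r => c r ^ m) (by simpa using hr))

lemma lintegral_Icc_enorm_rpow_lt_top {t : ℝ} (ht1 : t < 1) :
    ∫⁻ u : ℝ in Set.Icc (-1) 1, ‖u‖ₑ ^ (-t) < ⊤ := by
  have hI : IntegrableOn (fun x : ℝ => x ^ (-t)) (Set.Ioc 0 1) := by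
    have := intervalIntegral.intervalIntegrable_rpow' (a := 0) (b := 1) (r := -t) (by linarith)
    rwa [intervalIntegrable_iff_integrableOn_Ioc_of_le zero_le_one] at this
  have h1 : ∫⁻ u : ℝ in Set.Ioc 0 1, ‖u‖ₑ ^ (-t) < ⊤ := by
    refine lt_of_le_of_lt (le_of_eq ?_) hI.2
    refine setLIntegral_congr_fun measurableSet_Ioc fun x hx => ?_
    rw [Real.enorm_of_nonneg hx.1.le, Real.enorm_of_nonneg (Real.rpow_nonneg hx.1.le _),
      ENNReal.ofReal_rpow_of_pos hx.1]
  have h2 : ∫⁻ u : ℝ in Set.Ico (-1) 0, ‖u‖ₑ ^ (-t) < ⊤ := by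
    refine lt_of_le_of_lt (le_of_eq ?_) h1
    have := (Measure.measurePreserving_neg (volume : Measure ℝ)).setLIntegral_comp_preimage_emb
      (MeasurableEquiv.neg ℝ).measurableEmbedding (fun u => ‖u‖ₑ ^ (-t)) (Set.Ioc 0 1)
    rw [← this]
    simp
  have h3 : Set.Icc (-1 : ℝ) 1 ⊆ Set.Ico (-1) 0 ∪ ({0} ∪ Set.Ioc 0 1) := by
    intro x hx
    rcases lt_trichotomy x 0 with h | h | h
    · exact Or.inl ⟨hx.1, h⟩
    · exact Or.inr (Or.inl h)
    · exact Or.inr (Or.inr ⟨h, hx.2⟩)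
  refine (lintegral_mono_set h3).trans_lt ((lintegral_union_le _ _ _).trans_lt ?_)
  refine ENNReal.add_lt_top.2 ⟨h2, (lintegral_union_le _ _ _).trans_lt ?_⟩
  refine ENNReal.add_lt_top.2 ⟨?_, h1⟩
  simp [Measure.restrict_singleton]

/-- Uniformity in `ρ` is what matters, since the roots may lie anywhere. At distance less than `1`
from `ρ` translation invariance applies; elsewhere the integrand is at most `1` on an interval of
length `2`. -/
lemma lintegral_Icc_enorm_sub_rpow_le {t : ℝ} (ht : 0 ≤ t) (ρ : ℝ) :
    ∫⁻ x : ℝ in Set.Icc (-1) 1, ‖x - ρ‖ₑ ^ (-t)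
      ≤ (∫⁻ u : ℝ in Set.Icc (-1) 1, ‖u‖ₑ ^ (-t)) + 2 := by
  set f : ℝ → ENNReal := (Set.Icc (-1) 1).indicator fun u => ‖u‖ₑ ^ (-t) with hf
  have hpt : ∀ x, ‖x - ρ‖ₑ ^ (-t) ≤ f (x - ρ) + 1 := by
    intro x
    by_cases hx : x - ρ ∈ Set.Icc (-1 : ℝ) 1
    · simp [hf, Set.indicator_of_mem hx]
    · have h1 : 1 ≤ ‖x - ρ‖ₑ := by
        rw [Real.enorm_eq_ofReal_abs, ENNReal.one_le_ofReal]
        by_contra! h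
        exact hx ⟨(abs_lt.1 h).1.le, (abs_lt.1 h).2.le⟩
      refine le_add_left ?_
      rw [ENNReal.rpow_neg]
      refine ENNReal.inv_le_one.2 ?_
      rcases ht.eq_or_lt with rfl | ht
      · simp
      · exact ENNReal.one_le_rpow h1 ht
  have hfm : Measurable f := by
    refine Measurable.indicator (by fun_prop) measurableSet_Icc
  calc ∫⁻ x : ℝ in Set.Icc (-1) 1, ‖x - ρ‖ₑ ^ (-t)
      ≤ ∫⁻ x : ℝ in Set.Icc (-1) 1, (f (x - ρ) + 1) := lintegral_mono hpt
    _ = (∫⁻ x : ℝ in Set.Icc (-1) 1, f (x - ρ)) + 2 := by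
        rw [lintegral_add_right _ measurable_const]
        simp; norm_num
    _ ≤ (∫⁻ x : ℝ, f (x - ρ)) + 2 := by gcongr; exact Measure.restrict_le_self
    _ = _ := by rw [lintegral_sub_right_eq_self f ρ, hf, lintegral_indicator measurableSet_Icc]

lemma lintegral_multiset_sum_le {ι α : Type*} [MeasurableSpace α] (μ : Measure α)
    (S : Multiset ι) (f : ι → α → ENNReal) (hf : ∀ r, Measurable (f r)) (B : ENNReal)
    (hB : ∀ r, ∫⁻ x, f r x ∂μ ≤ B) :
    ∫⁻ x, (S.map fun r => f r x).sum ∂μ ≤ Multiset.card S * B := by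
  induction S using Multiset.induction with
  | empty => simp
  | cons r S ih =>
    simp only [Multiset.map_cons, Multiset.sum_cons, Multiset.card_cons]
    rw [lintegral_add_left (hf r)]
    push_cast
    rw [add_mul, one_mul, add_comm]
    exact add_le_add ih (hB r)

/-- A complex root may be replaced by its real part, because `|x - Re z| ≤ |x - z|` for real `x`. -/
lemma Polynomial.exists_roots_bound (q : Polynomial ℝ) :
    ∃ S : Multiset ℝ, Multiset.card S = q.natDegree ∧
      ∀ x : ℝ, |q.leadingCoeff| * (S.map fun ρ => |x - ρ|).prod ≤ |q.eval x| := by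
  set Q := q.map (algebraMap ℝ ℂ)
  have hQ : Q.Splits := IsAlgClosed.splits Q
  refine ⟨Q.roots.map Complex.re, ?_, fun x => ?_⟩
  · rw [Multiset.card_map, ← hQ.natDegree_eq_card_roots, Polynomial.natDegree_map]
  · have h1 := hQ.eval_eq_prod_roots (x : ℂ)
    have h2 : Q.eval (x : ℂ) = ((q.eval x : ℝ) : ℂ) := by
      simp [Q, Polynomial.eval_map]
      exact Polynomial.eval₂_at_apply (algebraMap ℝ ℂ) x
    have h3 : Q.leadingCoeff = (q.leadingCoeff : ℂ) := by simp [Q]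
    rw [h2, h3] at h1
    have h4 := congrArg norm h1
    rw [norm_mul, Complex.norm_real, Complex.norm_real, Real.norm_eq_abs, Real.norm_eq_abs] at h4
    rw [h4]
    refine mul_le_mul_of_nonneg_left ?_ (abs_nonneg _)
    clear h1 h4
    induction Q.roots using Multiset.induction with
    | empty => simp
    | cons r S ih =>
      simp only [Multiset.map_cons, Multiset.prod_cons, norm_mul]
      refine mul_le_mul ?_ ih (Multiset.prod_nonneg (by simp)) (norm_nonneg _)
      simpa using Complex.abs_re_le_norm ((x : ℂ) - r)

/-- The constant depends only on `m` and `s`; all dependence on the polynomial sits in its leading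
coefficient. This is the form that can be iterated over several variables. -/
lemma exists_lintegral_polynomial_le (m : ℕ) {s : ℝ} (hs : 0 < s) (hsm : s * m < 1) :
    ∃ C : ENNReal, C ≠ ⊤ ∧ ∀ q : Polynomial ℝ, q.natDegree ≤ m →
      ∫⁻ x : ℝ in Set.Icc (-1) 1, ‖q.eval x‖ₑ ^ (-s) ≤ C * ‖q.leadingCoeff‖ₑ ^ (-s) := by
  set B := (∫⁻ u : ℝ in Set.Icc (-1) 1, ‖u‖ₑ ^ (-(s * m))) + 2 with hB
  have hBtop : B ≠ ⊤ := by
    rw [hB]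
    exact ENNReal.add_ne_top.2 ⟨(lintegral_Icc_enorm_rpow_lt_top hsm).ne, by simp⟩
  refine ⟨2 + m * B, by finiteness, fun q hq => ?_⟩
  obtain ⟨S, hS, hSx⟩ := Polynomial.exists_roots_bound q
  have hpt : ∀ x : ℝ, ‖q.eval x‖ₑ ^ (-s) ≤
      ‖q.leadingCoeff‖ₑ ^ (-s) * (1 + (S.map fun ρ => ‖x - ρ‖ₑ ^ (-(s * m))).sum) := by
    intro x
    have h1 : ‖q.eval x‖ₑ ^ (-s) ≤ ‖q.leadingCoeff * (S.map fun ρ => (x - ρ)).prod‖ₑ ^ (-s) := by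
      rw [ENNReal.rpow_neg, ENNReal.rpow_neg]
      refine ENNReal.inv_le_inv.2 (ENNReal.rpow_le_rpow ?_ hs.le)
      rw [Real.enorm_eq_ofReal_abs, Real.enorm_eq_ofReal_abs, abs_mul]
      refine ENNReal.ofReal_le_ofReal (le_trans (le_of_eq ?_) (hSx x))
      congr 1
      clear hS hSx
      induction S using Multiset.induction with
      | empty => simp
      | cons r S ih => simp [abs_mul, ih]
    refine (h1.trans (enorm_rpow_neg_mul _ _ _ hs)).trans ?_
    gcongr
    have h2 : ‖(S.map fun ρ => (x - ρ)).prod‖ₑ ^ (-s)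
        ≤ (S.map fun ρ => ‖x - ρ‖ₑ ^ (-s)).prod := by
      clear hS hSx h1
      induction S using Multiset.induction with
      | empty => simp
      | cons r S ih =>
        simp only [Multiset.map_cons, Multiset.prod_cons]
        exact (enorm_rpow_neg_mul _ _ _ hs).trans (by gcongr)
    refine (h2.trans (multiset_prod_le_one_add_sum S _ (hS.trans_le hq))).trans (le_of_eq ?_)
    congr 3
    ext ρ
    rw [← ENNReal.rpow_natCast, ← ENNReal.rpow_mul, neg_mul]
  refine (lintegral_mono hpt).trans ?_
  have hm : ∀ x : ℝ, Measurable fun y : ℝ => ‖y - x‖ₑ ^ (-(s * m)) := fun x => by fun_prop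
  have hms : Measurable fun x : ℝ => (S.map fun ρ => ‖x - ρ‖ₑ ^ (-(s * m))).sum := by
    clear hS hSx hpt
    induction S using Multiset.induction with
    | empty => simp
    | cons r S ih =>
      simp only [Multiset.map_cons, Multiset.sum_cons]
      exact (hm r).add ih
  rw [lintegral_const_mul _ (hms.const_add 1), lintegral_add_left measurable_const, mul_comm]
  gcongr
  · simp; norm_num
  · refine (lintegral_multiset_sum_le _ S (fun ρ x => ‖x - ρ‖ₑ ^ (-(s * m))) hm B ?_).trans ?_
    · exact fun ρ => lintegral_Icc_enorm_sub_rpow_le (by positivity) ρ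
    · gcongr
      exact hS.trans_le hq

/-- Induction on the number of variables: regarded as a polynomial in the first variable, `p`
integrates to a constant times the same negative power of its leading coefficient, a nonzero
polynomial in the remaining variables with no larger degrees. Hence only the degree in each single
variable has to be controlled, not the total degree. -/
lemma lintegral_mvPolynomial_fin_lt_top (m : ℕ) {s : ℝ} (hs : 0 < s) (hsm : s * m < 1) (n : ℕ) :
    ∀ p : MvPolynomial (Fin n) ℝ, p ≠ 0 → (∀ i, p.degreeOf i ≤ m) →
      ∫⁻ x : Fin n → ℝ, ‖MvPolynomial.eval x p‖ₑ ^ (-s)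
        ∂(Measure.pi fun _ => volume.restrict (Set.Icc (-1) 1)) < ⊤ := by
  obtain ⟨C, hC, hCq⟩ := exists_lintegral_polynomial_le m hs hsm
  induction n with
  | zero =>
    intro p hp _
    obtain ⟨c, rfl⟩ := MvPolynomial.C_surjective (Fin 0) p
    have hc : c ≠ 0 := by rintro rfl; simp at hp
    simp only [MvPolynomial.eval_C]
    rw [lintegral_const]
    refine ENNReal.mul_lt_top ?_ (measure_lt_top _ _)
    exact (ENNReal.rpow_ne_top_of_ne_zero (by simpa using hc) (by simp)).lt_top
  | succ n ih =>
    intro p hp hdeg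
    set P := MvPolynomial.finSuccEquiv ℝ n p with hP
    have hP0 : P ≠ 0 := by simpa [hP] using hp
    set a := P.leadingCoeff with ha
    have hmp := measurePreserving_piFinSuccAbove
      (fun _ : Fin (n + 1) => (volume : Measure ℝ).restrict (Set.Icc (-1) 1)) 0
    have hmeas : Measurable fun x : Fin (n + 1) → ℝ => ‖MvPolynomial.eval x p‖ₑ ^ (-s) :=
      ((MvPolynomial.continuous_eval p).measurable.enorm).pow_const _
    rw [← hmp.symm.lintegral_comp hmeas, lintegral_prod_symm _ (by
      exact (hmeas.comp (MeasurableEquiv.measurable _)).aemeasurable)]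
    have hin : ∀ y : Fin n → ℝ, ∫⁻ x : ℝ in Set.Icc (-1) 1,
        ‖MvPolynomial.eval ((MeasurableEquiv.piFinSuccAbove (fun _ => ℝ) 0).symm (x, y)) p‖ₑ ^ (-s)
        ≤ C * ‖MvPolynomial.eval y a‖ₑ ^ (-s) := by
      intro y
      have h1 : ∀ x : ℝ, MvPolynomial.eval
          ((MeasurableEquiv.piFinSuccAbove (fun _ => ℝ) 0).symm (x, y)) p
          = (P.map (MvPolynomial.eval y)).eval x := by
        intro x
        rw [hP, ← MvPolynomial.eval_eq_eval_mv_eval']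
        simp [MeasurableEquiv.piFinSuccAbove, Fin.insertNthEquiv]
      simp only [h1]
      refine (hCq _ ?_).trans ?_
      · refine Polynomial.natDegree_map_le.trans ?_
        rw [hP, MvPolynomial.natDegree_finSuccEquiv]
        exact hdeg 0
      -- If the leading coefficient vanishes at `y`, specialization lowers the degree, but then the
      -- right-hand side is infinite unless `C = 0`.
      · by_cases h0 : MvPolynomial.eval y a = 0
        · rcases eq_or_ne C 0 with rfl | hC0
          · simp
          · simp [h0, ENNReal.zero_rpow_of_neg (neg_lt_zero.2 hs), ENNReal.mul_top hC0]
        · rw [Polynomial.leadingCoeff_map_of_leadingCoeff_ne_zero _ h0]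
    refine (lintegral_mono hin).trans_lt ?_
    rw [lintegral_const_mul' _ _ hC]
    refine ENNReal.mul_lt_top hC.lt_top (ih a (by simpa [ha] using hP0) fun i => ?_)
    exact (MvPolynomial.degreeOf_coeff_finSuccEquiv p i _).trans (hdeg _)

/-- A nonzero polynomial of degree at most `m` in each variable has an integrable power of order
`-s` on the cube if `s m < 1`. -/
lemma lintegral_mvPolynomial_lt_top {ι : Type*} [Fintype ι] (m : ℕ) {s : ℝ} (hs : 0 < s)
    (hsm : s * m < 1) (p : MvPolynomial ι ℝ) (hp : p ≠ 0) (hdeg : ∀ i, p.degreeOf i ≤ m) :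
    ∫⁻ x : ι → ℝ, ‖MvPolynomial.eval x p‖ₑ ^ (-s)
      ∂(Measure.pi fun _ => volume.restrict (Set.Icc (-1) 1)) < ⊤ := by
  classical
  set e := Fintype.equivFin ι
  have hmp := measurePreserving_piCongrLeft
    (fun _ : Fin (Fintype.card ι) => (volume : Measure ℝ).restrict (Set.Icc (-1) 1)) e
  have hmeas : Measurable fun x : Fin (Fintype.card ι) → ℝ =>
      ‖MvPolynomial.eval x (MvPolynomial.rename e p)‖ₑ ^ (-s) :=
    ((MvPolynomial.continuous_eval _).measurable.enorm).pow_const _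
  have := lintegral_mvPolynomial_fin_lt_top m hs hsm _ (MvPolynomial.rename e p)
    (by simpa using (MvPolynomial.rename_injective _ e.injective).ne hp) (fun i => by
      obtain ⟨j, rfl⟩ := e.surjective i
      rw [MvPolynomial.degreeOf_rename_of_injective e.injective]
      exact hdeg j)
  rw [← hmp.lintegral_comp hmeas] at this
  refine lt_of_le_of_lt (le_of_eq ?_) this
  congr! 4 with x
  rw [MvPolynomial.eval_rename]
  congr 2
  ext i
  simp [MeasurableEquiv.piCongrLeft, Equiv.piCongrLeft_apply_apply]

/-! ### Least squares weights -/

section LeastSquares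

variable {ι κ : Type*} [Fintype κ]

lemma sum_vecMulVec_mulVec (J : Finset ι) (ξ : ι → κ → ℝ) (u : κ → ℝ) :
    (∑ j ∈ J, Matrix.vecMulVec (ξ j) (ξ j)).mulVec u = ∑ j ∈ J, (ξ j ⬝ᵥ u) • ξ j := by
  rw [Matrix.sum_mulVec]
  refine Finset.sum_congr rfl fun j _ => ?_
  rw [Matrix.vecMulVec_mulVec]
  ext k
  simp [mul_comm]

variable [DecidableEq κ]

/-- The sum is `M M⁻¹ e_{k₀}`. In terms of polynomials: the fit reproduces the value at the centre
of every polynomial in the fitted space. -/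
lemma sum_leastSquares_smul (J : Finset ι) (ξ : ι → κ → ℝ) (k₀ : κ)
    (hM : IsUnit (∑ j ∈ J, Matrix.vecMulVec (ξ j) (ξ j)).det) :
    ∑ i ∈ J, ((∑ j ∈ J, Matrix.vecMulVec (ξ j) (ξ j))⁻¹.mulVec (ξ i) k₀) • ξ i
      = Pi.single k₀ 1 := by
  set M := ∑ j ∈ J, Matrix.vecMulVec (ξ j) (ξ j) with hMdef
  have hT : M.transpose = M := by
    rw [hMdef, Matrix.transpose_sum]
    exact Finset.sum_congr rfl fun j _ => Matrix.transpose_vecMulVec _ _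
  have h : ∀ i, M⁻¹.mulVec (ξ i) k₀ = ξ i ⬝ᵥ (M⁻¹ k₀) := fun i => by
    rw [Matrix.mulVec, dotProduct_comm]
  simp only [h]
  rw [← sum_vecMulVec_mulVec, ← hMdef, ← hT, Matrix.mulVec_transpose, hT]
  have : M⁻¹ k₀ = Matrix.vecMul (Pi.single k₀ 1) M⁻¹ := by
    rw [Matrix.single_one_vecMul]
    rfl
  rw [this, Matrix.vecMul_vecMul, Matrix.nonsing_inv_mul _ hM, Matrix.vecMul_one]

/-- Gauss–Markov: among reproducing weights, those of least squares have minimal `ℓ²` norm. Pairing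
both representations of `e_{k₀}` with `M⁻¹ e_{k₀}` shows that `∑ a w` and `∑ w²` are the same
number, and `2 a w ≤ a² + w²` finishes. -/
lemma sum_sq_leastSquares_le (J : Finset ι) (ξ : ι → κ → ℝ) (k₀ : κ) {β : Type*} [Fintype β]
    (f : β → ι) (hf : Function.Injective f) (hfJ : ∀ l, f l ∈ J) (a : β → ℝ)
    (ha : ∑ l, a l • ξ (f l) = Pi.single k₀ 1) :
    ∑ i ∈ J, ((∑ j ∈ J, Matrix.vecMulVec (ξ j) (ξ j))⁻¹.mulVec (ξ i) k₀) ^ 2 ≤ ∑ l, a l ^ 2 := by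
  by_cases hM : IsUnit (∑ j ∈ J, Matrix.vecMulVec (ξ j) (ξ j)).det
  · have hrep := sum_leastSquares_smul J ξ k₀ hM
    set M := ∑ j ∈ J, Matrix.vecMulVec (ξ j) (ξ j)
    set w : ι → ℝ := fun i => M⁻¹.mulVec (ξ i) k₀ with hw
    have h : ∀ i, w i = ξ i ⬝ᵥ (M⁻¹ k₀) := fun i => dotProduct_comm _ _
    have h1 : ∑ l, a l * w (f l) = M⁻¹ k₀ k₀ := by
      have := congrArg (fun w => w ⬝ᵥ (M⁻¹ k₀)) ha
      simp only [sum_dotProduct, smul_dotProduct, single_dotProduct, one_mul] at this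
      rw [← this]
      exact Finset.sum_congr rfl fun i _ => by rw [h]; simp
    have h2 : ∑ i ∈ J, w i ^ 2 = M⁻¹ k₀ k₀ := by
      have := congrArg (fun w => w ⬝ᵥ (M⁻¹ k₀)) hrep
      simp only [sum_dotProduct, smul_dotProduct, single_dotProduct, one_mul] at this
      rw [← this]
      exact Finset.sum_congr rfl fun i _ => by rw [sq, h, smul_eq_mul, ← h i]
    have h3 : ∑ l, w (f l) ^ 2 ≤ ∑ i ∈ J, w i ^ 2 := by
      classical
      rw [← Finset.sum_image (f := fun i => w i ^ 2) (s := Finset.univ) (g := f) hf.injOn]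
      refine Finset.sum_le_sum_of_subset_of_nonneg ?_ fun _ _ _ => sq_nonneg _
      intro i hi
      obtain ⟨l, -, rfl⟩ := Finset.mem_image.1 hi
      exact hfJ l
    have h4 : ∑ l, a l * w (f l) ≤ ∑ l, (a l ^ 2 / 2 + w (f l) ^ 2 / 2) :=
      Finset.sum_le_sum fun l _ => by nlinarith [sq_nonneg (a l - w (f l))]
    rw [Finset.sum_add_distrib, ← Finset.sum_div, ← Finset.sum_div] at h4
    linarith
  -- For singular `M` the inverse is `0` by convention, so all weights vanish.
  · rw [Matrix.nonsing_inv_apply_not_isUnit _ hM]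
    simp only [Matrix.zero_mulVec, Pi.zero_apply]
    have : 0 ≤ ∑ l, a l ^ 2 := Finset.sum_nonneg fun _ _ => sq_nonneg _
    simpa using this

/-- The quadratic form of the matrix at `u` is `∑ (ξ_i · u)²`. -/
lemma isUnit_det_sum_vecMulVec (J : Finset ι) (ξ : ι → κ → ℝ)
    (h : ∀ u : κ → ℝ, (∀ i ∈ J, ξ i ⬝ᵥ u = 0) → u = 0) :
    IsUnit (∑ j ∈ J, Matrix.vecMulVec (ξ j) (ξ j)).det := by
  rw [isUnit_iff_ne_zero]
  intro h0
  obtain ⟨u, hu, hMu⟩ := Matrix.exists_mulVec_eq_zero_iff.2 h0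
  refine hu (h u ?_)
  rw [sum_vecMulVec_mulVec] at hMu
  have h1 := congrArg (fun w => w ⬝ᵥ u) hMu
  simp only [sum_dotProduct, smul_dotProduct, zero_dotProduct, smul_eq_mul] at h1
  intro i hi
  have := (Finset.sum_eq_zero_iff_of_nonneg (fun i _ => mul_self_nonneg _)).1 h1 i hi
  simpa using this

end LeastSquares

/-! ### Generic Vandermonde determinants -/

section Vandermonde

variable {ι : Type*} {d L : ℕ}

lemma multiIndices_le (κ : multiIndices d L) (k : Fin d) : κ.1 k ≤ L := by
  have := κ.2
  simp only [multiIndices, Finset.mem_filter, Fintype.mem_piFinset, Finset.mem_range] at this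
  have := this.1 k
  omega

lemma multiIndices_sum_le (κ : multiIndices d L) : ∑ k, κ.1 k ≤ L := by
  have := κ.2
  simp only [multiIndices, Finset.mem_filter] at this
  exact this.2

lemma mem_multiIndices {κ : Fin d → ℕ} (h : ∑ k, κ k ≤ L) : κ ∈ multiIndices d L := by
  simp only [multiIndices, Finset.mem_filter, Fintype.mem_piFinset, Finset.mem_range]
  refine ⟨fun k => ?_, h⟩
  have := Finset.single_le_sum (f := κ) (fun i _ => Nat.zero_le _) (Finset.mem_univ k)
  omega

/-- The exponent vector of the monomial `∏ₗ x_{e l}^{σ l}`. -/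
def vandermondeExponent (e : multiIndices d L → ι) (σ : Equiv.Perm (multiIndices d L)) :
    ι × Fin d →₀ ℕ :=
  ∑ l, ∑ k, Finsupp.single (e l, k) ((σ l).1 k)

/-- The determinant of all monomials of degree at most `L`, evaluated at the points `e l`,
as a polynomial in the coordinates of the points. -/
def vandermondePoly (e : multiIndices d L → ι) : MvPolynomial (ι × Fin d) ℝ :=
  (Matrix.of fun κ l : multiIndices d L =>
    ∏ k, (MvPolynomial.X (e l, k) : MvPolynomial (ι × Fin d) ℝ) ^ κ.1 k).det

lemma vandermondePoly_eq (e : multiIndices d L → ι) :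
    vandermondePoly e = ∑ σ : Equiv.Perm (multiIndices d L),
      MvPolynomial.monomial (vandermondeExponent e σ) ((Equiv.Perm.sign σ : ℤ) : ℝ) := by
  rw [vandermondePoly, Matrix.det_apply']
  refine Finset.sum_congr rfl fun σ _ => ?_
  simp only [Matrix.of_apply]
  have : MvPolynomial.monomial (vandermondeExponent e σ) ((Equiv.Perm.sign σ : ℤ) : ℝ)
      = MvPolynomial.C ((Equiv.Perm.sign σ : ℤ) : ℝ) *
        MvPolynomial.monomial (vandermondeExponent e σ) 1 := by
    rw [MvPolynomial.C_mul_monomial, mul_one]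
  rw [this, vandermondeExponent, MvPolynomial.monomial_sum_one]
  congr 1
  · simp
    refine Finset.prod_congr rfl fun l _ => ?_
    rw [MvPolynomial.monomial_sum_one]
    exact Finset.prod_congr rfl fun k _ => by rw [MvPolynomial.X_pow_eq_monomial]

lemma vandermondeExponent_apply [DecidableEq ι] (e : multiIndices d L → ι)
    (σ : Equiv.Perm (multiIndices d L)) (i : ι) (k : Fin d) :
    vandermondeExponent e σ (i, k) = ∑ l, if e l = i then (σ l).1 k else 0 := by
  rw [vandermondeExponent, Finsupp.finsetSum_apply]
  refine Finset.sum_congr rfl fun l _ => ?_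
  rw [Finsupp.finsetSum_apply]
  simp only [Finsupp.single_apply, Prod.mk.injEq]
  by_cases h : e l = i <;> simp [h]

/-- No cancellation occurs in the Leibniz expansion: as the points are distinct variables, the
exponents at the point `e l` recover `σ l`, so different permutations give different monomials. -/
lemma vandermondePoly_ne_zero (e : multiIndices d L → ι) (he : Function.Injective e) :
    vandermondePoly e ≠ 0 := by
  classical
  have hinj : ∀ σ : Equiv.Perm (multiIndices d L),
      vandermondeExponent e σ = vandermondeExponent e 1 → σ = 1 := by
    intro σ h
    ext l k
    have h1 := DFunLike.congr_fun h (e l, k)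
    rw [vandermondeExponent_apply, vandermondeExponent_apply] at h1
    simpa [he.eq_iff] using h1
  intro h0
  have h1 := congrArg (MvPolynomial.coeff (vandermondeExponent e 1)) h0
  rw [vandermondePoly_eq, MvPolynomial.coeff_sum, Finset.sum_eq_single 1] at h1
  · simp at h1
  · intro σ _ hσ
    rw [MvPolynomial.coeff_monomial, if_neg fun h => hσ (hinj σ h)]
  · simp

lemma degreeOf_vandermondePoly_le [DecidableEq ι] (e : multiIndices d L → ι) (i : ι)
    (k : Fin d) :
    (vandermondePoly e).degreeOf (i, k) ≤ ∑ l, if e l = i then L else 0 := by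
  rw [vandermondePoly_eq]
  refine (MvPolynomial.degreeOf_sum_le _ _ _).trans (Finset.sup_le fun σ _ => ?_)
  have h0 : ((Equiv.Perm.sign σ : ℤ) : ℝ) ≠ 0 := by simp
  rw [MvPolynomial.degreeOf_monomial_eq _ _ h0, vandermondeExponent_apply]
  refine Finset.sum_le_sum fun l _ => ?_
  split_ifs
  · exact multiIndices_le _ _
  · exact le_rfl

lemma eval_vandermondePoly (e : multiIndices d L → ι) (x : ι × Fin d → ℝ) :
    MvPolynomial.eval x (vandermondePoly e)
      = (Matrix.of fun κ l : multiIndices d L => ∏ k, x (e l, k) ^ κ.1 k).det := by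
  rw [vandermondePoly, RingHom.map_det]
  congr 1
  ext κ l
  simp

/-- The groups are disjoint, so each coordinate variable occurs in at most one factor and the bound
`L` on the individual degrees does not grow with `m`. Taking many groups therefore makes the
exponent `2/m` small at no cost in degree. -/
lemma prod_vandermondePoly [Fintype ι] {m : ℕ} (e : Fin m × multiIndices d L → ι)
    (he : Function.Injective e) :
    (∏ g, vandermondePoly fun l => e (g, l)) ≠ 0 ∧
      ∀ q, (∏ g, vandermondePoly fun l => e (g, l)).degreeOf q ≤ L := by
  classical
  refine ⟨Finset.prod_ne_zero_iff.2 fun g _ => vandermondePoly_ne_zero _ fun a b h => ?_, ?_⟩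
  · simpa using he h
  · rintro ⟨i, k⟩
    refine (MvPolynomial.degreeOf_prod_le _ _ _).trans
      ((Finset.sum_le_sum fun g _ => degreeOf_vandermondePoly_le _ i k).trans ?_)
    rw [← Finset.sum_product', Finset.univ_product_univ, ← Finset.sum_filter, Finset.sum_const,
      smul_eq_mul]
    refine (Nat.mul_le_mul_right L ?_).trans (one_mul L).le
    refine Finset.card_le_one.2 fun a ha b hb => he ?_
    simp only [Finset.mem_filter, Finset.mem_univ, true_and, Prod.mk.eta] at ha hb
    rw [ha, hb]

/-- Cramer's rule: each entry of the adjugate is a determinant with entries at most `1` in absolute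
value, hence at most the factorial of the size. -/
lemma exists_solution_sum_sq_le {κ : Type*} [Fintype κ] [DecidableEq κ] (V : Matrix κ κ ℝ)
    (hV : V.det ≠ 0) (hV1 : ∀ i j, |V i j| ≤ 1) (k₀ : κ) :
    ∃ a : κ → ℝ, V.mulVec a = Pi.single k₀ 1 ∧
      ∑ l, a l ^ 2 ≤ (Fintype.card κ * ((Fintype.card κ).factorial : ℝ) ^ 2) / V.det ^ 2 := by
  refine ⟨V⁻¹.mulVec (Pi.single k₀ 1), ?_, ?_⟩
  · rw [Matrix.mulVec_mulVec, Matrix.mul_nonsing_inv _ (isUnit_iff_ne_zero.2 hV),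
      Matrix.one_mulVec]
  · have h1 : ∀ l, (V⁻¹.mulVec (Pi.single k₀ 1)) l ^ 2
        ≤ ((Fintype.card κ).factorial : ℝ) ^ 2 / V.det ^ 2 := by
      intro l
      rw [Matrix.mulVec_single_one, Matrix.col_apply, Matrix.inv_def, Ring.inverse_eq_inv',
        Matrix.smul_apply, smul_eq_mul, mul_pow, inv_pow, ← div_eq_inv_mul]
      gcongr ?_ / _
      rw [← sq_abs (V.adjugate l k₀)]
      gcongr
      rw [Matrix.adjugate_apply]
      have := Matrix.det_le (A := V.updateRow k₀ (Pi.single l 1))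
        (abv := (AbsoluteValue.abs : AbsoluteValue ℝ ℝ)) (x := 1) ?_
      · simpa using this
      · intro i j
        simp only [AbsoluteValue.abs_apply, Matrix.updateRow_apply]
        split_ifs
        · by_cases h : j = l
          · subst h; simp
          · simp [h]
        · exact hV1 i j
    refine (Finset.sum_le_sum fun l _ => h1 l).trans (le_of_eq ?_)
    rw [Finset.sum_const, Finset.card_univ, nsmul_eq_mul, mul_div_assoc]

end Vandermonde

/-! ### Weights of the local polynomial fit -/

section Fit

variable {d n : ℕ}

/-- The weight of the `i`-th response in the value at `z` of the local polynomial fit. -/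
def fitWeight (L : ℕ) (Z : Fin n → Space d) (J : Finset (Fin n)) (z : Space d) (i : Fin n) : ℝ :=
  (designMatrix L Z J z)⁻¹.mulVec (monomials L z (Z i)) (zeroIndex d L)

/-- The sum of the squared weights of the local polynomial fit. -/
def fitSq (L : ℕ) (Z : Fin n → Space d) (J : Finset (Fin n)) (z : Space d) : ℝ :=
  ∑ i ∈ J, fitWeight L Z J z i ^ 2

/-- The scaled coordinates of points relative to a centre. -/
def scaledCoord {ι : Type*} (y : ι → Space d) (r : ℝ) (q : ι × Fin d) : ℝ := y q.1 q.2 / r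

lemma sum_fitWeight_mul_monomials (L : ℕ) (Z : Fin n → Space d) (J : Finset (Fin n))
    (z : Space d) (hM : IsUnit (designMatrix L Z J z).det) (κ : multiIndices d L) :
    ∑ i ∈ J, fitWeight L Z J z i * monomials L z (Z i) κ
      = if κ = zeroIndex d L then 1 else 0 := by
  have := congrFun (sum_leastSquares_smul J (fun j => monomials L z (Z j)) (zeroIndex d L) hM) κ
  rw [Finset.sum_apply, Pi.single_apply] at this
  exact this

/-- Exact interpolation on any one of the `m` groups gives reproducing weights whose squared norm is
at most a constant over the squared determinant of that group. The least squares weights do at least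
as well as every group, hence as their geometric mean. -/
lemma fitSq_le_vandermonde {L m : ℕ} (hm : 0 < m) {ι : Type*} [Fintype ι]
    (e : Fin m × multiIndices d L → ι) (he : Function.Injective e) (Z : Fin n → Space d)
    (J : Finset (Fin n)) (f : ι → Fin n) (hf : Function.Injective f) (hfJ : ∀ i, f i ∈ J)
    (z : Space d) {r : ℝ} (hr : 0 < r) (hZ : ∀ i k, |(Z (f i) - z) k| ≤ r)
    (hp : MvPolynomial.eval (scaledCoord (fun i => Z (f i) - z) r)
      (∏ g, vandermondePoly fun l => e (g, l)) ≠ 0) :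
    IsUnit (designMatrix L Z J z).det ∧
    fitSq L Z J z ≤ (polyDim d L * ((polyDim d L).factorial : ℝ) ^ 2) *
      |MvPolynomial.eval (scaledCoord (fun i => Z (f i) - z) r)
        (∏ g, vandermondePoly fun l => e (g, l))| ^ (-(2 / m : ℝ)) := by
  set x := scaledCoord (fun i => Z (f i) - z) r with hx
  set C : ℝ := polyDim d L * ((polyDim d L).factorial : ℝ) ^ 2 with hC
  set V : Fin m → Matrix (multiIndices d L) (multiIndices d L) ℝ := fun g =>
    Matrix.of fun κ l => ∏ k, x (e (g, l), k) ^ κ.1 k with hV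
  have hev : MvPolynomial.eval x (∏ g, vandermondePoly fun l => e (g, l)) = ∏ g, (V g).det := by
    rw [map_prod]
    exact Finset.prod_congr rfl fun g _ => eval_vandermondePoly _ _
  rw [hev] at hp ⊢
  have hdet : ∀ g, (V g).det ≠ 0 := fun g => (Finset.prod_ne_zero_iff.1 hp) g (Finset.mem_univ g)
  have hV1 : ∀ g κ l, |V g κ l| ≤ 1 := by
    intro g κ l
    simp only [hV, Matrix.of_apply, Finset.abs_prod, abs_pow]
    refine Finset.prod_le_one (fun _ _ => by positivity) fun k _ => ?_
    refine pow_le_one₀ (abs_nonneg _) ?_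
    rw [hx, scaledCoord, abs_div, abs_of_pos hr, div_le_one hr]
    exact hZ _ _
  have hmono : ∀ g κ l, monomials L z (Z (f (e (g, l)))) κ = r ^ (∑ k, κ.1 k) * V g κ l := by
    intro g κ l
    simp only [monomials, hV, Matrix.of_apply, hx, scaledCoord]
    rw [← Finset.prod_pow_eq_pow_sum, ← Finset.prod_mul_distrib]
    refine Finset.prod_congr rfl fun k _ => ?_
    rw [← mul_pow, mul_div_cancel₀ _ hr.ne']
    simp
  refine ⟨?_, ?_⟩
  · refine isUnit_det_sum_vecMulVec J (fun j => monomials L z (Z j)) fun u hu => ?_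
    have h1 : (V ⟨0, hm⟩).transpose.mulVec (fun κ => r ^ (∑ k, κ.1 k) * u κ) = 0 := by
      ext l
      have := hu (f (e (⟨0, hm⟩, l))) (hfJ _)
      simp only [dotProduct, hmono] at this
      simp only [Matrix.mulVec, dotProduct, Matrix.transpose_apply, Pi.zero_apply]
      rw [← this]
      exact Finset.sum_congr rfl fun κ _ => by ring
    by_contra hu0
    refine hdet ⟨0, hm⟩ ?_
    rw [← Matrix.det_transpose]
    refine Matrix.exists_mulVec_eq_zero_iff.1 ⟨_, fun h => hu0 ?_, h1⟩
    ext κ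
    have := congrFun h κ
    simpa [hr.ne'] using this
  · have hg : ∀ g, fitSq L Z J z ≤ C / (V g).det ^ 2 := by
      intro g
      obtain ⟨a, ha, hale⟩ := exists_solution_sum_sq_le (V g) (hdet g) (hV1 g) (zeroIndex d L)
      refine (sum_sq_leastSquares_le J (fun j => monomials L z (Z j)) (zeroIndex d L)
        (fun l => f (e (g, l))) (fun l l' h => ?_) (fun l => hfJ _) a ?_).trans
        (hale.trans (le_of_eq ?_))
      · simpa using he (hf h)
      · ext κ
        have := congrFun ha κ
        simp only [Matrix.mulVec, dotProduct] at this
        simp only [Finset.sum_apply, Pi.smul_apply, smul_eq_mul, hmono]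
        have h2 : ∑ l, a l * (r ^ (∑ k, κ.1 k) * V g κ l)
            = r ^ (∑ k, κ.1 k) * ∑ l, V g κ l * a l := by
          rw [Finset.mul_sum]
          exact Finset.sum_congr rfl fun _ _ => by ring
        rw [h2, this]
        -- Scaling multiplies row `κ` by `r ^ |κ|`. The right-hand side is nonzero only for `κ = 0`,
        -- where this factor is `1`, so the same coefficients solve the unscaled system.
        by_cases hκ : κ = zeroIndex d L
        · subst hκ; simp [zeroIndex]
        · simp [hκ]
      · simp [hC, polyDim]
    have hQ0 : 0 ≤ fitSq L Z J z := Finset.sum_nonneg fun _ _ => sq_nonneg _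
    have hC0 : 0 ≤ C := by positivity
    -- A number below each of `m` bounds has its `m`-th power below their product.
    have hpow : fitSq L Z J z ^ m ≤ C ^ m * (|∏ g, (V g).det| ^ 2)⁻¹ := by
      calc fitSq L Z J z ^ m = ∏ _g : Fin m, fitSq L Z J z := by simp
        _ ≤ ∏ g, (C / (V g).det ^ 2) := Finset.prod_le_prod (fun _ _ => hQ0) fun g _ => hg g
        _ = _ := by
          rw [Finset.prod_div_distrib, Finset.prod_const, Finset.card_univ, Fintype.card_fin,
            sq_abs, ← Finset.prod_pow, div_eq_mul_inv]
    have hab : 0 < |∏ g, (V g).det| := abs_pos.2 hp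
    refine le_of_pow_le_pow_left₀ hm.ne' (by positivity) (hpow.trans (le_of_eq ?_))
    rw [mul_pow C, ← Real.rpow_natCast (|∏ g, (V g).det| ^ (-(2 / m : ℝ))), ← Real.rpow_mul hab.le,
      ← Real.rpow_natCast _ 2, ← Real.rpow_neg hab.le]
    congr 2
    have : (m : ℝ) ≠ 0 := by exact_mod_cast hm.ne'
    field_simp
    norm_num

end Fit

/-! ### Product measures -/

lemma measure_pi_mono {ι : Type*} [Fintype ι] {X : ι → Type*} [∀ i, MeasurableSpace (X i)]
    {μ ν : ∀ i, Measure (X i)} [∀ i, SigmaFinite (μ i)] [∀ i, SigmaFinite (ν i)]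
    (h : ∀ i, μ i ≤ ν i) : Measure.pi μ ≤ Measure.pi ν := by
  rw [Measure.le_iff]
  intro s hs
  have hle : OuterMeasure.pi (fun i => (μ i).toOuterMeasure)
      ≤ OuterMeasure.pi (fun i => (ν i).toOuterMeasure) := by
    rw [OuterMeasure.le_pi]
    intro t ht
    refine (OuterMeasure.pi_pi_le _ t).trans ?_
    exact Finset.prod_le_prod' fun i _ => h i (t i)
  rw [Measure.pi_def, Measure.pi_def, toMeasure_apply _ _ hs, toMeasure_apply _ _ hs]
  exact hle s

lemma volume_preserving_coords (ι : Type*) [Fintype ι] (d : ℕ) :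
    MeasurePreserving (fun (y : ι → Space d) (q : ι × Fin d) => y q.1 q.2) volume volume := by
  have h1 : MeasurePreserving (fun (y : ι → Space d) (i : ι) => (y i : Fin d → ℝ))
      volume volume :=
    measurePreserving_pi (fun _ => volume) (fun _ => volume)
      fun _ => PiLp.volume_preserving_ofLp (Fin d)
  have h2 : MeasurePreserving (fun (y : ι → Fin d → ℝ) (q : ι × Fin d) => y q.1 q.2)
      volume volume := by
    refine ⟨by fun_prop, ?_⟩
    refine (Measure.pi_eq fun s hs => ?_).symm
    rw [Measure.map_apply (by fun_prop) (MeasurableSet.univ_pi hs)]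
    have : (fun (y : ι → Fin d → ℝ) (q : ι × Fin d) => y q.1 q.2) ⁻¹' (Set.univ.pi s)
        = Set.univ.pi fun i => Set.univ.pi fun k => s (i, k) := by
      ext y
      simp [Set.mem_pi]
    rw [this, volume_pi, Measure.pi_pi, ← Finset.univ_product_univ, Finset.prod_product]
    simp_rw [volume_pi, Measure.pi_pi]
  exact h2.comp h1

lemma lintegral_prod_pi {ι X : Type*} [Fintype ι] [MeasurableSpace X] (μ : Measure X)
    [IsProbabilityMeasure μ] (g : ι → X → ENNReal) (hg : ∀ i, Measurable (g i)) :
    ∫⁻ x : ι → X, ∏ i, g i (x i) ∂(Measure.pi fun _ => μ) = ∏ i, ∫⁻ x, g i x ∂μ := by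
  have hind : iIndepFun (fun i (x : ι → X) => g i (x i)) (Measure.pi fun _ => μ) :=
    iIndepFun_pi (μ := fun _ => μ) fun i => (hg i).aemeasurable
  have := lintegral_prod_eq_prod_lintegral_of_indepFun Finset.univ
    (fun i (x : ι → X) => g i (x i)) hind fun i => (hg i).comp (measurable_pi_apply i)
  rw [this]
  refine Finset.prod_congr rfl fun i _ => ?_
  exact (measurePreserving_eval (fun _ : ι => μ) i).lintegral_comp (hg i)

/-- Integration over the coordinates outside of `J` when the integrand is a product. -/
lemma lintegral_pi_split {ι κ X : Type*} [Fintype ι] [DecidableEq ι] [Fintype κ]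
    [MeasurableSpace X] (μ : Measure X) [IsProbabilityMeasure μ] (J : Finset ι)
    (e : κ ≃ {i // i ∈ J}) (F : (κ → X) → ENNReal) (hF : Measurable F)
    (g : (κ → X) → X → ENNReal) (hg : Measurable (Function.uncurry g)) :
    ∫⁻ Z : ι → X, F (fun i => Z (e i)) * ∏ k ∈ Jᶜ, g (fun i => Z (e i)) (Z k)
        ∂(Measure.pi fun _ => μ)
      = ∫⁻ w : κ → X, F w * (∫⁻ x, g w x ∂μ) ^ (Jᶜ.card) ∂(Measure.pi fun _ => μ) := by
  have hmp := measurePreserving_piEquivPiSubtypeProd (fun _ : ι => μ) (fun i => i ∈ J)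
  set G : ({i // i ∈ J} → X) × ({i // i ∉ J} → X) → ENNReal := fun q =>
    F (fun i => q.1 (e i)) * ∏ k, g (fun i => q.1 (e i)) (q.2 k) with hG
  have hGm : Measurable G := by
    refine (hF.comp (by fun_prop)).mul (Finset.measurable_prod _ fun k _ => ?_)
    exact hg.comp (f := fun q : ({i // i ∈ J} → X) × ({i // i ∉ J} → X) =>
      ((fun i => q.1 (e i)), q.2 k)) (by fun_prop)
  have h1 : ∀ Z : ι → X, F (fun i => Z (e i)) * ∏ k ∈ Jᶜ, g (fun i => Z (e i)) (Z k)
      = G (MeasurableEquiv.piEquivPiSubtypeProd (fun _ => X) (fun i => i ∈ J) Z) := by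
    intro Z
    simp only [hG, MeasurableEquiv.piEquivPiSubtypeProd, MeasurableEquiv.coe_mk,
      Equiv.piEquivPiSubtypeProd_apply]
    congr 1
    exact Finset.prod_subtype Jᶜ (by simp) (fun k => g (fun i => Z (e i)) (Z k))
  simp_rw [h1]
  rw [hmp.lintegral_comp hGm, lintegral_prod _ hGm.aemeasurable]
  have h2 : ∀ q : {i // i ∈ J} → X, ∫⁻ r, G (q, r) ∂(Measure.pi fun _ => μ)
      = F (fun i => q (e i)) * (∫⁻ x, g (fun i => q (e i)) x ∂μ) ^ Jᶜ.card := by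
    intro q
    simp only [hG]
    rw [lintegral_const_mul, lintegral_prod_pi μ]
    · rw [Finset.prod_const, Finset.card_univ, Fintype.card_subtype_compl, Finset.card_compl]
      simp
    · exact fun _ => hg.comp measurable_prodMk_left
    · exact Finset.measurable_prod _ fun k _ => (hg.comp measurable_prodMk_left).comp
        (measurable_pi_apply k)
  simp_rw [h2]
  have hmp2 := measurePreserving_piCongrLeft (fun _ : κ => μ) e.symm
  have hHm : Measurable fun w : κ → X => F w * (∫⁻ x, g w x ∂μ) ^ Jᶜ.card :=
    hF.mul ((hg.lintegral_prod_right').pow_const _)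
  rw [← hmp2.lintegral_comp hHm]
  have h3 : ∀ q : {i // i ∈ J} → X,
      (MeasurableEquiv.piCongrLeft (fun _ : κ => X) e.symm) q = fun i => q (e i) := by
    intro q
    ext i
    obtain ⟨j, rfl⟩ := e.symm.surjective i
    simp [MeasurableEquiv.piCongrLeft, Equiv.piCongrLeft_apply_apply]
  simp_rw [h3]
  congr!

/-- Given one point, a tie forces the other onto a sphere centred at `z`, which is a Lebesgue null
set. -/
lemma ae_pi_dist_ne {n d : ℕ} (hd : 1 ≤ d) (μ : Measure (Space d)) [IsProbabilityMeasure μ]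
    (hμ : μ ≪ volume) (z : Space d) :
    ∀ᵐ Z : Fin n → Space d ∂(Measure.pi fun _ => μ), ∀ i k, i ≠ k → ‖z - Z i‖ ≠ ‖z - Z k‖ := by
  rw [ae_all_iff]; intro i
  rw [ae_all_iff]; intro k
  by_cases hik : i = k
  · exact Eventually.of_forall fun _ h => absurd hik h
  have : Nonempty (Fin d) := ⟨⟨0, hd⟩⟩
  have hind : iIndepFun (fun i (x : Fin n → Space d) => x i) (Measure.pi fun _ => μ) :=
    iIndepFun_pi (μ := fun _ => μ) (X := fun _ x => x) fun i => aemeasurable_id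
  have hpair := (indepFun_iff_map_prod_eq_prod_map_map (measurable_pi_apply i).aemeasurable
    (measurable_pi_apply k).aemeasurable).1 (hind.indepFun hik)
  rw [(measurePreserving_eval (fun _ : Fin n => μ) i).map_eq,
    (measurePreserving_eval (fun _ : Fin n => μ) k).map_eq] at hpair
  have hset : MeasurableSet {q : Space d × Space d | ‖z - q.1‖ = ‖z - q.2‖} :=
    measurableSet_eq_fun (by fun_prop) (by fun_prop)
  have h0 : (μ.prod μ) {q : Space d × Space d | ‖z - q.1‖ = ‖z - q.2‖} = 0 := by
    rw [Measure.measure_prod_null hset]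
    refine Eventually.of_forall fun x => ?_
    have : Prod.mk x ⁻¹' {q : Space d × Space d | ‖z - q.1‖ = ‖z - q.2‖}
        = Metric.sphere z ‖z - x‖ := by
      ext y
      simp [eq_comm, norm_sub_rev y z]
    simp only [this, Pi.zero_apply]
    exact hμ (Measure.addHaar_sphere volume z _)
  rw [← hpair, Measure.map_apply (by fun_prop) hset] at h0
  refine (measure_eq_zero_iff_ae_notMem.1 h0).mono fun Z hZ _ => ?_
  simpa using hZ

/-! ### Moments of the local fit -/

section Core

variable {d n : ℕ}

/-- The sum of the squared weights, set to `∞` for a singular design. -/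
def fitSqTop (L : ℕ) (Z : Fin n → Space d) (J : Finset (Fin n)) (z : Space d) : ENNReal :=
  if (designMatrix L Z J z).det ≠ 0 then ENNReal.ofReal (fitSq L Z J z) else ⊤

/-- The largest distance from `z` to the points with index in `J`. -/
def radius (Z : Fin n → Space d) (J : Finset (Fin n)) (z : Space d) : ℝ :=
  ‖fun j : J => Z j - z‖

lemma radius_nonneg (Z : Fin n → Space d) (J : Finset (Fin n)) (z : Space d) :
    0 ≤ radius Z J z := norm_nonneg _

lemma norm_sub_le_radius (Z : Fin n → Space d) {J : Finset (Fin n)} (z : Space d) {j : Fin n}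
    (hj : j ∈ J) : ‖Z j - z‖ ≤ radius Z J z :=
  norm_le_pi_norm (fun j : J => Z j - z) ⟨j, hj⟩

lemma radius_eq_norm_comp (Z : Fin n → Space d) (J : Finset (Fin n)) (z : Space d) {κ : Type*}
    [Fintype κ] (e : κ ≃ {i // i ∈ J}) : radius Z J z = ‖fun i => Z (e i) - z‖ := by
  refine le_antisymm ?_ ?_
  · refine (pi_norm_le_iff_of_nonneg (norm_nonneg _)).2 fun j => ?_
    have := norm_le_pi_norm (fun i => Z (e i) - z) (e.symm j)
    simpa using this
  · exact (pi_norm_le_iff_of_nonneg (norm_nonneg _)).2 fun i =>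
      norm_sub_le_radius Z z (e i).2

/-- The negative power of a polynomial in the coordinates of the points, scaled by `r`. -/
def polyWeight {K : ℕ} (p : MvPolynomial (Fin K × Fin d) ℝ) (s r : ℝ) (y : Fin K → Space d) :
    ENNReal :=
  ‖MvPolynomial.eval (scaledCoord y r) p‖ₑ ^ (-s)

lemma measurable_polyWeight {K : ℕ} (p : MvPolynomial (Fin K × Fin d) ℝ) (s r : ℝ) :
    Measurable (polyWeight p s r : (Fin K → Space d) → ENNReal) := by
  refine (Measurable.enorm ?_).pow_const _
  refine (MvPolynomial.continuous_eval p).measurable.comp ?_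
  unfold scaledCoord
  fun_prop

/-- The substitution `y = r u` produces the Jacobian `r ^ (K d)` and maps the ball into the cube
`[-1, 1]^(K d)`, where the negative power of `p` is integrable. -/
lemma exists_lintegral_polyWeight_le {K L : ℕ} (p : MvPolynomial (Fin K × Fin d) ℝ) (hp : p ≠ 0)
    (hdeg : ∀ i, p.degreeOf i ≤ L) {s : ℝ} (hs : 0 < s) (hsL : s * L < 1) :
    ∃ B : ENNReal, B ≠ ⊤ ∧ ∀ r : ℝ, 0 < r →
      ∫⁻ y in Metric.closedBall (0 : Fin K → Space d) r, polyWeight p s r y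
        ≤ ENNReal.ofReal (r ^ (K * d)) * B := by
  refine ⟨_, (lintegral_mvPolynomial_lt_top L hs hsL p hp hdeg).ne, fun r hr => ?_⟩
  have hF : Measurable fun x : Fin K × Fin d → ℝ => (Set.univ.pi fun _ => Set.Icc (-1 : ℝ) 1).indicator
      (fun x => ‖MvPolynomial.eval x p‖ₑ ^ (-s)) x :=
    (((MvPolynomial.continuous_eval p).measurable.enorm).pow_const _).indicator
      (MeasurableSet.univ_pi fun _ => measurableSet_Icc)
  have h1 : ∀ y : Fin K → Space d, (Metric.closedBall (0 : Fin K → Space d) r).indicator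
      (polyWeight p s r) y ≤ (Set.univ.pi fun _ => Set.Icc (-1 : ℝ) 1).indicator
      (fun x => ‖MvPolynomial.eval x p‖ₑ ^ (-s))
        (fun q : Fin K × Fin d => (r⁻¹ • y) q.1 q.2) := by
    intro y
    by_cases hy : y ∈ Metric.closedBall (0 : Fin K → Space d) r
    · rw [Set.indicator_of_mem hy, Set.indicator_of_mem]
      · refine le_of_eq ?_
        unfold polyWeight scaledCoord
        congr! 4 with q
        simp [div_eq_inv_mul]
      · rintro q -
        rw [mem_closedBall_zero_iff] at hy
        have h2 : |y q.1 q.2| ≤ r :=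
          ((PiLp.norm_apply_le (y q.1) q.2).trans (norm_le_pi_norm y q.1)).trans hy
        have h3 : |r⁻¹ * y q.1 q.2| ≤ 1 := by
          rw [abs_mul, abs_of_pos (inv_pos.2 hr), inv_mul_le_one₀ hr]
          exact h2
        simpa using abs_le.1 h3
    · rw [Set.indicator_of_notMem hy]
      exact zero_le
  have hfin : Module.finrank ℝ (Fin K → Space d) = K * d := by
    simp [Module.finrank_pi_fintype]
  calc ∫⁻ y in Metric.closedBall (0 : Fin K → Space d) r, polyWeight p s r y
      = ∫⁻ y, (Metric.closedBall (0 : Fin K → Space d) r).indicator (polyWeight p s r) y := by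
        rw [lintegral_indicator Metric.isClosed_closedBall.measurableSet]
    _ ≤ ∫⁻ y : Fin K → Space d, (Set.univ.pi fun _ => Set.Icc (-1 : ℝ) 1).indicator
      (fun x => ‖MvPolynomial.eval x p‖ₑ ^ (-s))
        (fun q : Fin K × Fin d => (r⁻¹ • y) q.1 q.2) := lintegral_mono h1
    _ = ENNReal.ofReal (r ^ (K * d)) * ∫⁻ y : Fin K → Space d,
        (Set.univ.pi fun _ => Set.Icc (-1 : ℝ) 1).indicator
      (fun x => ‖MvPolynomial.eval x p‖ₑ ^ (-s)) (fun q : Fin K × Fin d => y q.1 q.2) := by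
        have h4 := Measure.map_addHaar_smul (volume : Measure (Fin K → Space d))
          (inv_ne_zero hr.ne')
        have h5 := lintegral_map (μ := (volume : Measure (Fin K → Space d)))
          (f := fun y : Fin K → Space d => (Set.univ.pi fun _ => Set.Icc (-1 : ℝ) 1).indicator
          (fun x => ‖MvPolynomial.eval x p‖ₑ ^ (-s)) (fun q : Fin K × Fin d => y q.1 q.2))
          (g := fun y => r⁻¹ • y) (hF.comp (by fun_prop)) (by fun_prop)
        rw [← h5, h4, lintegral_smul_measure, hfin, smul_eq_mul]
        congr 2
        rw [inv_pow, inv_inv, abs_of_pos (by positivity)]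
    _ = ENNReal.ofReal (r ^ (K * d)) * ∫⁻ x : Fin K × Fin d → ℝ,
        (Set.univ.pi fun _ => Set.Icc (-1 : ℝ) 1).indicator
      (fun x => ‖MvPolynomial.eval x p‖ₑ ^ (-s)) x := by
        rw [← (volume_preserving_coords (Fin K) d).lintegral_comp hF]
    _ = _ := by
        rw [lintegral_indicator (MeasurableSet.univ_pi fun _ => measurableSet_Icc), volume_pi,
          Measure.restrict_pi_pi]

/-- The contribution of the shell `k ≤ τ‖y‖ ≤ k + 1`. -/
def shellTerm {K : ℕ} (p : MvPolynomial (Fin K × Fin d) ℝ) (s τ : ℝ) (k : ℕ)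
    (y : Fin K → Space d) : ENNReal :=
  {y : Fin K → Space d | (k : ℝ) ≤ τ * ‖y‖ ∧ ‖y‖ ≤ (k + 1) / τ}.indicator
    (polyWeight p s ((k + 1) / τ)) y

lemma measurableSet_shell {K : ℕ} (τ : ℝ) (k : ℕ) :
    MeasurableSet {y : Fin K → Space d | (k : ℝ) ≤ τ * ‖y‖ ∧ ‖y‖ ≤ (k + 1) / τ} :=
  (measurableSet_le measurable_const (measurable_norm.const_mul τ)).inter
    (measurableSet_le measurable_norm measurable_const)

lemma measurable_shellTerm {K : ℕ} (p : MvPolynomial (Fin K × Fin d) ℝ) (s τ : ℝ) (k : ℕ) :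
    Measurable (shellTerm p s τ k : (Fin K → Space d) → ENNReal) :=
  (measurable_polyWeight p s _).indicator (measurableSet_shell τ k)

/-- A dominating function for the squared weights of the local fit. -/
def shellSum {K : ℕ} (p : MvPolynomial (Fin K × Fin d) ℝ) (s C : ℝ) (N : ℕ) (τ : ℝ)
    (y : Fin K → Space d) : ENNReal :=
  ∑' k : ℕ, ENNReal.ofReal ((k + 2) ^ N * C) * shellTerm p s τ k y

lemma measurable_shellSum {K : ℕ} (p : MvPolynomial (Fin K × Fin d) ℝ) (s C : ℝ) (N : ℕ)
    (τ : ℝ) : Measurable (shellSum p s C N τ : (Fin K → Space d) → ENNReal) :=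
  Measurable.tsum fun k => (measurable_shellTerm p s τ k).const_mul _

/-- The natural scale `‖y‖` is random. Freezing it at the outer radius `(k + 1) / τ` of the shell
containing `y` leaves a fixed polynomial at a deterministic scale, to be integrated over a ball, and
`1 + τ‖y‖ ≤ k + 2` there. -/
lemma fitSqTop_le_shellSum {K L m : ℕ} (hm : 0 < m) (g : Fin m × multiIndices d L → Fin K)
    (hg : Function.Injective g) (N : ℕ) {τ : ℝ} (hτ : 0 < τ) (Z : Fin n → Space d)
    (J : Finset (Fin n)) (e : Fin K ≃ {i // i ∈ J}) (z : Space d) :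
    ENNReal.ofReal ((1 + τ * radius Z J z) ^ N) * fitSqTop L Z J z
      ≤ shellSum (∏ a, vandermondePoly fun l => g (a, l)) (2 / m)
        (polyDim d L * ((polyDim d L).factorial : ℝ) ^ 2) N τ (fun i => Z (e i) - z) := by
  set C : ℝ := polyDim d L * ((polyDim d L).factorial : ℝ) ^ 2 with hC
  set p := ∏ a, vandermondePoly fun l => g (a, l) with hp
  set y : Fin K → Space d := fun i => Z (e i) - z with hy
  have hCpos : 0 < C := by
    have : 0 < polyDim d L := Finset.card_pos.2 ⟨_, (zeroIndex d L).2⟩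
    positivity
  have hR : radius Z J z = ‖y‖ := radius_eq_norm_comp Z J z e
  rw [hR]
  set k := ⌊τ * ‖y‖⌋₊ with hk
  have hk1 : (k : ℝ) ≤ τ * ‖y‖ := Nat.floor_le (by positivity)
  have hk2 : τ * ‖y‖ ≤ k + 1 := (Nat.lt_floor_add_one _).le
  have hr : (0 : ℝ) < (k + 1) / τ := by positivity
  have hyr : ‖y‖ ≤ (k + 1) / τ := by rw [le_div_iff₀ hτ]; linarith
  refine le_trans ?_ (ENNReal.le_tsum k)
  have hmem : y ∈ {y : Fin K → Space d | (k : ℝ) ≤ τ * ‖y‖ ∧ ‖y‖ ≤ (k + 1) / τ} := ⟨hk1, hyr⟩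
  rw [shellTerm, Set.indicator_of_mem hmem, ENNReal.ofReal_mul (by positivity), mul_assoc]
  refine mul_le_mul' (ENNReal.ofReal_le_ofReal ?_) ?_
  · gcongr ?_ ^ N
    linarith
  · unfold polyWeight
    by_cases h0 : MvPolynomial.eval (scaledCoord y ((k + 1) / τ)) p = 0
    · have hs : (0 : ℝ) < 2 / m := by positivity
      rw [h0, enorm_zero, ENNReal.zero_rpow_of_neg (by linarith), ENNReal.mul_top]
      · exact le_top
      · simpa using hCpos
    · obtain ⟨hdet, hle⟩ := fitSq_le_vandermonde hm g hg Z J (fun i => (e i : Fin n))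
        (fun i i' h => e.injective (Subtype.ext h)) (fun i => (e i).2) z hr
        (fun i k => ((PiLp.norm_apply_le _ k).trans (norm_le_pi_norm y i)).trans hyr) h0
      rw [fitSqTop, if_pos hdet.ne_zero]
      refine (ENNReal.ofReal_le_ofReal hle).trans (le_of_eq ?_)
      rw [ENNReal.ofReal_mul hCpos.le, Real.enorm_eq_ofReal_abs,
        ENNReal.ofReal_rpow_of_pos (abs_pos.2 h0)]

/-- Shell `k` contributes `τ ^ (-K d)` times a power of `k + 2`, a power of `k + 1` and `exp(-c k)`,
so the series over the shells converges with a sum independent of `τ`. -/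
lemma exists_lintegral_shellSum_le (hd : 1 ≤ d) {K L : ℕ} (p : MvPolynomial (Fin K × Fin d) ℝ)
    (hp : p ≠ 0) (hdeg : ∀ i, p.degreeOf i ≤ L) {s : ℝ} (hs : 0 < s) (hsL : s * L < 1)
    {C c : ℝ} (hC : 0 ≤ C) (hc : 0 < c) (N : ℕ) :
    ∃ B : ENNReal, B ≠ ⊤ ∧ ∀ τ : ℝ, 0 < τ →
      ∫⁻ y : Fin K → Space d, shellSum p s C N τ y *
        ENNReal.ofReal (Real.exp (-(c * (τ * ‖y‖) ^ d)))
        ≤ ENNReal.ofReal ((τ ^ (K * d))⁻¹) * B := by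
  obtain ⟨B, hB, hBr⟩ := exists_lintegral_polyWeight_le p hp hdeg hs hsL
  have hsum : Summable fun k : ℕ => ((k : ℝ) + 2) ^ N * C * Real.exp (-(c * k)) *
      (k + 1) ^ (K * d) := by
    have h1 := Real.summable_pow_mul_exp_neg_nat_mul (N + K * d) hc
    have h2 := ((summable_nat_add_iff 2).2 h1).mul_left (C * Real.exp (2 * c))
    refine Summable.of_nonneg_of_le (fun k => by positivity) (fun k => ?_) h2
    have h3 : Real.exp (-(c * k)) = Real.exp (2 * c) * Real.exp (-c * ((k + 2 : ℕ) : ℝ)) := by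
      rw [← Real.exp_add]; congr 1; push_cast; ring
    rw [h3, pow_add]
    push_cast
    have h4 : ((k : ℝ) + 1) ^ (K * d) ≤ ((k : ℝ) + 2) ^ (K * d) := by gcongr; norm_num
    calc ((k : ℝ) + 2) ^ N * C * (Real.exp (2 * c) * Real.exp (-c * ((k : ℝ) + 2))) *
      (k + 1) ^ (K * d) ≤ ((k : ℝ) + 2) ^ N * C * (Real.exp (2 * c) *
        Real.exp (-c * ((k : ℝ) + 2))) * (k + 2) ^ (K * d) := by gcongr
      _ = _ := by ring
  refine ⟨ENNReal.ofReal (∑' k : ℕ, ((k : ℝ) + 2) ^ N * C * Real.exp (-(c * k)) *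
      (k + 1) ^ (K * d)) * B, ENNReal.mul_ne_top ENNReal.ofReal_ne_top hB, fun τ hτ => ?_⟩
  have hE : Measurable fun y : Fin K → Space d =>
      ENNReal.ofReal (Real.exp (-(c * (τ * ‖y‖) ^ d))) := by fun_prop
  simp only [shellSum, ← ENNReal.tsum_mul_right]
  rw [lintegral_tsum fun k => by
    exact (((measurable_shellTerm p s τ k).const_mul _).mul hE).aemeasurable]
  have hterm : ∀ k : ℕ, ∫⁻ y : Fin K → Space d, ENNReal.ofReal ((k + 2) ^ N * C) *
      shellTerm p s τ k y * ENNReal.ofReal (Real.exp (-(c * (τ * ‖y‖) ^ d)))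
      ≤ ENNReal.ofReal ((k + 2) ^ N * C * Real.exp (-(c * k)) * (k + 1) ^ (K * d)) *
        (ENNReal.ofReal ((τ ^ (K * d))⁻¹) * B) := by
    intro k
    have hr : (0 : ℝ) < (k + 1) / τ := by positivity
    have hpt : ∀ y : Fin K → Space d, ENNReal.ofReal ((k + 2) ^ N * C) *
        shellTerm p s τ k y * ENNReal.ofReal (Real.exp (-(c * (τ * ‖y‖) ^ d)))
        ≤ ENNReal.ofReal ((k + 2) ^ N * C * Real.exp (-(c * k))) *
          (Metric.closedBall (0 : Fin K → Space d) ((k + 1) / τ)).indicator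
            (polyWeight p s ((k + 1) / τ)) y := by
      intro y
      by_cases hy : y ∈ {y : Fin K → Space d | (k : ℝ) ≤ τ * ‖y‖ ∧ ‖y‖ ≤ (k + 1) / τ}
      · rw [shellTerm, Set.indicator_of_mem hy, Set.indicator_of_mem (by simpa using hy.2),
          ENNReal.ofReal_mul (by positivity : (0 : ℝ) ≤ (k + 2) ^ N * C), mul_right_comm]
        gcongr
        -- Only geometric decay in `k` is needed, so the `d`-th power in the exponent is given up.
        have hk : (k : ℝ) ≤ (k : ℝ) ^ d := by
          exact_mod_cast Nat.le_self_pow (by omega) k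
        exact hk.trans (pow_le_pow_left₀ (by positivity) hy.1 d)
      · rw [shellTerm, Set.indicator_of_notMem hy]
        simp
    refine (lintegral_mono hpt).trans ?_
    rw [lintegral_const_mul' _ _ ENNReal.ofReal_ne_top,
      lintegral_indicator Metric.isClosed_closedBall.measurableSet]
    refine (mul_le_mul_right (hBr _ hr) _).trans (le_of_eq ?_)
    rw [div_pow, div_eq_mul_inv,
      ENNReal.ofReal_mul (by positivity : (0 : ℝ) ≤ (k + 1) ^ (K * d)),
      ENNReal.ofReal_mul (by positivity : (0 : ℝ) ≤ (k + 2) ^ N * C * Real.exp (-(c * k)))]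
    ring
  refine (ENNReal.tsum_le_tsum hterm).trans ?_
  rw [ENNReal.tsum_mul_right, ← ENNReal.ofReal_tsum_of_nonneg (fun k => by positivity) hsum]
  refine le_of_eq ?_
  ring

lemma measure_pi_le_smul {K : ℕ} (μ : Measure (Space d)) [SigmaFinite μ] (S : Set (Space d))
    {c : ENNReal} (hc : c ≠ ⊤) (hμ : μ ≤ c • volume.restrict S) :
    Measure.pi (fun _ : Fin K => μ) ≤ c ^ K • volume := by
  have h0 : μ ≤ c • volume :=
    hμ.trans (by gcongr; exact Measure.restrict_le_self)
  lift c to NNReal using hc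
  have h1 : Measure.pi (fun _ : Fin K => c • (volume : Measure (Space d)))
      = (c : ENNReal) ^ K • volume := by
    refine Measure.pi_eq fun s hs => ?_
    rw [Measure.smul_apply, volume_pi, Measure.pi_pi, smul_eq_mul]
    simp_rw [Measure.smul_apply, ENNReal.smul_def, smul_eq_mul]
    rw [Finset.prod_mul_distrib, Finset.prod_const, Finset.card_univ, Fintype.card_fin]
  rw [← h1]
  exact measure_pi_mono fun _ => h0

/-- Uniform moment bound for the local polynomial fit on the `K` nearest design points. -/
lemma exists_lintegral_fitSqTop_le (hd : 1 ≤ d) {K L m : ℕ} (hm : 0 < m)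
    (hmK : m * polyDim d L ≤ K) (hmL : 2 * L < m) (μ : Measure (Space d)) [IsProbabilityMeasure μ]
    (S Sstar : Set (Space d)) (hS : MeasurableSet S) {cmax : ENNReal} (hcmax : cmax ≠ ⊤)
    (hμ : μ ≤ cmax • volume.restrict S) {c₀ Rmax : ℝ} (hc₀ : 0 < c₀)
    (hRmax : ∀ w ∈ S, ∀ z ∈ Sstar, ‖w - z‖ ≤ Rmax)
    (hball : ∀ z ∈ Sstar, ∀ ρ, 0 ≤ ρ → ρ ≤ Rmax →
      ENNReal.ofReal (c₀ * ρ ^ d) ≤ μ (Metric.closedBall z ρ)) (N : ℕ) :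
    ∃ B : ENNReal, B ≠ ⊤ ∧ ∀ (n : ℕ) (τ : ℝ), K ≤ n → 0 < τ → τ ^ d = n → ∀ z ∈ Sstar,
      ∑ J ∈ Finset.powersetCard K (Finset.univ : Finset (Fin n)),
      ∫⁻ Z : Fin n → Space d, (cell Sstar Z J).indicator (fun z =>
        ENNReal.ofReal ((1 + τ * radius Z J z) ^ N) * fitSqTop L Z J z) z
          ∂(Measure.pi fun _ => μ) ≤ B := by
  classical
  obtain ⟨g⟩ : Nonempty (Fin m × multiIndices d L ↪ Fin K) :=
    Function.Embedding.nonempty_of_card_le (by simpa [polyDim] using hmK)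
  obtain ⟨hp, hdeg⟩ := prod_vandermondePoly g g.injective
  set p := ∏ a, vandermondePoly fun l => g (a, l) with hpdef
  set C : ℝ := polyDim d L * ((polyDim d L).factorial : ℝ) ^ 2 with hC
  have hm' : (0 : ℝ) < m := by exact_mod_cast hm
  have hsL : (2 / m : ℝ) * L < 1 := by
    rw [div_mul_eq_mul_div, div_lt_one hm']
    exact_mod_cast hmL
  obtain ⟨B, hB, hBτ⟩ := exists_lintegral_shellSum_le hd p hp hdeg (by positivity) hsL
    (C := C) (by positivity) hc₀ N
  -- The exponential factor pays for replacing the exponent `n - K`, the number of points outside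
  -- `J`, by `n`.
  refine ⟨cmax ^ K * ENNReal.ofReal (Real.exp (c₀ * K * Rmax ^ d)) * B, ?_, ?_⟩
  · exact ENNReal.mul_ne_top (ENNReal.mul_ne_top (ENNReal.pow_ne_top hcmax)
      ENNReal.ofReal_ne_top) hB
  intro n τ hn hτ hτn z hz
  have hterm : ∀ J ∈ Finset.powersetCard K (Finset.univ : Finset (Fin n)),
      ∫⁻ Z : Fin n → Space d, (cell Sstar Z J).indicator (fun z =>
        ENNReal.ofReal ((1 + τ * radius Z J z) ^ N) * fitSqTop L Z J z) z
          ∂(Measure.pi fun _ => μ)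
        ≤ cmax ^ K * ENNReal.ofReal (Real.exp (c₀ * K * Rmax ^ d)) *
          (ENNReal.ofReal ((τ ^ (K * d))⁻¹) * B) := by
    intro J hJ
    have hcard : J.card = K := (Finset.mem_powersetCard.1 hJ).2
    set e : Fin K ≃ {i // i ∈ J} := (J.equivFinOfCardEq hcard).symm
    set Ψ : (Fin K → Space d) → ENNReal := shellSum p (2 / m) C N τ with hΨ
    have hΨm : Measurable Ψ := measurable_shellSum _ _ _ _ _
    set F : (Fin K → Space d) → ENNReal := fun w => Ψ (fun i => w i - z) with hF
    have hFm : Measurable F := hΨm.comp (by fun_prop)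
    set G : (Fin K → Space d) → Space d → ENNReal := fun w x =>
      {q : (Fin K → Space d) × Space d | ‖fun i => q.1 i - z‖ < ‖q.2 - z‖}.indicator 1 (w, x)
      with hG
    have hGset : MeasurableSet
        {q : (Fin K → Space d) × Space d | ‖fun i => q.1 i - z‖ < ‖q.2 - z‖} :=
      measurableSet_lt (by fun_prop) (by fun_prop)
    have hGm : Measurable (Function.uncurry G) := measurable_one.indicator hGset
    have hGint : ∀ w, ∫⁻ x, G w x ∂μ = 1 - μ (Metric.closedBall z ‖fun i => w i - z‖) := by
      intro w
      have h1 : ∀ x, G w x = (Metric.closedBall z ‖fun i => w i - z‖)ᶜ.indicator 1 x := by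
        intro x
        simp only [hG, Set.indicator_apply, Set.mem_ofPred_eq, Set.mem_compl_iff,
          Metric.mem_closedBall, dist_eq_norm, not_le, Pi.one_apply]
      simp_rw [h1]
      rw [lintegral_indicator_one Metric.isClosed_closedBall.measurableSet.compl,
        prob_compl_eq_one_sub Metric.isClosed_closedBall.measurableSet]
    -- If `z` lies in the cell of `J`, every point outside `J` is farther from `z` than all points
    -- of `J`. The bound thus becomes a function of the points in `J` times a product over the
    -- others, which are independent of them.
    have hpt : ∀ Z : Fin n → Space d, (cell Sstar Z J).indicator (fun z =>
        ENNReal.ofReal ((1 + τ * radius Z J z) ^ N) * fitSqTop L Z J z) z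
        ≤ F (fun i => Z (e i)) * ∏ k ∈ Jᶜ, G (fun i => Z (e i)) (Z k) := by
      intro Z
      by_cases hzc : z ∈ cell Sstar Z J
      · rw [Set.indicator_of_mem hzc]
        have h1 : ∏ k ∈ Jᶜ, G (fun i => Z (e i)) (Z k) = 1 := by
          refine Finset.prod_eq_one fun k hk => ?_
          simp only [hG]
          rw [Set.indicator_of_mem]
          · rfl
          · change ‖fun i => Z (e i) - z‖ < ‖Z k - z‖
            have hpos : ∀ i : Fin K, ‖Z (e i) - z‖ < ‖Z k - z‖ := fun i => by
              rw [norm_sub_rev, norm_sub_rev (Z k)]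
              exact hzc.2 _ (e i).2 k (by simpa using hk)
            have hK : 0 < K := by
              refine lt_of_lt_of_le (Nat.mul_pos hm ?_) hmK
              exact Finset.card_pos.2 ⟨_, (zeroIndex d L).2⟩
            exact (pi_norm_lt_iff (lt_of_le_of_lt (norm_nonneg _) (hpos ⟨0, hK⟩))).2 hpos
        rw [h1, mul_one]
        exact fitSqTop_le_shellSum hm g g.injective N hτ Z J e z
      · rw [Set.indicator_of_notMem hzc]
        exact zero_le
    refine (lintegral_mono hpt).trans ?_
    rw [lintegral_pi_split μ J e F hFm G hGm, Finset.card_compl, hcard, Fintype.card_fin]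
    -- Almost surely the design stays in `S`, so the radius is at most `Rmax`, the range in which
    -- the lower bound on ball masses is available.
    have hSae : ∀ᵐ w ∂(Measure.pi fun _ : Fin K => μ), ∀ i, w i ∈ S := by
      rw [ae_all_iff]
      intro i
      have hμS : ∀ᵐ x ∂μ, x ∈ S := by
        have h2 : μ ≪ volume.restrict S :=
          (Measure.absolutelyContinuous_of_le hμ).trans Measure.smul_absolutelyContinuous
        exact h2 (ae_restrict_mem hS)
      exact (measurePreserving_eval (fun _ : Fin K => μ) i).quasiMeasurePreserving.ae hμS
    set E : (Fin K → Space d) → ENNReal := fun y =>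
      ENNReal.ofReal (Real.exp (-(c₀ * (τ * ‖y‖) ^ d))) with hE
    have hbd : ∀ᵐ w ∂(Measure.pi fun _ : Fin K => μ),
        F w * (∫⁻ x, G w x ∂μ) ^ (n - K) ≤ ENNReal.ofReal (Real.exp (c₀ * K * Rmax ^ d)) *
          (Ψ (fun i => w i - z) * E (fun i => w i - z)) := by
      filter_upwards [hSae] with w hw
      have hR : ‖fun i => w i - z‖ ≤ Rmax := by
        have hK0 : 0 ≤ Rmax := by
          have hK : 0 < K := by
            refine lt_of_lt_of_le (Nat.mul_pos hm ?_) hmK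
            exact Finset.card_pos.2 ⟨_, (zeroIndex d L).2⟩
          exact (norm_nonneg _).trans (hRmax _ (hw ⟨0, hK⟩) z hz)
        exact (pi_norm_le_iff_of_nonneg hK0).2 fun i => hRmax _ (hw i) z hz
      set ρ := ‖fun i => w i - z‖ with hρ
      have hρ0 : 0 ≤ ρ := norm_nonneg _
      -- The mass outside the ball is at most `1 - t ≤ exp(-t)` with `t = c₀ ρ ^ d`.
      have h1 : ∫⁻ x, G w x ∂μ ≤ ENNReal.ofReal (Real.exp (-(c₀ * ρ ^ d))) := by
        rw [hGint]
        refine (tsub_le_tsub_left (hball z hz ρ hρ0 hR) 1).trans ?_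
        rw [← ENNReal.ofReal_one, ← ENNReal.ofReal_sub _ (by positivity)]
        refine ENNReal.ofReal_le_ofReal ?_
        have := Real.add_one_le_exp (-(c₀ * ρ ^ d))
        linarith
      have h2 : (∫⁻ x, G w x ∂μ) ^ (n - K) ≤ ENNReal.ofReal (Real.exp (c₀ * K * Rmax ^ d)) *
          E (fun i => w i - z) := by
        refine (pow_le_pow_left₀ zero_le h1 _).trans ?_
        rw [hE, ← ENNReal.ofReal_pow (Real.exp_nonneg _), ← ENNReal.ofReal_mul (Real.exp_nonneg _),
          ← Real.exp_nat_mul, ← Real.exp_add]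
        refine ENNReal.ofReal_le_ofReal (Real.exp_le_exp.2 ?_)
        rw [← hρ, mul_pow, hτn, Nat.cast_sub hn]
        have h3 : ρ ^ d ≤ Rmax ^ d := pow_le_pow_left₀ hρ0 hR d
        have h4 : c₀ * K * ρ ^ d ≤ c₀ * K * Rmax ^ d := by gcongr
        linarith
      calc F w * (∫⁻ x, G w x ∂μ) ^ (n - K)
          ≤ F w * (ENNReal.ofReal (Real.exp (c₀ * K * Rmax ^ d)) * E (fun i => w i - z)) := by
            gcongr
        _ = _ := by simp only [hF]; ring
    refine (lintegral_mono_ae hbd).trans ?_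
    refine (lintegral_mono' (measure_pi_le_smul μ S hcmax hμ) le_rfl).trans ?_
    rw [lintegral_smul_measure, lintegral_const_mul' _ _ ENNReal.ofReal_ne_top, smul_eq_mul]
    refine (mul_le_mul' le_rfl (mul_le_mul' le_rfl ?_)).trans_eq (mul_assoc _ _ _).symm
    have htr := lintegral_sub_right_eq_self (μ := (volume : Measure (Fin K → Space d)))
      (fun y => Ψ y * E y) (fun _ => z)
    refine (le_of_eq ?_).trans (hBτ τ hτ)
    rw [← htr]
    rfl
  refine (Finset.sum_le_sum hterm).trans ?_
  rw [Finset.sum_const, Finset.card_powersetCard, Finset.card_univ, Fintype.card_fin, nsmul_eq_mul]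
  have hτK : τ ^ (K * d) = (n : ℝ) ^ K := by rw [mul_comm, pow_mul, hτn]
  -- The number of index sets `J` is at most `n ^ K = τ ^ (K d)`, which the volume scale `τ ^ (-K
  -- d)` of `K` points near `z` cancels exactly.
  have h5 : ((n.choose K : ℕ) : ENNReal) * ENNReal.ofReal ((τ ^ (K * d))⁻¹) ≤ 1 := by
    rw [hτK, ← ENNReal.ofReal_natCast, ← ENNReal.ofReal_mul (by positivity), ENNReal.ofReal_le_one]
    have hnpos : (0 : ℝ) < (n : ℝ) ^ K := by rw [← hτK]; positivity
    rw [← div_eq_mul_inv, div_le_one hnpos]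
    exact_mod_cast Nat.choose_le_pow n K
  calc _ = (((n.choose K : ℕ) : ENNReal) * ENNReal.ofReal ((τ ^ (K * d))⁻¹)) *
        (cmax ^ K * ENNReal.ofReal (Real.exp (c₀ * K * Rmax ^ d)) * B) := by ring
    _ ≤ 1 * (cmax ^ K * ENNReal.ofReal (Real.exp (c₀ * K * Rmax ^ d)) * B) := by gcongr
    _ = _ := one_mul _

end Core

/-! ### Measurability of the local fit -/

section Measurability

variable {d n : ℕ}

lemma continuous_monomials (L : ℕ) (i : Fin n) :
    Continuous fun q : (Fin n → Space d) × Space d => monomials L q.2 (q.1 i) := by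
  unfold monomials
  fun_prop

lemma continuous_designMatrix (L : ℕ) (J : Finset (Fin n)) :
    Continuous fun q : (Fin n → Space d) × Space d => designMatrix L q.1 J q.2 := by
  unfold designMatrix
  exact continuous_finsetSum _ fun j _ =>
    (continuous_monomials L j).matrix_vecMulVec (continuous_monomials L j)

/-- Writing the inverse as the adjugate over the determinant, with `0⁻¹ = 0`, gives measurability
also across singular designs. -/
lemma measurable_fitWeight (L : ℕ) (J : Finset (Fin n)) (i : Fin n) :
    Measurable fun q : (Fin n → Space d) × Space d => fitWeight L q.1 J q.2 i := by
  have h : ∀ q : (Fin n → Space d) × Space d, fitWeight L q.1 J q.2 i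
      = ∑ κ, ((designMatrix L q.1 J q.2).det)⁻¹ *
        (designMatrix L q.1 J q.2).adjugate (zeroIndex d L) κ * monomials L q.2 (q.1 i) κ := by
    intro q
    simp only [fitWeight, Matrix.inv_def, Ring.inverse_eq_inv', Matrix.mulVec, dotProduct,
      Matrix.smul_apply, smul_eq_mul]
  simp_rw [h]
  have hM := continuous_designMatrix (d := d) (n := n) L J
  refine Finset.measurable_sum _ fun κ _ => ((hM.matrix_det.measurable.inv).mul ?_).mul ?_
  · exact ((hM.matrix_adjugate).matrix_elem _ _).measurable
  · exact ((continuous_apply κ).comp (continuous_monomials L i)).measurable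

lemma measurable_fitSq (L : ℕ) (J : Finset (Fin n)) :
    Measurable fun q : (Fin n → Space d) × Space d => fitSq L q.1 J q.2 :=
  Finset.measurable_sum _ fun i _ => (measurable_fitWeight L J i).pow_const 2

lemma measurable_fitSqTop (L : ℕ) (J : Finset (Fin n)) :
    Measurable fun q : (Fin n → Space d) × Space d => fitSqTop L q.1 J q.2 := by
  unfold fitSqTop
  refine Measurable.ite ?_ (measurable_fitSq L J).ennreal_ofReal measurable_const
  exact (measurableSet_eq_fun (continuous_designMatrix L J).matrix_det.measurable
    measurable_const).compl

lemma measurable_radius (J : Finset (Fin n)) :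
    Measurable fun q : (Fin n → Space d) × Space d => radius q.1 J q.2 := by
  unfold radius
  fun_prop

lemma measurableSet_cell {Sstar : Set (Space d)} (hS : MeasurableSet Sstar) (J : Finset (Fin n)) :
    MeasurableSet {q : (Fin n → Space d) × Space d | q.2 ∈ cell Sstar q.1 J} := by
  have : {q : (Fin n → Space d) × Space d | q.2 ∈ cell Sstar q.1 J}
      = {q | q.2 ∈ Sstar} ∩ ⋂ j ∈ J, ⋂ k ∈ Jᶜ,
        {q : (Fin n → Space d) × Space d | ‖q.2 - q.1 j‖ < ‖q.2 - q.1 k‖} := by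
    ext q
    simp [cell]
  rw [this]
  refine (measurable_snd hS).inter (Finset.measurableSet_biInter _ fun j _ =>
    Finset.measurableSet_biInter _ fun k _ => measurableSet_lt (by fun_prop) (by fun_prop))

end Measurability

/-! ### The weights of the nearest neighbour estimator -/

section Weights

variable {d n : ℕ}

/-- The weight of the `i`-th response at the point `z`. -/
def totalWeight (L K : ℕ) (Sstar : Set (Space d)) (Z : Fin n → Space d) (z : Space d)
    (i : Fin n) : ℝ :=
  ∑ J ∈ Finset.powersetCard K (Finset.univ : Finset (Fin n)),
    (cell Sstar Z J).indicator (fun z => if i ∈ J then fitWeight L Z J z i else 0) z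

/-- The squared weights at `z` together with a power of the nearest neighbour radius. -/
def nnMoment (L K N : ℕ) (τ : ℝ) (Sstar : Set (Space d)) (Z : Fin n → Space d) (z : Space d) :
    ENNReal :=
  ∑ J ∈ Finset.powersetCard K (Finset.univ : Finset (Fin n)),
    (cell Sstar Z J).indicator (fun z =>
      ENNReal.ofReal ((1 + τ * radius Z J z) ^ N) * fitSqTop L Z J z) z

/-- The weight of the `i`-th response in the estimator of the integral functional. -/
def intWeight (L K : ℕ) (Sstar : Set (Space d)) (Z : Fin n → Space d) (i : Fin n) : ℝ :=
  ∫ z in Sstar, totalWeight L K Sstar Z z i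

lemma measurable_totalWeight (L K : ℕ) {Sstar : Set (Space d)} (hS : MeasurableSet Sstar)
    (i : Fin n) :
    Measurable fun q : (Fin n → Space d) × Space d => totalWeight L K Sstar q.1 q.2 i := by
  unfold totalWeight
  refine Finset.measurable_sum _ fun J _ => ?_
  have : (fun q : (Fin n → Space d) × Space d => (cell Sstar q.1 J).indicator
      (fun z => if i ∈ J then fitWeight L q.1 J z i else 0) q.2)
      = {q : (Fin n → Space d) × Space d | q.2 ∈ cell Sstar q.1 J}.indicator
        fun q => if i ∈ J then fitWeight L q.1 J q.2 i else 0 := by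
    ext q
    rfl
  rw [this]
  refine Measurable.indicator ?_ (measurableSet_cell hS J)
  split_ifs
  · exact measurable_fitWeight L J i
  · exact measurable_const

lemma measurable_nnMoment_term (L N : ℕ) (τ : ℝ) {Sstar : Set (Space d)}
    (hS : MeasurableSet Sstar) (J : Finset (Fin n)) :
    Measurable fun q : (Fin n → Space d) × Space d => (cell Sstar q.1 J).indicator (fun z =>
      ENNReal.ofReal ((1 + τ * radius q.1 J z) ^ N) * fitSqTop L q.1 J z) q.2 := by
  have : (fun q : (Fin n → Space d) × Space d => (cell Sstar q.1 J).indicator (fun z =>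
      ENNReal.ofReal ((1 + τ * radius q.1 J z) ^ N) * fitSqTop L q.1 J z) q.2)
      = {q : (Fin n → Space d) × Space d | q.2 ∈ cell Sstar q.1 J}.indicator
        fun q => ENNReal.ofReal ((1 + τ * radius q.1 J q.2) ^ N) * fitSqTop L q.1 J q.2 := by
    ext q
    rfl
  rw [this]
  refine Measurable.indicator ?_ (measurableSet_cell hS J)
  refine Measurable.mul ?_ (measurable_fitSqTop L J)
  have := measurable_radius (d := d) (n := n) J
  fun_prop

lemma measurable_nnMoment (L K N : ℕ) (τ : ℝ) {Sstar : Set (Space d)}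
    (hS : MeasurableSet Sstar) :
    Measurable fun q : (Fin n → Space d) × Space d => nnMoment L K N τ Sstar q.1 q.2 :=
  Finset.measurable_sum _ fun J _ => measurable_nnMoment_term L N τ hS J

lemma measurable_intWeight (L K : ℕ) {Sstar : Set (Space d)} (hS : MeasurableSet Sstar)
    (i : Fin n) : Measurable fun Z : Fin n → Space d => intWeight L K Sstar Z i :=
  ((measurable_totalWeight L K hS i).stronglyMeasurable.integral_prod_right
    (ν := volume.restrict Sstar)).measurable

/-- Distinct sets of equal size each contain an index missing from the other, and these two indices
would have to be strictly ordered both ways. So at most one term of any sum over cells is nonzero at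
a given point. -/
lemma cell_unique {Sstar : Set (Space d)} {Z : Fin n → Space d} {J J' : Finset (Fin n)}
    {z : Space d} (hcard : J.card = J'.card) (h : z ∈ cell Sstar Z J) (h' : z ∈ cell Sstar Z J') :
    J = J' := by
  by_contra hne
  have h1 : ¬ J ⊆ J' := fun hs => hne (Finset.eq_of_subset_of_card_le hs hcard.ge)
  have h2 : ¬ J' ⊆ J := fun hs => hne (Finset.eq_of_subset_of_card_le hs hcard.le).symm
  obtain ⟨j, hj, hj'⟩ := Finset.not_subset.1 h1
  obtain ⟨k, hk, hk'⟩ := Finset.not_subset.1 h2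
  exact lt_asymm (h.2 j hj k hk') (h'.2 k hk j hj')

lemma sum_cell_indicator_eq {M : Type*} [AddCommMonoid M] {K : ℕ} {Sstar : Set (Space d)}
    {Z : Fin n → Space d} {J : Finset (Fin n)} (hJ : J.card = K) {z : Space d}
    (hz : z ∈ cell Sstar Z J) (f : Finset (Fin n) → Space d → M) :
    ∑ J' ∈ Finset.powersetCard K (Finset.univ : Finset (Fin n)),
      (cell Sstar Z J').indicator (f J') z = f J z := by
  rw [Finset.sum_eq_single J]
  · exact Set.indicator_of_mem hz _
  · intro J' hJ' hne
    refine Set.indicator_of_notMem (fun hz' => hne ?_) _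
    exact cell_unique ((Finset.mem_powersetCard.1 hJ').2.trans hJ.symm) hz' hz
  · intro h
    exact absurd (Finset.mem_powersetCard.2 ⟨Finset.subset_univ _, hJ⟩) h

lemma sum_cell_indicator_eq_zero {M : Type*} [AddCommMonoid M] {K : ℕ} {Sstar : Set (Space d)}
    {Z : Fin n → Space d} {z : Space d}
    (hz : ∀ J : Finset (Fin n), J.card = K → z ∉ cell Sstar Z J)
    (f : Finset (Fin n) → Space d → M) :
    ∑ J' ∈ Finset.powersetCard K (Finset.univ : Finset (Fin n)),
      (cell Sstar Z J').indicator (f J') z = 0 :=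
  Finset.sum_eq_zero fun J hJ =>
    Set.indicator_of_notMem (hz J (Finset.mem_powersetCard.1 hJ).2) _

lemma ofReal_fitSq_le_fitSqTop (L : ℕ) (Z : Fin n → Space d) (J : Finset (Fin n)) (z : Space d) :
    ENNReal.ofReal (fitSq L Z J z) ≤ fitSqTop L Z J z := by
  unfold fitSqTop
  split_ifs
  · exact le_rfl
  · exact le_top

lemma fitSq_nonneg (L : ℕ) (Z : Fin n → Space d) (J : Finset (Fin n)) (z : Space d) :
    0 ≤ fitSq L Z J z := Finset.sum_nonneg fun _ _ => sq_nonneg _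

lemma ofReal_rpow_mul_fitSq_le_nnMoment {L K N N' : ℕ} (hN : N' ≤ N) {τ : ℝ} (hτ : 0 < τ)
    {Sstar : Set (Space d)} {Z : Fin n → Space d} {J : Finset (Fin n)} (hJ : J.card = K)
    {z : Space d} (hz : z ∈ cell Sstar Z J) :
    ENNReal.ofReal ((1 + τ * radius Z J z) ^ N' * fitSq L Z J z)
      ≤ nnMoment L K N τ Sstar Z z := by
  have hR := radius_nonneg Z J z
  rw [nnMoment, sum_cell_indicator_eq hJ hz, ENNReal.ofReal_mul (by positivity)]
  gcongr
  · nlinarith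
  · exact ofReal_fitSq_le_fitSqTop L Z J z

/-- The weights at two points overlap only if the points are close. -/
lemma sum_totalWeight_mul_le {L K M : ℕ} {τ : ℝ} (hτ : 0 < τ) (Sstar : Set (Space d))
    (Z : Fin n → Space d) (z z' : Space d) :
    ∑ i, ‖totalWeight L K Sstar Z z i‖ₑ * ‖totalWeight L K Sstar Z z' i‖ₑ
      ≤ ENNReal.ofReal (((1 + τ * ‖z - z'‖) ^ M)⁻¹) *
        (nnMoment L K (2 * M) τ Sstar Z z + nnMoment L K (2 * M) τ Sstar Z z') := by
  by_cases h : ∃ J : Finset (Fin n), J.card = K ∧ z ∈ cell Sstar Z J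
  swap
  · push Not at h
    simp [totalWeight, sum_cell_indicator_eq_zero h]
  by_cases h' : ∃ J : Finset (Fin n), J.card = K ∧ z' ∈ cell Sstar Z J
  swap
  · push Not at h'
    simp [totalWeight, sum_cell_indicator_eq_zero h']
  obtain ⟨J, hJ, hz⟩ := h
  obtain ⟨J', hJ', hz'⟩ := h'
  have hR := radius_nonneg Z J z
  have hR' := radius_nonneg Z J' z'
  have e1 : ∀ i, totalWeight L K Sstar Z z i = if i ∈ J then fitWeight L Z J z i else 0 :=
    fun i => sum_cell_indicator_eq hJ hz _
  have e2 : ∀ i, totalWeight L K Sstar Z z' i = if i ∈ J' then fitWeight L Z J' z' i else 0 :=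
    fun i => sum_cell_indicator_eq hJ' hz' _
  set D := (1 + τ * ‖z - z'‖) ^ M with hD
  have hDpos : 0 < D := by positivity
  set a := (1 + τ * radius Z J z) ^ M with ha
  set b := (1 + τ * radius Z J' z') ^ M with hb
  have key : ∀ i, ‖totalWeight L K Sstar Z z i‖ * ‖totalWeight L K Sstar Z z' i‖
      ≤ D⁻¹ * ((if i ∈ J then a ^ 2 * fitWeight L Z J z i ^ 2 else 0)
        + (if i ∈ J' then b ^ 2 * fitWeight L Z J' z' i ^ 2 else 0)) := by
    intro i
    rw [e1, e2]
    by_cases hi : i ∈ J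
    · by_cases hi' : i ∈ J'
      · simp only [hi, hi', if_true, Real.norm_eq_abs]
        set u := fitWeight L Z J z i
        set v := fitWeight L Z J' z' i
        -- A shared observation lies within the nearest neighbour radius of both points.
        have htri : ‖z - z'‖ ≤ radius Z J z + radius Z J' z' := by
          have h1 := norm_sub_le_radius Z z hi
          have h2 := norm_sub_le_radius Z z' hi'
          have h3 := norm_sub_le_norm_sub_add_norm_sub z (Z i) z'
          rw [norm_sub_rev z (Z i)] at h3
          linarith
        -- Since `1 + τ(R + R') ≤ (1 + τR)(1 + τR')`, decay in `‖z - z'‖` is bought with powers of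
        -- the two radii; separating them by `xy ≤ x² + y²` doubles the order of the moment.
        have hDab : D ≤ a * b := by
          rw [hD, ha, hb, ← mul_pow]
          refine pow_le_pow_left₀ (by positivity) ?_ M
          have h4 : τ * ‖z - z'‖ ≤ τ * (radius Z J z + radius Z J' z') := by gcongr
          have h5 : 0 ≤ τ * radius Z J z * (τ * radius Z J' z') := by positivity
          nlinarith
        rw [← div_eq_inv_mul, le_div_iff₀ hDpos]
        have ha0 : 0 ≤ a := by positivity
        have hb0 : 0 ≤ b := by positivity
        calc |u| * |v| * D ≤ |u| * |v| * (a * b) := by gcongr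
          _ = (a * |u|) * (b * |v|) := by ring
          _ ≤ (a * |u|) ^ 2 + (b * |v|) ^ 2 := by
            nlinarith [sq_nonneg (a * |u| - b * |v|), sq_nonneg (a * |u|), sq_nonneg (b * |v|)]
          _ = a ^ 2 * u ^ 2 + b ^ 2 * v ^ 2 := by rw [mul_pow, mul_pow, sq_abs, sq_abs]
      · simp only [hi, hi', if_true, if_false, norm_zero, mul_zero]
        positivity
    · simp only [hi, if_false, norm_zero, zero_mul]
      split_ifs <;> positivity
  calc ∑ i, ‖totalWeight L K Sstar Z z i‖ₑ * ‖totalWeight L K Sstar Z z' i‖ₑ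
      = ENNReal.ofReal (∑ i, ‖totalWeight L K Sstar Z z i‖ * ‖totalWeight L K Sstar Z z' i‖) := by
        rw [ENNReal.ofReal_sum_of_nonneg fun i _ => by positivity]
        refine Finset.sum_congr rfl fun i _ => ?_
        rw [ENNReal.ofReal_mul (norm_nonneg _), ofReal_norm, ofReal_norm]
    _ ≤ ENNReal.ofReal (D⁻¹ * ((1 + τ * radius Z J z) ^ (2 * M) * fitSq L Z J z
          + (1 + τ * radius Z J' z') ^ (2 * M) * fitSq L Z J' z')) := by
        refine ENNReal.ofReal_le_ofReal ((Finset.sum_le_sum fun i _ => key i).trans (le_of_eq ?_))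
        rw [← Finset.mul_sum, Finset.sum_add_distrib, fitSq, fitSq, Finset.mul_sum,
          Finset.mul_sum, mul_comm 2 M, pow_mul, pow_mul, Finset.sum_ite_mem, Finset.sum_ite_mem,
          Finset.univ_inter, Finset.univ_inter]
    _ ≤ _ := by
        have q1 := fitSq_nonneg L Z J z
        have q2 := fitSq_nonneg L Z J' z'
        rw [ENNReal.ofReal_mul (by positivity), ENNReal.ofReal_add (by positivity) (by positivity)]
        gcongr
        · exact ofReal_rpow_mul_fitSq_le_nnMoment le_rfl hτ hJ hz
        · exact ofReal_rpow_mul_fitSq_le_nnMoment le_rfl hτ hJ' hz'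

end Weights

/-! ### Moments of the nearest neighbour estimator -/

lemma ENNReal_mul_le_sq_add_sq (a b : ENNReal) : a * b ≤ a ^ 2 + b ^ 2 := by
  rcases le_total a b with h | h
  · calc a * b ≤ b * b := by gcongr
      _ = b ^ 2 := (sq b).symm
      _ ≤ _ := le_add_self
  · calc a * b ≤ a * a := by gcongr
      _ = a ^ 2 := (sq a).symm
      _ ≤ _ := le_self_add

lemma sq_lintegral_le {α : Type*} [MeasurableSpace α] (ν : Measure α) {f : α → ENNReal}
    (hf : Measurable f) :
    (∫⁻ x, f x ∂ν) ^ 2 ≤ 2 * ν Set.univ * ∫⁻ x, f x ^ 2 ∂ν := by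
  have h1 : (∫⁻ x, f x ∂ν) ^ 2 = ∫⁻ x, ∫⁻ y, f x * f y ∂ν ∂ν := by
    simp_rw [lintegral_const_mul _ hf]
    rw [lintegral_mul_const _ hf, sq]
  rw [h1]
  calc ∫⁻ x, ∫⁻ y, f x * f y ∂ν ∂ν ≤ ∫⁻ x, ∫⁻ y, (f x ^ 2 + f y ^ 2) ∂ν ∂ν := by
        gcongr with x y
        exact ENNReal_mul_le_sq_add_sq _ _
    _ = _ := by
        simp_rw [lintegral_add_left measurable_const, lintegral_const]
        rw [lintegral_add_right _ measurable_const, lintegral_mul_const _ (hf.pow_const 2),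
          lintegral_const]
        ring

/-- Greedy choice: adjoin the minimiser of `f` on the complement. -/
lemma exists_finset_forall_lt {n K : ℕ} (hK : K ≤ n) (f : Fin n → ℝ) (hf : Function.Injective f) :
    ∃ J : Finset (Fin n), J.card = K ∧ ∀ j ∈ J, ∀ k ∉ J, f j < f k := by
  classical
  induction K with
  | zero => exact ⟨∅, rfl, by simp⟩
  | succ K ih =>
    obtain ⟨J, hJ, hlt⟩ := ih (by omega)
    have hne : (Jᶜ).Nonempty := by
      rw [← Finset.card_pos, Finset.card_compl, hJ, Fintype.card_fin]
      omega
    obtain ⟨i, hi, hmin⟩ := Finset.exists_min_image Jᶜ f hne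
    rw [Finset.mem_compl] at hi
    refine ⟨insert i J, by rw [Finset.card_insert_of_notMem hi, hJ], ?_⟩
    intro j hj k hk
    rw [Finset.mem_insert, not_or] at hk
    rcases Finset.mem_insert.1 hj with rfl | hj
    · exact lt_of_le_of_ne (hmin k (by simpa using hk.2)) fun h => hk.1 (hf h).symm
    · exact hlt j hj k hk.2

section Moments

variable {d n : ℕ}

lemma nnMoment_mono {L K N N' : ℕ} (hN : N' ≤ N) {τ : ℝ} (hτ : 0 < τ) (Sstar : Set (Space d))
    (Z : Fin n → Space d) (z : Space d) :
    nnMoment L K N' τ Sstar Z z ≤ nnMoment L K N τ Sstar Z z := by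
  refine Finset.sum_le_sum fun J _ => Set.indicator_le_indicator ?_
  have hR := radius_nonneg Z J z
  gcongr
  nlinarith

lemma lintegral_inv_one_add_norm_sub {M : ℕ} {τ : ℝ} (hτ : 0 < τ) (z : Space d) :
    ∫⁻ z', ENNReal.ofReal (((1 + τ * ‖z - z'‖) ^ M)⁻¹)
      = ENNReal.ofReal ((τ ^ d)⁻¹) * ∫⁻ u : Space d, ENNReal.ofReal (((1 + ‖u‖) ^ M)⁻¹) := by
  have h1 : ∫⁻ z', ENNReal.ofReal (((1 + τ * ‖z - z'‖) ^ M)⁻¹)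
      = ∫⁻ y : Space d, ENNReal.ofReal (((1 + ‖τ • y‖) ^ M)⁻¹) := by
    rw [← lintegral_sub_right_eq_self (fun y : Space d =>
      ENNReal.ofReal (((1 + ‖τ • y‖) ^ M)⁻¹)) z]
    simp_rw [norm_smul, Real.norm_eq_abs, abs_of_pos hτ, norm_sub_rev z]
  have hm : Measurable fun u : Space d => ENNReal.ofReal (((1 + ‖u‖) ^ M)⁻¹) := by fun_prop
  have h5 := lintegral_map (μ := (volume : Measure (Space d))) (g := fun y => τ • y) hm
    (by fun_prop)
  rw [h1, ← h5, Measure.map_addHaar_smul _ hτ.ne', lintegral_smul_measure, smul_eq_mul]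
  congr 2
  simp [abs_of_pos hτ]

lemma lintegral_inv_one_add_norm_lt_top :
    ∫⁻ u : Space d, ENNReal.ofReal (((1 + ‖u‖) ^ (d + 1))⁻¹) < ⊤ := by
  have h := integrable_one_add_norm (E := Space d) (μ := volume) (r := (d + 1 : ℕ)) (by simp)
  refine lt_of_le_of_lt (le_of_eq ?_) h.2
  refine lintegral_congr fun u => ?_
  rw [Real.enorm_of_nonneg (by positivity)]
  simp only [Real.rpow_neg (by positivity : 0 ≤ 1 + ‖u‖), Real.rpow_natCast]

variable {L K N : ℕ} {τ : ℝ} {Sstar : Set (Space d)} (μ : Measure (Space d))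
  [IsProbabilityMeasure μ] {B : ENNReal}

lemma lintegral_nnMoment_le (hS : MeasurableSet Sstar)
    (hB : ∀ z ∈ Sstar, ∫⁻ Z : Fin n → Space d, nnMoment L K N τ Sstar Z z
      ∂(Measure.pi fun _ => μ) ≤ B) :
    ∫⁻ Z : Fin n → Space d, (∫⁻ z in Sstar, nnMoment L K N τ Sstar Z z)
      ∂(Measure.pi fun _ => μ)
      ≤ B * volume Sstar := by
  rw [lintegral_lintegral_swap (f := fun (Z : Fin n → Space d) z => nnMoment L K N τ Sstar Z z)
    (measurable_nnMoment L K N τ hS).aemeasurable]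
  refine (setLIntegral_mono' hS hB).trans (le_of_eq ?_)
  rw [setLIntegral_const]

/-- The expected sum of squared weights is of order `τ^{-d}`. -/
lemma lintegral_sum_intWeight_sq_le (hτ : 0 < τ) (hS : MeasurableSet Sstar)
    (hN : 2 * (d + 1) ≤ N)
    (hB : ∀ z ∈ Sstar, ∫⁻ Z : Fin n → Space d, nnMoment L K N τ Sstar Z z
      ∂(Measure.pi fun _ => μ) ≤ B) :
    ∫⁻ Z : Fin n → Space d, ∑ i, ‖intWeight L K Sstar Z i‖ₑ ^ 2 ∂(Measure.pi fun _ => μ)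
      ≤ ENNReal.ofReal ((τ ^ d)⁻¹) * (2 * B * volume Sstar *
        ∫⁻ u : Space d, ENNReal.ofReal (((1 + ‖u‖) ^ (d + 1))⁻¹)) := by
  set ν : Measure (Space d) := volume.restrict Sstar with hν
  obtain ⟨T, hT⟩ : ∃ T : (Fin n → Space d) → Space d → ENNReal,
    T = fun Z z => nnMoment L K N τ Sstar Z z := ⟨_, rfl⟩
  obtain ⟨k, hk⟩ : ∃ k : Space d × Space d → ENNReal,
    k = fun q => ENNReal.ofReal (((1 + τ * ‖q.1 - q.2‖) ^ (d + 1))⁻¹) := ⟨_, rfl⟩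
  have hkm : Measurable k := by rw [hk]; fun_prop
  have hTm : Measurable (Function.uncurry T) := by
    rw [hT]; exact measurable_nnMoment L K N τ hS
  have hkz : ∀ z z', k (z, z') = ENNReal.ofReal (((1 + τ * ‖z - z'‖) ^ (d + 1))⁻¹) := by
    intro z z'; rw [hk]
  have hkt : ∀ q, k q ≠ ⊤ := by intro q; rw [hk]; exact ENNReal.ofReal_ne_top
  have hTB : ∀ z ∈ Sstar, ∫⁻ Z : Fin n → Space d, T Z z ∂(Measure.pi fun _ => μ) ≤ B := by
    rw [hT]; exact hB
  have hwm : ∀ (Z : Fin n → Space d) i,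
      Measurable fun z => ‖totalWeight L K Sstar Z z i‖ₑ := fun Z i =>
    ((measurable_totalWeight L K hS i).comp measurable_prodMk_left).enorm
  -- The square of an integral is a double integral over `(z, z')`. The overlap bound inserts a
  -- kernel concentrated on `‖z - z'‖` of order `1/τ`; the exponent `d + 1` makes it integrable, and
  -- its integral is the source of `τ ^ (-d)`.
  have h1 : ∀ Z : Fin n → Space d, ∑ i, ‖intWeight L K Sstar Z i‖ₑ ^ 2
      ≤ ∫⁻ q, k q * (T Z q.1 + T Z q.2) ∂(ν.prod ν) := by
    intro Z
    have hint : Measurable fun q : Space d × Space d => k q * (T Z q.1 + T Z q.2) := by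
      have : Measurable (T Z) := hTm.comp measurable_prodMk_left
      exact hkm.mul ((this.comp measurable_fst).add (this.comp measurable_snd))
    rw [lintegral_prod _ hint.aemeasurable]
    calc ∑ i, ‖intWeight L K Sstar Z i‖ₑ ^ 2
        ≤ ∑ i, (∫⁻ z, ‖totalWeight L K Sstar Z z i‖ₑ ∂ν) ^ 2 := by
          gcongr with i
          exact enorm_integral_le_lintegral_enorm _
      _ = ∑ i, ∫⁻ z, ∫⁻ z', ‖totalWeight L K Sstar Z z i‖ₑ * ‖totalWeight L K Sstar Z z' i‖ₑ
            ∂ν ∂ν := by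
          refine Finset.sum_congr rfl fun i _ => ?_
          simp_rw [lintegral_const_mul _ (hwm Z i)]
          rw [lintegral_mul_const _ (hwm Z i), sq]
      _ = ∫⁻ z, ∫⁻ z', ∑ i, ‖totalWeight L K Sstar Z z i‖ₑ * ‖totalWeight L K Sstar Z z' i‖ₑ
            ∂ν ∂ν := by
          rw [← lintegral_finsetSum]
          · refine lintegral_congr fun z => ?_
            rw [lintegral_finsetSum]
            exact fun i _ => (hwm Z i).const_mul _
          · intro i _
            simp_rw [lintegral_const_mul _ (hwm Z i)]
            exact (hwm Z i).mul_const _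
      _ ≤ _ := by
          gcongr with z z'
          refine (sum_totalWeight_mul_le (M := d + 1) hτ Sstar Z z z').trans ?_
          rw [hkz, hT]
          gcongr
          · exact nnMoment_mono hN hτ _ _ _
          · exact nnMoment_mono hN hτ _ _ _
  refine (lintegral_mono h1).trans ?_
  rw [lintegral_lintegral_swap]
  swap
  · have h2 : Measurable fun p : (Fin n → Space d) × (Space d × Space d) => T p.1 p.2.1 :=
      hTm.comp (f := fun p : (Fin n → Space d) × (Space d × Space d) => (p.1, p.2.1)) (by fun_prop)
    have h3 : Measurable fun p : (Fin n → Space d) × (Space d × Space d) => T p.1 p.2.2 :=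
      hTm.comp (f := fun p : (Fin n → Space d) × (Space d × Space d) => (p.1, p.2.2)) (by fun_prop)
    exact ((hkm.comp measurable_snd).mul (h2.add h3)).aemeasurable
  have h4 : ∀ q : Space d × Space d, q.1 ∈ Sstar → q.2 ∈ Sstar →
      ∫⁻ Z : Fin n → Space d, k q * (T Z q.1 + T Z q.2) ∂(Measure.pi fun _ => μ)
        ≤ k q * (2 * B) := by
    intro q hq1 hq2
    rw [lintegral_const_mul' _ _ (hkt q), lintegral_add_left
      (by exact hTm.comp measurable_prodMk_right), two_mul]
    gcongr
    · exact hTB _ hq1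
    · exact hTB _ hq2
  have h5 : ∀ᵐ q ∂(ν.prod ν), q.1 ∈ Sstar ∧ q.2 ∈ Sstar := by
    rw [hν, Measure.prod_restrict]
    exact ae_restrict_mem (hS.prod hS)
  calc ∫⁻ q, ∫⁻ Z : Fin n → Space d, k q * (T Z q.1 + T Z q.2) ∂(Measure.pi fun _ => μ)
        ∂(ν.prod ν) ≤ ∫⁻ q, k q * (2 * B) ∂(ν.prod ν) := by
        refine lintegral_mono_ae ?_
        filter_upwards [h5] with q hq
        exact h4 q hq.1 hq.2
    _ = (∫⁻ z, ∫⁻ z', k (z, z') ∂ν ∂ν) * (2 * B) := by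
        rw [lintegral_mul_const _ hkm, lintegral_prod _ hkm.aemeasurable]
    _ ≤ (∫⁻ _z, ENNReal.ofReal ((τ ^ d)⁻¹) *
          (∫⁻ u : Space d, ENNReal.ofReal (((1 + ‖u‖) ^ (d + 1))⁻¹)) ∂ν) * (2 * B) := by
        gcongr with z
        simp_rw [hkz]
        rw [← lintegral_inv_one_add_norm_sub hτ z]
        exact lintegral_mono' Measure.restrict_le_self le_rfl
    _ = _ := by
        rw [lintegral_const, hν, Measure.restrict_apply_univ]
        ring

/-- Almost surely almost every point lies in a cell. -/
lemma ae_ae_mem_cell (hd : 1 ≤ d) (hμ : μ ≪ volume) (hK : K ≤ n) :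
    ∀ᵐ Z : Fin n → Space d ∂(Measure.pi fun _ => μ), ∀ᵐ z ∂(volume.restrict Sstar),
      z ∈ Sstar → ∃ J : Finset (Fin n), J.card = K ∧ z ∈ cell Sstar Z J := by
  have hmeas : MeasurableSet {q : (Fin n → Space d) × Space d |
      ∀ i k, i ≠ k → ‖q.2 - q.1 i‖ ≠ ‖q.2 - q.1 k‖} := by
    simp only [Set.ofPred_forall]
    refine MeasurableSet.iInter fun i => MeasurableSet.iInter fun k => MeasurableSet.iInter fun _ =>
      (measurableSet_eq_fun (by fun_prop) (by fun_prop)).compl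
  have h1 : ∀ᵐ Z : Fin n → Space d ∂(Measure.pi fun _ => μ), ∀ᵐ z ∂(volume.restrict Sstar),
      ∀ i k, i ≠ k → ‖z - Z i‖ ≠ ‖z - Z k‖ := by
    -- Fubini for null sets: ties are negligible for each fixed `z`, hence for almost every design
    -- they are negligible in `z`.
    rw [Measure.ae_ae_comm hmeas]
    exact Eventually.of_forall fun z => ae_pi_dist_ne hd μ hμ z
  filter_upwards [h1] with Z hZ
  filter_upwards [hZ] with z hz hzS
  obtain ⟨J, hJ, hlt⟩ := exists_finset_forall_lt hK (fun i => ‖z - Z i‖) fun i k h => by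
    by_contra hne
    exact hz i k hne h
  exact ⟨J, hJ, hzS, hlt⟩

end Moments

/-! ### Bias of the nearest neighbour estimator -/

section Bias

lemma measurable_fitWeight_right {d n : ℕ} (L : ℕ) (Z : Fin n → Space d) (J : Finset (Fin n)) (i : Fin n) :
    Measurable fun z => fitWeight L Z J z i := by
  have h := (measurable_fitWeight (d := d) L J i).comp (measurable_prodMk_left (x := Z))
  simpa only [Function.comp_def] using h

lemma measurable_totalWeight_right {d n : ℕ} (L K : ℕ) {Sstar : Set (Space d)} (hS : MeasurableSet Sstar)
    (Z : Fin n → Space d) (i : Fin n) :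
    Measurable fun z => totalWeight L K Sstar Z z i := by
  have h := (measurable_totalWeight L K hS i).comp (measurable_prodMk_left (x := Z))
  simpa only [Function.comp_def] using h

variable {d n : ℕ} {L K N : ℕ} {τ : ℝ} {Sstar : Set (Space d)} {Z : Fin n → Space d}

/-- `F` is approximated near every point by a polynomial of degree at most `L` with the same value
at that point, up to an error of order `‖w - z‖ ^ L`. -/
def HasTaylorBound (L : ℕ) (B : ℝ) (F : Space d → ℂ) : Prop :=
  ∀ z, ∃ c : multiIndices d L → ℂ, c (zeroIndex d L) = F z ∧
    ∀ w, ‖F w - ∑ κ, c κ * (monomials L z w κ : ℂ)‖ ≤ B * ‖w - z‖ ^ L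

lemma enorm_cellWeight_le (hτ : 0 < τ) {J : Finset (Fin n)} (hJ : J.card = K) (i : Fin n)
    (z : Space d) :
    ‖(cell Sstar Z J).indicator (fun z => if i ∈ J then fitWeight L Z J z i else 0) z‖ₑ
      ≤ 1 + nnMoment L K N τ Sstar Z z := by
  by_cases hz : z ∈ cell Sstar Z J
  swap
  · simp [Set.indicator_of_notMem hz]
  rw [Set.indicator_of_mem hz]
  by_cases hi : i ∈ J
  swap
  · simp [hi]
  rw [if_pos hi]
  have h1 : ‖fitWeight L Z J z i‖ ≤ 1 + fitSq L Z J z := by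
    have h2 : fitWeight L Z J z i ^ 2 ≤ fitSq L Z J z :=
      Finset.single_le_sum (f := fun i => fitWeight L Z J z i ^ 2)
        (fun _ _ => sq_nonneg _) hi
    rw [Real.norm_eq_abs]
    nlinarith [sq_abs (fitWeight L Z J z i), sq_nonneg (|fitWeight L Z J z i| - 1)]
  have h3 := ofReal_rpow_mul_fitSq_le_nnMoment (L := L) (N := N) (Nat.zero_le N) hτ hJ hz
  rw [pow_zero, one_mul] at h3
  rw [← ofReal_norm]
  refine (ENNReal.ofReal_le_ofReal h1).trans ?_
  rw [ENNReal.ofReal_add zero_le_one (fitSq_nonneg _ _ _ _), ENNReal.ofReal_one]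
  gcongr

lemma integrable_cellWeight (hτ : 0 < τ) (hS : MeasurableSet Sstar) (hSfin : volume Sstar ≠ ⊤)
    (hZ : ∫⁻ z in Sstar, nnMoment L K N τ Sstar Z z ≠ ⊤) {J : Finset (Fin n)} (hJ : J.card = K)
    (i : Fin n) :
    Integrable (fun z => (cell Sstar Z J).indicator
      (fun z => if i ∈ J then fitWeight L Z J z i else 0) z) (volume.restrict Sstar) := by
  refine ⟨?_, ?_⟩
  · have hcell : MeasurableSet (cell Sstar Z J) :=
      (measurableSet_cell hS J).preimage measurable_prodMk_left
    have hw : Measurable fun z => fitWeight L Z J z i :=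
      measurable_fitWeight_right L Z J i
    have hw' : Measurable fun z => if i ∈ J then fitWeight L Z J z i else 0 := by
      split_ifs
      · exact hw
      · exact measurable_const
    exact (hw'.indicator hcell).aestronglyMeasurable
  · refine (lintegral_mono fun z => enorm_cellWeight_le (L := L) (N := N) hτ hJ i z).trans_lt ?_
    rw [lintegral_add_left measurable_const, lintegral_const, Measure.restrict_apply_univ, one_mul]
    exact ENNReal.add_lt_top.2 ⟨hSfin.lt_top, hZ.lt_top⟩

lemma integrable_totalWeight (hτ : 0 < τ) (hS : MeasurableSet Sstar) (hSfin : volume Sstar ≠ ⊤)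
    (hZ : ∫⁻ z in Sstar, nnMoment L K N τ Sstar Z z ≠ ⊤) (i : Fin n) :
    Integrable (fun z => totalWeight L K Sstar Z z i) (volume.restrict Sstar) := by
  unfold totalWeight
  exact integrable_finsetSum _ fun J hJ =>
    integrable_cellWeight hτ hS hSfin hZ (Finset.mem_powersetCard.1 hJ).2 i

/-- Finiteness of the integrated moment makes every local weight integrable over `Sstar`; only then
may sums and Bochner integrals be interchanged. This linear form in the responses is what permits
the conditional bias and variance analysis. -/
lemma psiHat_eq_sum (hτ : 0 < τ) (hS : MeasurableSet Sstar) (hSfin : volume Sstar ≠ ⊤)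
    (hZ : ∫⁻ z in Sstar, nnMoment L K N τ Sstar Z z ≠ ⊤) (g : ℝ → Space d → ℂ) (U : Fin n → ℝ) :
    psiHat Sstar L K g U Z = ∑ i, g (U i) (Z i) * (intWeight L K Sstar Z i : ℂ) := by
  have hcell : ∀ J : Finset (Fin n), MeasurableSet (cell Sstar Z J) := fun J =>
    (measurableSet_cell hS J).preimage measurable_prodMk_left
  have hint : ∀ J ∈ Finset.powersetCard K (Finset.univ : Finset (Fin n)), ∀ i, Integrable
      (fun z => g (U i) (Z i) * (((cell Sstar Z J).indicator
        (fun z => if i ∈ J then fitWeight L Z J z i else 0) z : ℝ) : ℂ))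
      (volume.restrict Sstar) := fun J hJ i =>
    ((integrable_cellWeight hτ hS hSfin hZ (Finset.mem_powersetCard.1 hJ).2 i).ofReal).const_mul _
  have h1 : ∀ J : Finset (Fin n), ∫ z in cell Sstar Z J,
      localFit L Z (fun j => g (U j) (Z j)) J z
      = ∫ z in Sstar, ∑ i, g (U i) (Z i) * (((cell Sstar Z J).indicator
        (fun z => if i ∈ J then fitWeight L Z J z i else 0) z : ℝ) : ℂ) := by
    intro J
    have hsub : cell Sstar Z J ∩ Sstar = cell Sstar Z J :=
      Set.inter_eq_left.2 fun z hz => hz.1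
    rw [show volume.restrict (cell Sstar Z J) = (volume.restrict Sstar).restrict (cell Sstar Z J) by
      rw [Measure.restrict_restrict (hcell J), hsub], ← integral_indicator (hcell J)]
    congr 1
    ext z
    by_cases hz : z ∈ cell Sstar Z J
    · simp only [Set.indicator_of_mem hz, localFit]
      simp only [apply_ite Complex.ofReal, Complex.ofReal_zero, mul_ite, mul_zero,
        Finset.sum_ite_mem, Finset.univ_inter]
      rfl
    · simp [Set.indicator_of_notMem hz]
  unfold psiHat
  rw [Finset.sum_congr rfl fun J _ => h1 J, ← integral_finsetSum _ fun J hJ =>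
    integrable_finsetSum _ fun i _ => hint J hJ i]
  have h2 : ∀ z, ∑ J ∈ Finset.powersetCard K (Finset.univ : Finset (Fin n)),
      ∑ i, g (U i) (Z i) * (((cell Sstar Z J).indicator
        (fun z => if i ∈ J then fitWeight L Z J z i else 0) z : ℝ) : ℂ)
      = ∑ i, g (U i) (Z i) * ((totalWeight L K Sstar Z z i : ℝ) : ℂ) := by
    intro z
    rw [Finset.sum_comm]
    refine Finset.sum_congr rfl fun i _ => ?_
    rw [totalWeight, Complex.ofReal_sum, Finset.mul_sum]
  simp_rw [h2]
  rw [integral_finsetSum _ fun i _ =>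
    ((integrable_totalWeight hτ hS hSfin hZ i).ofReal).const_mul _]
  refine Finset.sum_congr rfl fun i _ => ?_
  rw [integral_const_mul, intWeight]
  congr 1
  exact integral_ofReal

/-- The weights reproduce the approximating polynomial, whose value at `z` is `F z`, so the error is
a weighted sum of `K` remainders. Cauchy–Schwarz and `R ^ (2L) ≤ τ ^ (-2L) (1 + τR) ^ (2L)` turn it
into a moment. -/
lemma fit_error_sq_le (hτ : 0 < τ) (hK : 0 < K) (hN : 2 * L ≤ N) {F : Space d → ℂ} {B : ℝ}
    (hB : 0 < B) (hF : HasTaylorBound L B F) {z : Space d} {J : Finset (Fin n)} (hJ : J.card = K)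
    (hz : z ∈ cell Sstar Z J) :
    ‖∑ i, F (Z i) * (totalWeight L K Sstar Z z i : ℂ) - F z‖ₑ ^ 2
      ≤ ENNReal.ofReal (K * B ^ 2 * (τ ^ (2 * L))⁻¹) * nnMoment L K N τ Sstar Z z := by
  have hR := radius_nonneg Z J z
  have hK' : (0 : ℝ) < K := by exact_mod_cast hK
  -- For a singular design reproduction fails, but the bound is infinite because `fitSqTop` is.
  by_cases hdet : (designMatrix L Z J z).det = 0
  · have htop : nnMoment L K N τ Sstar Z z = ⊤ := by
      rw [nnMoment, sum_cell_indicator_eq hJ hz, fitSqTop, if_neg (not_not.2 hdet),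
        ENNReal.mul_top]
      simp only [ne_eq, ENNReal.ofReal_eq_zero, not_le]
      positivity
    rw [htop, ENNReal.mul_top]
    · exact le_top
    · simp only [ne_eq, ENNReal.ofReal_eq_zero, not_le]
      positivity
  obtain ⟨c, hc0, hc⟩ := hF z
  set w : Fin n → ℝ := fun i => fitWeight L Z J z i with hw
  have e1 : ∀ i, totalWeight L K Sstar Z z i = if i ∈ J then w i else 0 :=
    fun i => sum_cell_indicator_eq hJ hz _
  have hrep := sum_fitWeight_mul_monomials L Z J z (isUnit_iff_ne_zero.2 hdet)
  have h1 : ∑ i ∈ J, (w i : ℂ) * ∑ κ, c κ * (monomials L z (Z i) κ : ℂ) = F z := by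
    have h2 : ∀ κ, ∑ i ∈ J, (w i : ℂ) * (monomials L z (Z i) κ : ℂ)
        = if κ = zeroIndex d L then 1 else 0 := fun κ => by
      rw [← Complex.ofReal_one, ← Complex.ofReal_zero, ← apply_ite Complex.ofReal, ← hrep κ]
      simp [hw]
    calc ∑ i ∈ J, (w i : ℂ) * ∑ κ, c κ * (monomials L z (Z i) κ : ℂ)
        = ∑ κ, c κ * ∑ i ∈ J, (w i : ℂ) * (monomials L z (Z i) κ : ℂ) := by
          simp_rw [Finset.mul_sum]
          rw [Finset.sum_comm]
          exact Finset.sum_congr rfl fun κ _ => Finset.sum_congr rfl fun i _ => by ring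
      _ = F z := by simp_rw [h2]; simp [hc0]
  have h3 : ∑ i, F (Z i) * (totalWeight L K Sstar Z z i : ℂ) - F z
      = ∑ i ∈ J, (w i : ℂ) * (F (Z i) - ∑ κ, c κ * (monomials L z (Z i) κ : ℂ)) := by
    simp_rw [mul_sub]
    rw [Finset.sum_sub_distrib, h1]
    congr 1
    simp_rw [e1, apply_ite Complex.ofReal, Complex.ofReal_zero, mul_ite, mul_zero]
    rw [Finset.sum_ite_mem, Finset.univ_inter]
    exact Finset.sum_congr rfl fun i _ => mul_comm _ _
  have h4 : ‖∑ i, F (Z i) * (totalWeight L K Sstar Z z i : ℂ) - F z‖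
      ≤ (∑ i ∈ J, |w i|) * (B * radius Z J z ^ L) := by
    rw [h3, Finset.sum_mul]
    refine (norm_sum_le _ _).trans (Finset.sum_le_sum fun i hi => ?_)
    rw [norm_mul, Complex.norm_real, Real.norm_eq_abs]
    gcongr
    refine (hc (Z i)).trans ?_
    gcongr
    exact norm_sub_le_radius Z z hi
  have h5 : (∑ i ∈ J, |w i|) ^ 2 ≤ K * fitSq L Z J z := by
    have := sq_sum_le_card_mul_sum_sq (s := J) (f := fun i => |w i|)
    simp_rw [sq_abs, hJ] at this
    exact this
  have h6 : ‖∑ i, F (Z i) * (totalWeight L K Sstar Z z i : ℂ) - F z‖ ^ 2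
      ≤ (K * B ^ 2 * (τ ^ (2 * L))⁻¹) * ((1 + τ * radius Z J z) ^ (2 * L) * fitSq L Z J z) := by
    have h7 : radius Z J z ^ (2 * L) ≤ (τ ^ (2 * L))⁻¹ * (1 + τ * radius Z J z) ^ (2 * L) := by
      rw [← div_eq_inv_mul, le_div_iff₀ (by positivity), ← mul_pow]
      exact pow_le_pow_left₀ (by positivity) (by linarith) _
    have hQ := fitSq_nonneg L Z J z
    calc _ ≤ ((∑ i ∈ J, |w i|) * (B * radius Z J z ^ L)) ^ 2 := by gcongr
      _ = (∑ i ∈ J, |w i|) ^ 2 * (B ^ 2 * radius Z J z ^ (2 * L)) := by ring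
      _ ≤ (K * fitSq L Z J z) * (B ^ 2 * ((τ ^ (2 * L))⁻¹ * (1 + τ * radius Z J z) ^ (2 * L))) := by
        gcongr
      _ = _ := by ring
  rw [← ofReal_norm, ← ENNReal.ofReal_pow (norm_nonneg _)]
  refine (ENNReal.ofReal_le_ofReal h6).trans ?_
  rw [ENNReal.ofReal_mul (by positivity)]
  gcongr
  exact ofReal_rpow_mul_fitSq_le_nnMoment hN hτ hJ hz

/-- The squared conditional bias of the nearest neighbour estimator. -/
lemma bias_sq_le (hτ : 0 < τ) (hK : 0 < K) (hN : 2 * L ≤ N) (hS : MeasurableSet Sstar)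
    (hSfin : volume Sstar ≠ ⊤)
    (hZ : ∫⁻ z in Sstar, nnMoment L K N τ Sstar Z z ≠ ⊤)
    (hcell : ∀ᵐ z ∂(volume.restrict Sstar),
      z ∈ Sstar → ∃ J : Finset (Fin n), J.card = K ∧ z ∈ cell Sstar Z J)
    {F : Space d → ℂ} (hFm : Measurable F) (hFi : IntegrableOn F Sstar) {B : ℝ} (hB : 0 < B)
    (hF : HasTaylorBound L B F) :
    ‖∑ i, F (Z i) * (intWeight L K Sstar Z i : ℂ) - ∫ z in Sstar, F z‖ₑ ^ 2
      ≤ 2 * volume Sstar * (ENNReal.ofReal (K * B ^ 2 * (τ ^ (2 * L))⁻¹) *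
        ∫⁻ z in Sstar, nnMoment L K N τ Sstar Z z) := by
  have hti := integrable_totalWeight (Z := Z) hτ hS hSfin hZ
  have h1 : ∑ i, F (Z i) * (intWeight L K Sstar Z i : ℂ) - ∫ z in Sstar, F z
      = ∫ z in Sstar, (∑ i, F (Z i) * (totalWeight L K Sstar Z z i : ℂ) - F z) := by
    have hti' : ∀ i, Integrable (fun z => F (Z i) * (totalWeight L K Sstar Z z i : ℂ))
        (volume.restrict Sstar) := fun i => ((hti i).ofReal).const_mul _
    rw [integral_sub (integrable_finsetSum _ fun i _ => hti' i) hFi,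
      integral_finsetSum _ fun i _ => hti' i]
    congr 1
    refine Finset.sum_congr rfl fun i _ => ?_
    rw [integral_const_mul, intWeight]
    congr 1
    exact integral_ofReal.symm
  have hm : Measurable fun z =>
      ‖∑ i, F (Z i) * (totalWeight L K Sstar Z z i : ℂ) - F z‖ₑ := by
    have : ∀ i, Measurable fun z => totalWeight L K Sstar Z z i := fun i =>
      measurable_totalWeight_right L K hS Z i
    refine Measurable.enorm (Measurable.sub ?_ hFm)
    exact Finset.measurable_sum _ fun i _ =>
      (Complex.measurable_ofReal.comp (this i)).const_mul _
  rw [h1]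
  calc _ ≤ (∫⁻ z in Sstar, ‖∑ i, F (Z i) * (totalWeight L K Sstar Z z i : ℂ) - F z‖ₑ) ^ 2 := by
        gcongr
        exact enorm_integral_le_lintegral_enorm _
    _ ≤ 2 * volume Sstar *
        ∫⁻ z in Sstar, ‖∑ i, F (Z i) * (totalWeight L K Sstar Z z i : ℂ) - F z‖ₑ ^ 2 := by
        refine (sq_lintegral_le _ hm).trans (le_of_eq ?_)
        rw [Measure.restrict_apply_univ]
    _ ≤ _ := by
        rw [← lintegral_const_mul' _ _ ENNReal.ofReal_ne_top]
        gcongr 2 * volume Sstar * ?_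
        refine lintegral_mono_ae ?_
        filter_upwards [hcell, ae_restrict_mem hS] with z hz hzS
        obtain ⟨J, hJ, hzJ⟩ := hz hzS
        exact fit_error_sq_le hτ hK hN hB hF hJ hzJ

end Bias

/-! ### Fourier transforms of functions supported in the cube -/

section Fourier

variable {d : ℕ}

/-- The character `x ↦ exp (i ⟨t, x⟩)`. -/
def expFun (t x : Space d) : ℂ :=
  Complex.exp (Complex.I * ((∑ k, t k * x k : ℝ) : ℂ))

/-- The Fourier transform `t ↦ ∫ f(x) exp (i ⟨t, x⟩) dx`. -/
def ft (f : Space d → ℂ) (t : Space d) : ℂ := ∫ x, f x * expFun t x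

lemma basisFun_eq_expFun (j : Fin d → ℤ) (x : Space d) : basisFun j x = expFun (intVec j) x := rfl

lemma fourierCoef_eq_ft (f : Space d → ℝ) (j : Fin d → ℤ) :
    fourierCoef f j = ft (fun x => (f x : ℂ)) (intVec j) := rfl

lemma norm_expFun (t x : Space d) : ‖expFun t x‖ = 1 := by
  rw [expFun, mul_comm, Complex.norm_exp_ofReal_mul_I]

lemma expFun_add (s t x : Space d) : expFun (s + t) x = expFun s x * expFun t x := by
  rw [expFun, expFun, expFun, ← Complex.exp_add, ← mul_add, ← Complex.ofReal_add,
    ← Finset.sum_add_distrib]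
  simp [add_mul]

lemma expFun_add_right (t x y : Space d) : expFun t (x + y) = expFun t x * expFun t y := by
  rw [expFun, expFun, expFun, ← Complex.exp_add, ← mul_add, ← Complex.ofReal_add,
    ← Finset.sum_add_distrib]
  simp [mul_add]

lemma intVec_neg (j : Fin d → ℤ) : intVec (-j) = -intVec j := by
  ext k; simp [intVec]

lemma intVec_add (i j : Fin d → ℤ) : intVec (i + j) = intVec i + intVec j := by
  ext k; simp [intVec]

lemma continuous_expFun : Continuous fun p : Space d × Space d => expFun p.1 p.2 := by
  unfold expFun; fun_prop

lemma continuous_expFun_right (t : Space d) : Continuous (expFun t) := by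
  unfold expFun; fun_prop

lemma integrable_mul_expFun {f : Space d → ℂ} (hf : Integrable f) (t : Space d) :
    Integrable fun x => f x * expFun t x :=
  hf.mul_bdd (c := 1) (continuous_expFun_right t).aestronglyMeasurable
    (Eventually.of_forall fun x => (norm_expFun t x).le)

lemma ft_eq_fourier (f : Space d → ℂ) (t : Space d) :
    ft f t = FourierTransform.fourier f (-(2 * Real.pi)⁻¹ • t) := by
  rw [Real.fourier_eq', ft]
  congr 1
  ext x
  rw [smul_eq_mul, mul_comm, expFun]
  congr 2
  rw [inner_smul_right, PiLp.inner_apply]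
  have hpi := Real.pi_ne_zero
  have h1 : ∑ i, inner ℝ (x i) (t i) = ∑ k, t k * x k := by simp
  rw [h1, mul_comm]
  congr 2
  field_simp

lemma fourier_eq_ft (f : Space d → ℂ) (w : Space d) :
    FourierTransform.fourier f w = ft f (-(2 * Real.pi) • w) := by
  rw [ft_eq_fourier, smul_smul]
  have hpi := Real.pi_ne_zero
  rw [show -(2 * Real.pi)⁻¹ * -(2 * Real.pi) = 1 by field_simp, one_smul]

/-- A smooth cutoff function for the compact subset `A` of the open cube. -/
structure IsCutoff (A : Set (Space d)) (η : ℝ → ℝ) (χ : Space d → ℝ) : Prop where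
  eq_prod : ∀ x, χ x = ∏ k, η (x k)
  continuous_one : Continuous η
  one_eq_zero : ∀ u, u ∉ Set.Ioo (-Real.pi) Real.pi → η u = 0
  one_pos : ∀ u ∈ Set.Ioo (-Real.pi) Real.pi, 0 < η u
  contDiff : ContDiff ℝ (⊤ : ℕ∞) χ
  eq_one : ∀ x ∈ A, χ x = 1
  hasCompactSupport : HasCompactSupport χ

/-- By compactness the coordinates on `A` are bounded by some `a < π`. The product of
one-dimensional bumps equal to `1` on `[-a, a]` and supported in `[-π, π]` works; its positivity on
the whole open cube later allows division by it outside `A`. -/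
lemma exists_isCutoff {A : Set (Space d)} (hA : IsCompact A) (hAc : A ⊆ openCube d) :
    ∃ η χ, IsCutoff A η χ := by
  obtain ⟨a, ha0, ha1, haA⟩ : ∃ a : ℝ, 0 < a ∧ a < Real.pi ∧ ∀ x ∈ A, ∀ k, |x k| ≤ a := by
    rcases A.eq_empty_or_nonempty with rfl | hne
    · exact ⟨1, one_pos, by linarith [Real.pi_gt_three], by simp⟩
    rcases isEmpty_or_nonempty (Fin d) with hd | hd
    · exact ⟨1, one_pos, by linarith [Real.pi_gt_three], fun x _ k => hd.elim k⟩
    have hcont : Continuous fun x : Space d => ‖(x : Fin d → ℝ)‖ := by fun_prop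
    obtain ⟨x₀, hx₀, hmax⟩ := hA.exists_isMaxOn hne hcont.continuousOn
    have hlt : ‖(x₀ : Fin d → ℝ)‖ < Real.pi := by
      refine (pi_norm_lt_iff Real.pi_pos).2 fun k => ?_
      rw [Real.norm_eq_abs, abs_lt]
      exact hAc hx₀ k
    refine ⟨max 1 ‖(x₀ : Fin d → ℝ)‖, by positivity, max_lt (by linarith [Real.pi_gt_three]) hlt,
      fun x hx k => ?_⟩
    exact ((norm_le_pi_norm (x : Fin d → ℝ) k).trans (hmax hx)).trans (le_max_right _ _)
  set b : ContDiffBump (0 : ℝ) := ⟨a, Real.pi, ha0, ha1⟩ with hb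
  have hzero : ∀ u, u ∉ Set.Ioo (-Real.pi) Real.pi → b u = 0 := by
    intro u hu
    have : u ∉ Function.support b := by
      rw [b.support_eq, Real.ball_eq_Ioo]
      simpa [hb] using hu
    simpa using this
  refine ⟨b, fun x => ∏ k, b (x k), ⟨fun _ => rfl, b.continuous, hzero, ?_, ?_, ?_, ?_⟩⟩
  · intro u hu
    refine b.pos_of_mem_ball ?_
    rw [Real.ball_eq_Ioo]
    simpa [hb] using hu
  · refine contDiff_prod fun k _ => b.contDiff.comp ?_
    fun_prop
  · intro x hx
    refine Finset.prod_eq_one fun k _ => b.one_of_mem_closedBall ?_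
    rw [mem_closedBall_zero_iff]
    exact haA x hx k
  · refine HasCompactSupport.of_support_subset_isCompact
      (K := (EuclideanSpace.equiv (Fin d) ℝ).toHomeomorph ⁻¹'
        (Set.univ.pi fun _ => Set.Icc (-Real.pi) Real.pi)) ?_ ?_
    · rw [Homeomorph.isCompact_preimage]
      exact isCompact_univ_pi fun _ => isCompact_Icc
    · intro x hx k _
      by_contra h
      refine hx (Finset.prod_eq_zero (Finset.mem_univ k) (hzero _ fun h' => h ?_))
      exact ⟨h'.1.le, h'.2.le⟩

end Fourier

/-! ### Fourier series of a cutoff character -/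

section FourierSeries

variable {d : ℕ}

lemma expFun_eq_prod (t x : Space d) :
    expFun t x = ∏ k, Complex.exp (Complex.I * ((t k * x k : ℝ) : ℂ)) := by
  rw [expFun, ← Complex.exp_sum, Complex.ofReal_sum, Finset.mul_sum]

lemma mFourier_coe_eq (n : Fin d → ℤ) (x : Fin d → ℝ) :
    UnitAddTorus.mFourier n (fun i => (x i : AddCircle (1 : ℝ)))
      = expFun (intVec n) ((2 * Real.pi) • WithLp.toLp 2 x) := by
  rw [expFun_eq_prod]
  change ∏ k, fourier (n k) ((x k : AddCircle (1 : ℝ))) = _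
  refine Finset.prod_congr rfl fun k _ => ?_
  rw [fourier_coe_apply]
  congr 1
  simp [intVec]
  ring

/-- The one-dimensional factor of the periodic extension of a cutoff character. -/
def torusFactor (η : ℝ → ℝ) (s : ℝ) : AddCircle (1 : ℝ) → ℂ :=
  AddCircle.liftIco 1 (-1 / 2) fun u =>
    (η (2 * Real.pi * u) : ℂ) * Complex.exp (Complex.I * ((s * (2 * Real.pi * u) : ℝ) : ℂ))

lemma torusFactor_ends {η : ℝ → ℝ} (hη : ∀ u, u ∉ Set.Ioo (-Real.pi) Real.pi → η u = 0) :
    η (2 * Real.pi * (-1 / 2)) = 0 ∧ η (2 * Real.pi * (-1 / 2 + 1)) = 0 := by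
  constructor <;> refine hη _ fun h => ?_
  · have := h.1; linarith
  · have := h.2; linarith

lemma continuous_torusFactor {η : ℝ → ℝ} (hηc : Continuous η)
    (hη : ∀ u, u ∉ Set.Ioo (-Real.pi) Real.pi → η u = 0) (s : ℝ) :
    Continuous (torusFactor η s) := by
  refine AddCircle.liftIco_continuous ?_ (by fun_prop)
  rw [(torusFactor_ends hη).1, (torusFactor_ends hη).2]
  simp

lemma torusFactor_coe {η : ℝ → ℝ} (hη : ∀ u, u ∉ Set.Ioo (-Real.pi) Real.pi → η u = 0) (s : ℝ)
    {u : ℝ} (hu : u ∈ Set.Icc (-1 / 2 : ℝ) (1 / 2)) :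
    torusFactor η s (u : AddCircle (1 : ℝ)) = (η (2 * Real.pi * u) : ℂ) *
      Complex.exp (Complex.I * ((s * (2 * Real.pi * u) : ℝ) : ℂ)) := by
  rcases hu.2.lt_or_eq with h | h
  · exact AddCircle.liftIco_coe_apply ⟨hu.1, by linarith⟩
  · have h1 : (u : AddCircle (1 : ℝ)) = ((-1 / 2 : ℝ) : AddCircle (1 : ℝ)) := by
      rw [h]
      have := AddCircle.coe_add_period (1 : ℝ) (-1 / 2)
      rw [← this]; norm_num
    have h2 := (torusFactor_ends hη)
    rw [h1, torusFactor, AddCircle.liftIco_coe_apply ⟨le_refl _, by norm_num⟩, h2.1, h]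
    have h3 := h2.2
    rw [show (-1 / 2 + 1 : ℝ) = 1 / 2 by norm_num] at h3
    rw [h3]; simp

/-- The periodic extension of `x ↦ χ(x) exp (i ⟨t, x⟩)`. -/
def torusFun {η : ℝ → ℝ} (hηc : Continuous η)
    (hη : ∀ u, u ∉ Set.Ioo (-Real.pi) Real.pi → η u = 0) (t : Space d) :
    C(UnitAddTorus (Fin d), ℂ) where
  toFun y := ∏ k, torusFactor η (t k) (y k)
  continuous_toFun := continuous_finsetProd _ fun k _ =>
    (continuous_torusFactor hηc hη (t k)).comp (continuous_apply k)

lemma torusFun_coe {A : Set (Space d)} {η : ℝ → ℝ} {χ : Space d → ℝ} (h : IsCutoff A η χ)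
    (t : Space d) {x : Fin d → ℝ} (hx : ∀ k, x k ∈ Set.Icc (-1 / 2 : ℝ) (1 / 2)) :
    torusFun h.continuous_one h.one_eq_zero t (fun k => (x k : AddCircle (1 : ℝ)))
      = (χ ((2 * Real.pi) • WithLp.toLp 2 x) : ℂ)
        * expFun t ((2 * Real.pi) • WithLp.toLp 2 x) := by
  rw [h.eq_prod, expFun_eq_prod, Complex.ofReal_prod, ← Finset.prod_mul_distrib]
  change ∏ k, torusFactor η (t k) (x k : AddCircle (1 : ℝ)) = _
  refine Finset.prod_congr rfl fun k _ => ?_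
  rw [torusFactor_coe h.one_eq_zero (t k) (hx k)]
  simp

lemma IsCutoff.eq_zero {A : Set (Space d)} {η : ℝ → ℝ} {χ : Space d → ℝ} (h : IsCutoff A η χ)
    {x : Space d} (hx : x ∉ openCube d) : χ x = 0 := by
  simp only [openCube, Set.mem_ofPred_eq, not_forall] at hx
  obtain ⟨k, hk⟩ := hx
  rw [h.eq_prod]
  exact Finset.prod_eq_zero (Finset.mem_univ k) (h.one_eq_zero _ hk)

/-- The torus has period `1`, whence the rescaling by `2π`. As `χ` vanishes off the open cube, an
integral over one period is an integral over the whole space. -/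
lemma mFourierCoeff_torusFun {A : Set (Space d)} {η : ℝ → ℝ} {χ : Space d → ℝ}
    (h : IsCutoff A η χ) (t : Space d) (n : Fin d → ℤ) :
    UnitAddTorus.mFourierCoeff (torusFun h.continuous_one h.one_eq_zero t) n
      = ((2 * Real.pi : ℝ) : ℂ)⁻¹ ^ d * ft (fun x => (χ x : ℂ)) (t - intVec n) := by
  have h2 : (0 : ℝ) < 2 * Real.pi := by positivity
  rw [UnitAddTorus.mFourierCoeff_eq_integral _ n (fun _ => (-1 / 2 : ℝ))]
  have hmeas : MeasurableSet {x : Fin d → ℝ | ∀ i, x i ∈ Set.Ioc (-1 / 2 : ℝ) (-1 / 2 + 1)} :=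
    MeasurableSet.univ_pi' fun _ => measurableSet_Ioc
  have key : ∀ x : Fin d → ℝ, ({x : Fin d → ℝ | ∀ i, x i ∈ Set.Ioc (-1 / 2 : ℝ) (-1 / 2 + 1)}).indicator
      (fun x => UnitAddTorus.mFourier (-n) (fun i => (x i : AddCircle (1 : ℝ))) •
        torusFun h.continuous_one h.one_eq_zero t (fun i => (x i : AddCircle (1 : ℝ)))) x
      = (fun y => (χ y : ℂ) * expFun (t - intVec n) y) ((2 * Real.pi) • WithLp.toLp 2 x) := by
    intro x
    by_cases hx : x ∈ {x : Fin d → ℝ | ∀ i, x i ∈ Set.Ioc (-1 / 2 : ℝ) (-1 / 2 + 1)}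
    · rw [Set.indicator_of_mem hx, torusFun_coe h t fun k =>
        ⟨(hx k).1.le, by have := (hx k).2; linarith⟩, mFourier_coe_eq, smul_eq_mul,
        sub_eq_add_neg t, ← intVec_neg]
      simp only [expFun_add]
      ring
    · rw [Set.indicator_of_notMem hx]
      have : χ ((2 * Real.pi) • WithLp.toLp 2 x) = 0 := by
        refine h.eq_zero fun hc => hx fun k => ?_
        have := hc k
        simp only [PiLp.smul_apply, smul_eq_mul, Set.mem_Ioo] at this
        constructor <;> nlinarith [this.1, this.2, Real.pi_pos]
      simp [this]
  rw [← integral_indicator hmeas, integral_congr_ae (Eventually.of_forall key)]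
  have e := (PiLp.volume_preserving_toLp (Fin d)).integral_comp
    (MeasurableEquiv.toLp 2 (Fin d → ℝ)).measurableEmbedding
    (fun x : Space d => (fun y => (χ y : ℂ) * expFun (t - intVec n) y) ((2 * Real.pi) • x))
  refine e.trans ((Measure.integral_comp_smul (volume : Measure (Space d))
    (fun y => (χ y : ℂ) * expFun (t - intVec n) y) (2 * Real.pi)).trans ?_)
  rw [ft, finrank_euclideanSpace_fin, abs_of_pos (by positivity), Complex.real_smul]
  rw [Complex.ofReal_inv, Complex.ofReal_pow, inv_pow]

/-- Where `χ = 1` this expands a character of arbitrary real frequency in characters of integer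
frequency, with coefficients decaying rapidly in `t - n`. -/
lemma hasSum_cutoff_mul_expFun {A : Set (Space d)} {η : ℝ → ℝ} {χ : Space d → ℝ}
    (h : IsCutoff A η χ) (t : Space d)
    (hs : Summable fun n : Fin d → ℤ => ft (fun x => (χ x : ℂ)) (t - intVec n))
    {x : Space d} (hx : x ∈ closedCube d) :
    HasSum (fun n : Fin d → ℤ => ((2 * Real.pi : ℝ) : ℂ)⁻¹ ^ d *
      ft (fun x => (χ x : ℂ)) (t - intVec n) * expFun (intVec n) x) ((χ x : ℂ) * expFun t x) := by
  have h2 : (0 : ℝ) < 2 * Real.pi := by positivity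
  have hsum : Summable (UnitAddTorus.mFourierCoeff (torusFun h.continuous_one h.one_eq_zero t)) := by
    refine (hs.mul_left (((2 * Real.pi : ℝ) : ℂ)⁻¹ ^ d)).congr fun n => ?_
    rw [mFourierCoeff_torusFun h]
  have e : x = (2 * Real.pi) • WithLp.toLp 2 (fun k => (2 * Real.pi)⁻¹ * x k) := by
    ext k
    rw [PiLp.smul_apply, smul_eq_mul, mul_inv_cancel_left₀ h2.ne']
  have hmem : ∀ k, (2 * Real.pi)⁻¹ * x k ∈ Set.Icc (-1 / 2 : ℝ) (1 / 2) := by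
    intro k
    have := hx k
    rw [inv_mul_eq_div]
    constructor
    · rw [le_div_iff₀ h2]; linarith [this.1]
    · rw [div_le_iff₀ h2]; linarith [this.2]
  have key := UnitAddTorus.hasSum_mFourier_series_apply_of_summable hsum
    (fun k => (((2 * Real.pi)⁻¹ * x k : ℝ) : AddCircle (1 : ℝ)))
  rw [torusFun_coe h t hmem, ← e] at key
  convert key using 1
  ext n
  rw [mFourierCoeff_torusFun h, mFourier_coe_eq, ← e, smul_eq_mul]

end FourierSeries

/-! ### Cauchy–Schwarz inequalities -/

section CauchySchwarz

lemma sq_lintegral_mul_le {β : Type*} [MeasurableSpace β] (ν : Measure β) {f g : β → ENNReal}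
    (hf : AEMeasurable f ν) (hg : AEMeasurable g ν) :
    (∫⁻ x, f x * g x ∂ν) ^ 2 ≤ (∫⁻ x, f x ^ 2 ∂ν) * ∫⁻ x, g x ^ 2 ∂ν := by
  have h := ENNReal.lintegral_mul_le_Lp_mul_Lq ν Real.HolderConjugate.two_two hf hg
  simp only [Pi.mul_apply, ENNReal.rpow_two] at h
  refine (pow_le_pow_left' h 2).trans (le_of_eq ?_)
  rw [mul_pow, ← ENNReal.rpow_two, ← ENNReal.rpow_two, ← ENNReal.rpow_mul, ← ENNReal.rpow_mul]
  norm_num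

lemma sq_lintegral_weight_mul_le {β : Type*} [MeasurableSpace β] (ν : Measure β)
    {w f : β → ENNReal} (hw : AEMeasurable w ν) (hf : AEMeasurable f ν) :
    (∫⁻ x, w x * f x ∂ν) ^ 2 ≤ (∫⁻ x, w x ∂ν) * ∫⁻ x, w x * f x ^ 2 ∂ν := by
  have hsq : ∀ x, w x ^ (1 / 2 : ℝ) * w x ^ (1 / 2 : ℝ) = w x := fun x => by
    rw [← ENNReal.rpow_add_of_nonneg _ _ (by norm_num) (by norm_num)]; norm_num
  have h := sq_lintegral_mul_le ν (hw.pow_const (1 / 2 : ℝ)) ((hw.pow_const (1 / 2 : ℝ)).mul hf)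
  simp only [Pi.mul_apply, mul_pow, ← mul_assoc, hsq] at h
  simpa only [sq, hsq] using h

lemma sq_tsum_mul_le {ι : Type*} [Countable ι] (f g : ι → ENNReal) :
    (∑' i, f i * g i) ^ 2 ≤ (∑' i, f i ^ 2) * ∑' i, g i ^ 2 := by
  let _ : MeasurableSpace ι := ⊤
  have := sq_lintegral_mul_le (Measure.count : Measure ι) (f := f) (g := g)
    (measurable_of_countable _).aemeasurable (measurable_of_countable _).aemeasurable
  simpa only [lintegral_count] using this

lemma sq_tsum_weight_mul_le {ι : Type*} [Countable ι] (w f : ι → ENNReal) :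
    (∑' i, w i * f i) ^ 2 ≤ (∑' i, w i) * ∑' i, w i * f i ^ 2 := by
  let _ : MeasurableSpace ι := ⊤
  have := sq_lintegral_weight_mul_le (Measure.count : Measure ι) (w := w) (f := f)
    (measurable_of_countable _).aemeasurable (measurable_of_countable _).aemeasurable
  simpa only [lintegral_count] using this

end CauchySchwarz

/-! ### Sums over the integer lattice -/

section Lattice

variable {d : ℕ}

/-- The unit cube of points whose coordinatewise floor is `j`. -/
def unitCube (j : Fin d → ℤ) : Set (Space d) := {x | ∀ k, ⌊x k⌋ = j k}

lemma measurableSet_unitCube (j : Fin d → ℤ) : MeasurableSet (unitCube j) := by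
  have : unitCube j = ⋂ k, (fun x : Space d => ⌊x k⌋) ⁻¹' {j k} := by
    ext x; simp [unitCube]
  rw [this]
  refine MeasurableSet.iInter fun k => ?_
  exact (Int.measurable_floor.comp (by fun_prop)) (measurableSet_singleton _)

lemma volume_unitCube (j : Fin d → ℤ) : volume (unitCube j) = 1 := by
  have e : unitCube j = (WithLp.ofLp : Space d → Fin d → ℝ) ⁻¹'
      (Set.univ.pi fun k => Set.Ico (j k : ℝ) (j k + 1)) := by
    ext x
    simp only [unitCube, Set.mem_ofPred_eq, Set.mem_preimage, Set.mem_pi, Set.mem_univ,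
      true_imp_iff, Int.floor_eq_iff, Set.mem_Ico]
  rw [e, (PiLp.volume_preserving_ofLp (Fin d)).measure_preimage
    (MeasurableSet.univ_pi fun _ => measurableSet_Ico).nullMeasurableSet, Real.volume_pi_Ico]
  simp

lemma norm_sub_intVec_le {j : Fin d → ℤ} {x : Space d} (hx : x ∈ unitCube j) :
    ‖x - intVec j‖ ≤ d := by
  have h1 : ‖x - intVec j‖ ^ 2 ≤ (d : ℝ) ^ 2 := by
    rw [EuclideanSpace.norm_sq_eq]
    calc ∑ k, ‖(x - intVec j) k‖ ^ 2 ≤ ∑ _k : Fin d, (1 : ℝ) := by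
          refine Finset.sum_le_sum fun k _ => ?_
          have h2 := hx k
          rw [Int.floor_eq_iff] at h2
          rw [PiLp.sub_apply, Real.norm_eq_abs, sq_abs]
          simp only [intVec]
          nlinarith [h2.1, h2.2]
      _ = d := by simp
      _ ≤ (d : ℝ) ^ 2 := by exact_mod_cast Nat.le_self_pow two_ne_zero d
  exact (sq_le_sq₀ (norm_nonneg _) (by positivity)).1 h1

/-- Peetre's inequality: weights move between `t` and a lattice point at the price of a power of the
distance between them. -/
lemma one_add_norm_le_mul {E : Type*} [SeminormedAddCommGroup E] (x y : E) :
    1 + ‖x‖ ≤ (1 + ‖y‖) * (1 + ‖x - y‖) := by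
  have : ‖x‖ ≤ ‖y‖ + ‖x - y‖ := by
    have := norm_add_le y (x - y); rwa [add_sub_cancel] at this
  nlinarith [norm_nonneg y, norm_nonneg (x - y), mul_nonneg (norm_nonneg y) (norm_nonneg (x - y))]

/-- Each term is compared with an integral over a cube of volume `1`, and these cubes tile the
space. -/
lemma tsum_le_lintegral_unitCube {f F : Space d → ENNReal} (j₀ : (Fin d → ℤ) → Space d)
    (h : ∀ j, ∀ x ∈ unitCube j, f (j₀ j) ≤ F x) :
    ∑' j, f (j₀ j) ≤ ∫⁻ x, F x := by
  have hU : ⋃ j : Fin d → ℤ, unitCube j = Set.univ :=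
    Set.eq_univ_of_forall fun x => Set.mem_iUnion.2 ⟨fun k => ⌊x k⌋, fun _ => rfl⟩
  rw [← setLIntegral_univ, ← hU, lintegral_iUnion measurableSet_unitCube]
  · refine ENNReal.tsum_le_tsum fun j => ?_
    calc f (j₀ j) = ∫⁻ _ in unitCube j, f (j₀ j) := by
          rw [setLIntegral_const, volume_unitCube, mul_one]
      _ ≤ _ := setLIntegral_mono' (measurableSet_unitCube j) (h j)
  · intro i j hij
    refine Set.disjoint_left.2 fun x hi hj => hij ?_
    funext k
    exact (hi k).symm.trans (hj k)

/-- Translates of `(1 + ‖·‖)⁻ʳ` are uniformly summable over the lattice when `d < r`. -/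
lemma exists_tsum_one_add_norm_sub_le {r : ℝ} (hr : (d : ℝ) < r) :
    ∃ W : ENNReal, W ≠ ⊤ ∧ ∀ t : Space d,
      ∑' j : Fin d → ℤ, ENNReal.ofReal ((1 + ‖t - intVec j‖) ^ (-r)) ≤ W := by
  have hr0 : 0 ≤ r := (Nat.cast_nonneg d).trans hr.le
  refine ⟨ENNReal.ofReal ((1 + d : ℝ) ^ r) * ∫⁻ x : Space d, ENNReal.ofReal ((1 + ‖x‖) ^ (-r)),
    ENNReal.mul_ne_top ENNReal.ofReal_ne_top
      (finite_integral_one_add_norm (by simpa using hr)).ne, fun t => ?_⟩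
  have e : ∫⁻ x : Space d, ENNReal.ofReal ((1 + ‖x‖) ^ (-r))
      = ∫⁻ x : Space d, ENNReal.ofReal ((1 + ‖t - x‖) ^ (-r)) :=
    (lintegral_sub_left_eq_self (μ := (volume : Measure (Space d)))
      (fun x => ENNReal.ofReal ((1 + ‖x‖) ^ (-r))) t).symm
  rw [e, ← lintegral_const_mul _ (by fun_prop)]
  refine tsum_le_lintegral_unitCube (f := fun y => ENNReal.ofReal ((1 + ‖t - y‖) ^ (-r))) intVec
    fun j x hx => ?_
  rw [← ENNReal.ofReal_mul (by positivity)]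
  refine ENNReal.ofReal_le_ofReal ?_
  have h1 : 1 + ‖t - x‖ ≤ (1 + ‖t - intVec j‖) * (1 + d) := by
    refine (one_add_norm_le_mul (t - x) (t - intVec j)).trans ?_
    gcongr
    have := norm_sub_intVec_le hx
    rwa [sub_sub_sub_cancel_left, norm_sub_rev]
  have h2 : (1 + ‖t - x‖) ^ r ≤ (1 + ‖t - intVec j‖) ^ r * (1 + d : ℝ) ^ r := by
    rw [← Real.mul_rpow (by positivity) (by positivity)]
    exact Real.rpow_le_rpow (by positivity) h1 hr0
  rw [Real.rpow_neg (by positivity), Real.rpow_neg (by positivity), ← div_eq_mul_inv,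
    le_div_iff₀ (by positivity), inv_mul_le_iff₀ (by positivity)]
  exact h2

end Lattice

/-! ### Rapid decay of the transform of the cutoff -/

section Decay

variable {d : ℕ}

/-- The Fourier transform of a smooth cutoff function decays rapidly. -/
lemma IsCutoff.exists_norm_ft_le {A : Set (Space d)} {η : ℝ → ℝ} {χ : Space d → ℝ}
    (h : IsCutoff A η χ) (r : ℝ) :
    ∃ C : ℝ, 0 < C ∧ ∀ t : Space d, ‖ft (fun x => (χ x : ℂ)) t‖ ≤ C * (1 + ‖t‖) ^ (-r) := by
  obtain ⟨N, hN⟩ := exists_nat_ge r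
  have hc : HasCompactSupport fun x => (χ x : ℂ) := h.hasCompactSupport.comp_left Complex.ofReal_zero
  have hd : ContDiff ℝ (⊤ : ℕ∞) fun x => (χ x : ℂ) := Complex.ofRealCLM.contDiff.comp h.contDiff
  set f : SchwartzMap (Space d) ℂ := hc.toSchwartzMap hd with hf
  have hfc : ⇑f = fun x => (χ x : ℂ) := rfl
  set C₀ := 2 ^ N * ((Finset.Iic (N, 0)).sup fun m => SchwartzMap.seminorm ℝ m.1 m.2)
    (FourierTransform.fourier f) with hC₀
  have hdec : ∀ w, (1 + ‖w‖) ^ N * ‖FourierTransform.fourier (fun x => (χ x : ℂ)) w‖ ≤ C₀ := by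
    intro w
    have := SchwartzMap.one_add_le_sup_seminorm_apply (𝕜 := ℝ) (m := (N, 0)) le_rfl le_rfl
      (FourierTransform.fourier f) w
    rwa [norm_iteratedFDeriv_zero, SchwartzMap.fourier_coe, hfc] at this
  have h2 : (1 : ℝ) ≤ 2 * Real.pi := by linarith [Real.pi_gt_three]
  have hC0 : 0 ≤ C₀ := le_trans (by positivity) (hdec 0)
  refine ⟨(2 * Real.pi) ^ N * C₀ + 1, by positivity, fun t => ?_⟩
  have h3 := hdec (-(2 * Real.pi)⁻¹ • t)
  rw [← ft_eq_fourier, norm_smul, norm_neg, norm_inv, Real.norm_of_nonneg (by positivity)] at h3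
  have h4 : 1 + ‖t‖ ≤ (2 * Real.pi) * (1 + (2 * Real.pi)⁻¹ * ‖t‖) := by
    rw [mul_add, mul_inv_cancel_left₀ (by positivity)]; linarith
  have h5 : (1 + ‖t‖) ^ r ≤ (2 * Real.pi) ^ N * (1 + (2 * Real.pi)⁻¹ * ‖t‖) ^ N := by
    calc (1 + ‖t‖) ^ r ≤ (1 + ‖t‖) ^ (N : ℝ) :=
          Real.rpow_le_rpow_of_exponent_le (by linarith [norm_nonneg t]) hN
      _ = (1 + ‖t‖) ^ N := Real.rpow_natCast _ _
      _ ≤ _ := by rw [← mul_pow]; gcongr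
  rw [Real.rpow_neg (by positivity), ← div_eq_mul_inv, le_div_iff₀ (by positivity)]
  calc ‖ft (fun x => (χ x : ℂ)) t‖ * (1 + ‖t‖) ^ r
      ≤ ‖ft (fun x => (χ x : ℂ)) t‖ * ((2 * Real.pi) ^ N * (1 + (2 * Real.pi)⁻¹ * ‖t‖) ^ N) := by
        gcongr
    _ = (2 * Real.pi) ^ N * ((1 + (2 * Real.pi)⁻¹ * ‖t‖) ^ N * ‖ft (fun x => (χ x : ℂ)) t‖) := by
        ring
    _ ≤ (2 * Real.pi) ^ N * C₀ := by gcongr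
    _ ≤ _ := by linarith

end Decay

/-! ### The Fourier transform in terms of the Fourier coefficients -/

section Sampling

variable {d : ℕ} {A : Set (Space d)} {η : ℝ → ℝ} {χ : Space d → ℝ}

lemma enorm_le_ofReal_of_norm_le {E : Type*} [SeminormedAddCommGroup E] {x : E} {c : ℝ}
    (h : ‖x‖ ≤ c) : ‖x‖ₑ ≤ ENNReal.ofReal c := by
  rw [← ofReal_norm]; exact ENNReal.ofReal_le_ofReal h

lemma IsCutoff.summable_ft_sub (h : IsCutoff A η χ) (t : Space d) :
    Summable fun n : Fin d → ℤ => ft (fun x => (χ x : ℂ)) (t - intVec n) := by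
  obtain ⟨C, hC, hb⟩ := h.exists_norm_ft_le ((d : ℝ) + 1)
  obtain ⟨W, hW, hWb⟩ := exists_tsum_one_add_norm_sub_le (d := d) (r := (d : ℝ) + 1) (by linarith)
  have h1 : Summable fun n : Fin d → ℤ => (1 + ‖t - intVec n‖) ^ (-((d : ℝ) + 1)) := by
    have := ENNReal.summable_toReal (ne_top_of_le_ne_top hW (hWb t))
    refine this.congr fun n => ENNReal.toReal_ofReal (by positivity)
  exact Summable.of_norm_bounded (h1.mul_left C) fun n => hb _

/-- Sampling expansion: inserting the series of the cutoff character into `∫ f(x) exp(i⟨t, x⟩) dx`,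
which is legitimate because `χ = 1` on the support of `f`, recovers the transform at every real
frequency from its values on the integer lattice. -/
lemma IsCutoff.hasSum_ft (h : IsCutoff A η χ) (hAc : A ⊆ openCube d) {f : Space d → ℂ}
    (hf : Integrable f) (hfA : Function.support f ⊆ A) (t : Space d) :
    HasSum (fun n : Fin d → ℤ => ((2 * Real.pi : ℝ) : ℂ)⁻¹ ^ d *
      ft (fun x => (χ x : ℂ)) (t - intVec n) * ft f (intVec n)) (ft f t) := by
  have hs := h.summable_ft_sub t
  have key := hasSum_integral_of_summable_integral_norm (μ := (volume : Measure (Space d)))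
    (F := fun (n : Fin d → ℤ) x => ((2 * Real.pi : ℝ) : ℂ)⁻¹ ^ d *
      ft (fun x => (χ x : ℂ)) (t - intVec n) * (f x * expFun (intVec n) x))
    (fun n => (integrable_mul_expFun hf _).const_mul _) ?_
  · simp_rw [integral_const_mul] at key
    suffices e2 : ft f t = ∫ x, ∑' n : Fin d → ℤ, ((2 * Real.pi : ℝ) : ℂ)⁻¹ ^ d *
        ft (fun x => (χ x : ℂ)) (t - intVec n) * (f x * expFun (intVec n) x) by
      rw [e2]; exact key
    refine integral_congr_ae (Eventually.of_forall fun x => ?_)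
    by_cases hx : f x = 0
    · simp [hx]
    · have hxA := hfA hx
      have hc : x ∈ closedCube d := fun k => ⟨(hAc hxA k).1.le, (hAc hxA k).2.le⟩
      have e := (hasSum_cutoff_mul_expFun h t hs hc).mul_left (f x)
      rw [h.eq_one x hxA, Complex.ofReal_one, one_mul] at e
      refine (e.tsum_eq.symm.trans ?_)
      exact tsum_congr fun n => by ring
  · simp_rw [norm_mul, norm_expFun, mul_one, integral_const_mul]
    exact (hs.norm.mul_left _).mul_right _

lemma IsCutoff.enorm_ft_le (h : IsCutoff A η χ) (hAc : A ⊆ openCube d) {f : Space d → ℂ}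
    (hf : Integrable f) (hfA : Function.support f ⊆ A) (t : Space d) :
    ‖ft f t‖ₑ ≤ ∑' n : Fin d → ℤ, ‖ft (fun x => (χ x : ℂ)) (t - intVec n)‖ₑ *
      ‖ft f (intVec n)‖ₑ := by
  rw [← (h.hasSum_ft hAc hf hfA t).tsum_eq]
  refine enorm_tsum_le_tsum_enorm.trans (ENNReal.tsum_le_tsum fun n => ?_)
  rw [enorm_mul, enorm_mul]
  gcongr
  refine mul_le_of_le_one_left' ?_
  rw [enorm_pow]
  refine pow_le_one' ?_ d
  refine (enorm_le_ofReal_of_norm_le (c := 1) ?_).trans (by simp)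
  rw [norm_inv, Complex.norm_real, Real.norm_of_nonneg (by positivity)]
  exact inv_le_one_of_one_le₀ (by linarith [Real.pi_gt_three])

lemma one_add_norm_rpow_peetre {E : Type*} [SeminormedAddCommGroup E] (x y : E) {s : ℝ}
    (hs : 0 ≤ s) : (1 + ‖x‖) ^ s ≤ (1 + ‖y‖) ^ s * (1 + ‖x - y‖) ^ s := by
  rw [← Real.mul_rpow (by positivity) (by positivity)]
  exact Real.rpow_le_rpow (by positivity) (one_add_norm_le_mul x y) hs

/-- Decay of the Fourier coefficients implies decay of the Fourier transform. -/
lemma IsCutoff.exists_norm_ft_le_of_coef (h : IsCutoff A η χ) (hAc : A ⊆ openCube d)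
    {f : Space d → ℂ} (hf : Integrable f) (hfA : Function.support f ⊆ A) {γ C : ℝ} (hγ : 0 ≤ γ)
    (hC : ∀ n : Fin d → ℤ, ‖ft f (intVec n)‖ ≤ C * (1 + ‖intVec n‖) ^ (-γ)) :
    ∃ C' : ℝ, 0 < C' ∧ ∀ t : Space d, ‖ft f t‖ ≤ C' * (1 + ‖t‖) ^ (-γ) := by
  -- The decay is split: the order `d + 1` makes the lattice sum converge, the order `γ` is spent in
  -- Peetre's inequality.
  obtain ⟨C₁, hC₁, hb⟩ := h.exists_norm_ft_le (((d : ℝ) + 1) + γ)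
  obtain ⟨W, hW, hWb⟩ := exists_tsum_one_add_norm_sub_le (d := d) (r := (d : ℝ) + 1) (by linarith)
  have hC0 : 0 ≤ C := by
    have h1 := (norm_nonneg _).trans (hC 0)
    have h2 : (0 : ℝ) < (1 + ‖intVec (0 : Fin d → ℤ)‖) ^ (-γ) := by positivity
    exact le_of_mul_le_mul_right (by simpa using h1) h2
  refine ⟨C₁ * C * W.toReal + 1, by positivity, fun t => ?_⟩
  have hpt : ∀ n : Fin d → ℤ, ‖ft (fun x => (χ x : ℂ)) (t - intVec n)‖ₑ * ‖ft f (intVec n)‖ₑ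
      ≤ ENNReal.ofReal (C₁ * C * (1 + ‖t‖) ^ (-γ)) *
        ENNReal.ofReal ((1 + ‖t - intVec n‖) ^ (-((d : ℝ) + 1))) := by
    intro n
    rw [← ENNReal.ofReal_mul (by positivity), ← enorm_mul]
    refine enorm_le_ofReal_of_norm_le ?_
    rw [norm_mul]
    refine (mul_le_mul (hb _) (hC n) (norm_nonneg _) (by positivity)).trans ?_
    have hp := one_add_norm_rpow_peetre t (intVec n) hγ
    rw [neg_add, Real.rpow_add (by positivity)]
    have e : (1 + ‖intVec n‖) ^ (-γ) * (1 + ‖t - intVec n‖) ^ (-γ) ≤ (1 + ‖t‖) ^ (-γ) := by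
      simp only [Real.rpow_neg (by positivity : (0 : ℝ) ≤ 1 + ‖t‖),
        Real.rpow_neg (by positivity : (0 : ℝ) ≤ 1 + ‖intVec n‖),
        Real.rpow_neg (by positivity : (0 : ℝ) ≤ 1 + ‖t - intVec n‖)]
      rw [← mul_inv]
      exact inv_anti₀ (by positivity) hp
    calc _ = C₁ * C * (1 + ‖t - intVec n‖) ^ (-((d : ℝ) + 1)) *
          ((1 + ‖intVec n‖) ^ (-γ) * (1 + ‖t - intVec n‖) ^ (-γ)) := by ring
      _ ≤ C₁ * C * (1 + ‖t - intVec n‖) ^ (-((d : ℝ) + 1)) * (1 + ‖t‖) ^ (-γ) := by gcongr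
      _ = _ := by ring
  have h1 : ‖ft f t‖ₑ ≤ ENNReal.ofReal (C₁ * C * (1 + ‖t‖) ^ (-γ)) * W := by
    refine (h.enorm_ft_le hAc hf hfA t).trans ((ENNReal.tsum_le_tsum hpt).trans ?_)
    rw [ENNReal.tsum_mul_left]
    gcongr
    exact hWb t
  have h2 : ‖ft f t‖ ≤ C₁ * C * (1 + ‖t‖) ^ (-γ) * W.toReal := by
    have := ENNReal.toReal_mono (ENNReal.mul_ne_top ENNReal.ofReal_ne_top hW) h1
    rwa [toReal_enorm, ENNReal.toReal_mul, ENNReal.toReal_ofReal (by positivity)] at this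
  have h3 : (0 : ℝ) < (1 + ‖t‖) ^ (-γ) := by positivity
  nlinarith

/-- The weighted `L²` norm of the Fourier transform is bounded by that of the coefficients. -/
lemma IsCutoff.exists_lintegral_ft_sq_le (h : IsCutoff A η χ) (hAc : A ⊆ openCube d) {s : ℝ}
    (hs : 0 ≤ s) :
    ∃ C : ENNReal, C ≠ ⊤ ∧ ∀ f : Space d → ℂ, Integrable f → Function.support f ⊆ A →
      ∫⁻ t, ENNReal.ofReal ((1 + ‖t‖) ^ s) * ‖ft f t‖ₑ ^ 2 ≤
        C * ∑' n : Fin d → ℤ, ENNReal.ofReal ((1 + ‖intVec n‖) ^ s) * ‖ft f (intVec n)‖ₑ ^ 2 := by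
  obtain ⟨C₁, hC₁, hb⟩ := h.exists_norm_ft_le (((d : ℝ) + 1) + s)
  obtain ⟨W, hW, hWb⟩ := exists_tsum_one_add_norm_sub_le (d := d) (r := (d : ℝ) + 1) (by linarith)
  set I := ∫⁻ x : Space d, ENNReal.ofReal ((1 + ‖x‖) ^ (-((d : ℝ) + 1))) with hI
  have hIfin : I ≠ ⊤ := (finite_integral_one_add_norm (by simp)).ne
  refine ⟨ENNReal.ofReal C₁ * W * ENNReal.ofReal C₁ * I, by finiteness, fun f hf hfA => ?_⟩
  have hw : ∀ (t : Space d) (n : Fin d → ℤ), ‖ft (fun x => (χ x : ℂ)) (t - intVec n)‖ₑ ≤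
      ENNReal.ofReal C₁ * ENNReal.ofReal ((1 + ‖t - intVec n‖) ^ (-((d : ℝ) + 1))) := by
    intro t n
    rw [← ENNReal.ofReal_mul hC₁.le]
    refine enorm_le_ofReal_of_norm_le ((hb _).trans ?_)
    refine mul_le_mul_of_nonneg_left ?_ hC₁.le
    exact Real.rpow_le_rpow_of_exponent_le (by linarith [norm_nonneg (t - intVec n)]) (by linarith)
  have hw' : ∀ (t : Space d) (n : Fin d → ℤ), ENNReal.ofReal ((1 + ‖t‖) ^ s) *
      ‖ft (fun x => (χ x : ℂ)) (t - intVec n)‖ₑ ≤ ENNReal.ofReal C₁ *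
        (ENNReal.ofReal ((1 + ‖intVec n‖) ^ s) *
          ENNReal.ofReal ((1 + ‖t - intVec n‖) ^ (-((d : ℝ) + 1)))) := by
    intro t n
    rw [← ENNReal.ofReal_mul (by positivity), ← ENNReal.ofReal_mul hC₁.le, ← ofReal_norm,
      ← ENNReal.ofReal_mul (by positivity)]
    refine ENNReal.ofReal_le_ofReal ?_
    have hp := one_add_norm_rpow_peetre t (intVec n) hs
    have e : (1 + ‖t - intVec n‖) ^ s * (1 + ‖t - intVec n‖) ^ (-s) = 1 := by
      rw [← Real.rpow_add (by positivity)]; simp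
    calc (1 + ‖t‖) ^ s * ‖ft (fun x => (χ x : ℂ)) (t - intVec n)‖
        ≤ ((1 + ‖intVec n‖) ^ s * (1 + ‖t - intVec n‖) ^ s) *
          (C₁ * (1 + ‖t - intVec n‖) ^ (-(((d : ℝ) + 1) + s))) := by
          gcongr
          exact hb _
      _ = C₁ * ((1 + ‖intVec n‖) ^ s * (1 + ‖t - intVec n‖) ^ (-((d : ℝ) + 1))) *
          ((1 + ‖t - intVec n‖) ^ s * (1 + ‖t - intVec n‖) ^ (-s)) := by
          rw [neg_add, Real.rpow_add (by positivity)]; ring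
      _ = _ := by rw [e, mul_one]
  have hpt : ∀ t, ENNReal.ofReal ((1 + ‖t‖) ^ s) * ‖ft f t‖ₑ ^ 2 ≤
      ENNReal.ofReal C₁ * W * ENNReal.ofReal C₁ * ∑' n : Fin d → ℤ,
        (ENNReal.ofReal ((1 + ‖intVec n‖) ^ s) * ‖ft f (intVec n)‖ₑ ^ 2) *
          ENNReal.ofReal ((1 + ‖t - intVec n‖) ^ (-((d : ℝ) + 1))) := by
    intro t
    -- Schur-type argument: Cauchy–Schwarz with the kernel as weight, whose sum over the lattice is
    -- bounded uniformly in `t`. The remaining factor of the kernel is integrated over `t`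
    -- afterwards.
    have h1 : ‖ft f t‖ₑ ^ 2 ≤ ENNReal.ofReal C₁ * W *
        ∑' n : Fin d → ℤ, ‖ft (fun x => (χ x : ℂ)) (t - intVec n)‖ₑ * ‖ft f (intVec n)‖ₑ ^ 2 := by
      refine (pow_le_pow_left' (h.enorm_ft_le hAc hf hfA t) 2).trans
        ((sq_tsum_weight_mul_le _ _).trans ?_)
      gcongr
      refine (ENNReal.tsum_le_tsum (hw t)).trans ?_
      rw [ENNReal.tsum_mul_left]
      gcongr
      exact hWb t
    refine (mul_le_mul_right h1 _).trans ?_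
    rw [mul_left_comm, ← ENNReal.tsum_mul_left, mul_assoc (ENNReal.ofReal C₁ * W)]
    gcongr
    rw [← ENNReal.tsum_mul_left]
    refine ENNReal.tsum_le_tsum fun n => ?_
    calc _ = (ENNReal.ofReal ((1 + ‖t‖) ^ s) * ‖ft (fun x => (χ x : ℂ)) (t - intVec n)‖ₑ) *
          ‖ft f (intVec n)‖ₑ ^ 2 := by ring
      _ ≤ _ := mul_le_mul_left (hw' t n) _
      _ = _ := by ring
  refine (lintegral_mono hpt).trans ?_
  rw [lintegral_const_mul _ (by
    refine Measurable.tsum fun n => ?_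
    fun_prop), lintegral_tsum fun n => by fun_prop]
  have e : ∀ n : Fin d → ℤ, ∫⁻ t : Space d,
      (ENNReal.ofReal ((1 + ‖intVec n‖) ^ s) * ‖ft f (intVec n)‖ₑ ^ 2) *
          ENNReal.ofReal ((1 + ‖t - intVec n‖) ^ (-((d : ℝ) + 1))) =
      (ENNReal.ofReal ((1 + ‖intVec n‖) ^ s) * ‖ft f (intVec n)‖ₑ ^ 2) * I := by
    intro n
    rw [lintegral_const_mul _ (by fun_prop), lintegral_sub_right_eq_self
      (fun t : Space d => ENNReal.ofReal ((1 + ‖t‖) ^ (-((d : ℝ) + 1))))]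
  simp_rw [e]
  rw [ENNReal.tsum_mul_right]
  exact le_of_eq (by ring)

end Sampling

/-! ### Parseval's identity on the cube -/

section Parseval

variable {d : ℕ}

lemma closedCube_eq_preimage :
    closedCube d = (WithLp.ofLp : Space d → Fin d → ℝ) ⁻¹'
      (Set.univ.pi fun _ => Set.Icc (-Real.pi) Real.pi) := by
  ext x; simp only [closedCube, Set.mem_ofPred_eq, Set.mem_preimage, Set.mem_univ_pi]

lemma openCube_eq_preimage :
    openCube d = (WithLp.ofLp : Space d → Fin d → ℝ) ⁻¹'
      (Set.univ.pi fun _ => Set.Ioo (-Real.pi) Real.pi) := by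
  ext x; simp [openCube]

lemma measurableSet_closedCube : MeasurableSet (closedCube d) := by
  rw [closedCube_eq_preimage]
  exact (PiLp.volume_preserving_ofLp (Fin d)).measurable (MeasurableSet.univ_pi fun _ => measurableSet_Icc)

lemma openCube_ae_eq_closedCube : openCube d =ᵐ[volume] closedCube d := by
  rw [closedCube_eq_preimage, openCube_eq_preimage]
  refine (PiLp.volume_preserving_ofLp (Fin d)).quasiMeasurePreserving.preimage_ae_eq ?_
  rw [Set.pi_univ_Icc]
  exact Measure.univ_pi_Ioo_ae_eq_Icc

lemma volume_closedCube_lt_top : volume (closedCube d) < ⊤ := by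
  rw [closedCube_eq_preimage, (PiLp.volume_preserving_ofLp (Fin d)).measure_preimage
    (MeasurableSet.univ_pi fun _ => measurableSet_Icc).nullMeasurableSet, Set.pi_univ_Icc]
  exact measure_Icc_lt_top

lemma integral_Icc_exp_int (m : ℤ) :
    ∫ x in Set.Icc (-Real.pi) Real.pi, Complex.exp (Complex.I * (((m : ℝ) * x : ℝ) : ℂ))
      = if m = 0 then ((2 * Real.pi : ℝ) : ℂ) else 0 := by
  have hpi : -Real.pi ≤ Real.pi := by linarith [Real.pi_pos]
  rw [integral_Icc_eq_integral_Ioc, ← intervalIntegral.integral_of_le hpi]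
  split_ifs with hm
  · simp [hm]; ring
  · have hc : Complex.I * (m : ℂ) ≠ 0 := by simp [hm]
    have e : ∀ x : ℝ, Complex.I * (((m : ℝ) * x : ℝ) : ℂ) = (Complex.I * (m : ℂ)) * x := by
      intro x; push_cast; ring
    simp_rw [e]
    rw [integral_exp_mul_complex hc]
    have : Complex.exp (Complex.I * m * (Real.pi : ℝ)) = Complex.exp (Complex.I * m * ((-Real.pi : ℝ) : ℂ)) := by
      rw [Complex.exp_eq_exp_iff_exists_int]
      exact ⟨m, by push_cast; ring⟩
    rw [this, sub_self, zero_div]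

lemma integral_closedCube_expFun (m : Fin d → ℤ) :
    ∫ x in closedCube d, expFun (intVec m) x
      = if m = 0 then (((2 * Real.pi) ^ d : ℝ) : ℂ) else 0 := by
  have h1 : ∫ x in closedCube d, expFun (intVec m) x =
      ∫ y in Set.univ.pi fun _ : Fin d => Set.Icc (-Real.pi) Real.pi,
        expFun (intVec m) (WithLp.toLp 2 y) := by
    rw [closedCube_eq_preimage]
    exact (PiLp.volume_preserving_ofLp (Fin d)).setIntegral_preimage_emb
      (MeasurableEquiv.toLp 2 (Fin d → ℝ)).symm.measurableEmbedding
      (fun y => expFun (intVec m) (WithLp.toLp 2 y)) _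
  rw [h1, volume_pi, Measure.restrict_pi_pi]
  simp_rw [expFun_eq_prod, intVec]
  rw [integral_fintype_prod_eq_prod (fun k : Fin d => fun x : ℝ =>
    Complex.exp (Complex.I * (((m k : ℝ) * x : ℝ) : ℂ)))]
  simp_rw [integral_Icc_exp_int]
  split_ifs with hm
  · simp [hm]
  · obtain ⟨k, hk⟩ := Function.ne_iff.1 hm
    exact Finset.prod_eq_zero (Finset.mem_univ k) (if_neg hk)

/-- The sum of the Fourier series with coefficients `c` at the characters `φ_{-n}`. -/
def series (c : (Fin d → ℤ) → ℂ) (x : Space d) : ℂ := ∑' n, c n * expFun (-intVec n) x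

lemma hasSum_series {c : (Fin d → ℤ) → ℂ} (hc : Summable c) (x : Space d) :
    HasSum (fun n => c n * expFun (-intVec n) x) (series c x) := by
  refine Summable.hasSum (Summable.of_norm ?_)
  simpa only [norm_mul, norm_expFun, mul_one] using hc.norm

lemma continuous_series {c : (Fin d → ℤ) → ℂ} (hc : Summable c) : Continuous (series c) := by
  refine continuous_tsum (u := fun n => ‖c n‖)
    (fun n => continuous_const.mul (continuous_expFun_right _)) hc.norm fun n x => ?_
  rw [norm_mul, norm_expFun, mul_one]

lemma norm_series_le {c : (Fin d → ℤ) → ℂ} (hc : Summable c) (x : Space d) :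
    ‖series c x‖ ≤ ∑' n, ‖c n‖ := by
  have h := hc.norm
  refine (norm_tsum_le_tsum_norm ?_).trans (le_of_eq ?_)
  · simpa only [norm_mul, norm_expFun, mul_one] using h
  · simp only [norm_mul, norm_expFun, mul_one]

lemma hasSum_integral_mul_series {c : (Fin d → ℤ) → ℂ} (hc : Summable c) {μ : Measure (Space d)}
    {w : Space d → ℂ} (hw : Integrable w μ) :
    HasSum (fun n => c n * ∫ x, w x * expFun (-intVec n) x ∂μ) (∫ x, w x * series c x ∂μ) := by
  have key := hasSum_integral_of_summable_integral_norm (μ := μ)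
    (F := fun (n : Fin d → ℤ) x => c n * (w x * expFun (-intVec n) x))
    (fun n => (hw.mul_bdd (c := 1) (continuous_expFun_right _).aestronglyMeasurable
      (Eventually.of_forall fun x => (norm_expFun _ x).le)).const_mul _) ?_
  · simp_rw [integral_const_mul] at key
    suffices e2 : ∫ x, w x * series c x ∂μ
        = ∫ x, ∑' n : Fin d → ℤ, c n * (w x * expFun (-intVec n) x) ∂μ by
      rw [e2]; exact key
    refine integral_congr_ae (Eventually.of_forall fun x => ?_)
    simp only
    rw [← (hasSum_series hc x).tsum_eq, ← tsum_mul_left]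
    exact tsum_congr fun n => by ring
  · simp_rw [norm_mul, norm_expFun, mul_one, integral_const_mul]
    exact hc.norm.mul_right _

lemma conj_expFun (t x : Space d) : (starRingEnd ℂ) (expFun t x) = expFun (-t) x := by
  rw [expFun, expFun, ← Complex.exp_conj]
  congr 1
  rw [map_mul, Complex.conj_I, Complex.conj_ofReal]
  simp

lemma integral_closedCube_series_mul {c : (Fin d → ℤ) → ℂ} (hc : Summable c) (m : Fin d → ℤ) :
    ∫ x in closedCube d, expFun (intVec m) x * series c x = (((2 * Real.pi) ^ d : ℝ) : ℂ) * c m := by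
  have hfin : IsFiniteMeasure ((volume : Measure (Space d)).restrict (closedCube d)) :=
    ⟨by rw [Measure.restrict_apply_univ]; exact volume_closedCube_lt_top⟩
  have hw : Integrable (expFun (intVec m)) ((volume : Measure (Space d)).restrict (closedCube d)) :=
    Integrable.of_bound (continuous_expFun_right _).aestronglyMeasurable 1
      (Eventually.of_forall fun x => (norm_expFun _ x).le)
  have h := hasSum_integral_mul_series hc hw
  have e : ∀ n : Fin d → ℤ, c n * ∫ x in closedCube d, expFun (intVec m) x * expFun (-intVec n) x
      = if n = m then (((2 * Real.pi) ^ d : ℝ) : ℂ) * c m else 0 := by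
    intro n
    simp_rw [← expFun_add, ← intVec_neg, ← intVec_add]
    rw [integral_closedCube_expFun]
    by_cases hnm : n = m
    · subst hnm; simp [mul_comm]
    · rw [if_neg hnm, if_neg, mul_zero]
      rw [← sub_eq_add_neg, sub_eq_zero]
      exact fun h => hnm h.symm
  simp_rw [e] at h
  exact h.unique (hasSum_ite_eq m _)

/-- For absolutely summable coefficients Parseval follows from termwise integration and
orthogonality. This suffices: the estimator has finitely many coefficients, and those of the
regression functions are summable. -/
lemma lintegral_closedCube_series_sq {c : (Fin d → ℤ) → ℂ} (hc : Summable c) :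
    ∫⁻ x in closedCube d, ‖series c x‖ₑ ^ 2
      = ENNReal.ofReal ((2 * Real.pi) ^ d) * ∑' n, ‖c n‖ₑ ^ 2 := by
  have hfin : IsFiniteMeasure ((volume : Measure (Space d)).restrict (closedCube d)) :=
    ⟨by rw [Measure.restrict_apply_univ]; exact volume_closedCube_lt_top⟩
  have hcont := continuous_series hc
  have hw : Integrable (fun x => (starRingEnd ℂ) (series c x))
      ((volume : Measure (Space d)).restrict (closedCube d)) :=
    Integrable.of_bound (by fun_prop : Continuous fun x => (starRingEnd ℂ) (series c x)).aestronglyMeasurable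
      (∑' n, ‖c n‖) (Eventually.of_forall fun x => by
        rw [RCLike.norm_conj]; exact norm_series_le hc x)
  have h := hasSum_integral_mul_series hc hw
  have e : ∀ n : Fin d → ℤ, c n * ∫ x in closedCube d,
      (starRingEnd ℂ) (series c x) * expFun (-intVec n) x
      = (((2 * Real.pi) ^ d * ‖c n‖ ^ 2 : ℝ) : ℂ) := by
    intro n
    have h1 := congrArg (starRingEnd ℂ) (integral_closedCube_series_mul hc n)
    rw [← integral_conj] at h1
    simp_rw [map_mul, conj_expFun, Complex.conj_ofReal] at h1
    simp_rw [mul_comm ((starRingEnd ℂ) (series c _))]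
    rw [h1, mul_left_comm, Complex.mul_conj, Complex.normSq_eq_norm_sq]
    push_cast; ring
  simp_rw [e] at h
  have e2 : ∫ x in closedCube d, (starRingEnd ℂ) (series c x) * series c x
      = ((∫ x in closedCube d, ‖series c x‖ ^ 2 : ℝ) : ℂ) := by
    rw [← integral_complex_ofReal]
    refine integral_congr_ae (Eventually.of_forall fun x => ?_)
    simp only
    rw [mul_comm, Complex.mul_conj, Complex.normSq_eq_norm_sq]
  rw [e2, Complex.hasSum_ofReal] at h
  have hint : Integrable (fun x => ‖series c x‖ ^ 2)
      ((volume : Measure (Space d)).restrict (closedCube d)) :=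
    Integrable.of_bound (by fun_prop : Continuous fun x => ‖series c x‖ ^ 2).aestronglyMeasurable
      ((∑' n, ‖c n‖) ^ 2) (Eventually.of_forall fun x => by
        rw [norm_pow, norm_norm]; gcongr; exact norm_series_le hc x)
  have h3 : ∫⁻ x in closedCube d, ‖series c x‖ₑ ^ 2
      = ENNReal.ofReal (∫ x in closedCube d, ‖series c x‖ ^ 2) := by
    rw [ofReal_integral_eq_lintegral_ofReal hint (Eventually.of_forall fun x => by positivity)]
    refine lintegral_congr fun x => ?_
    rw [ENNReal.ofReal_pow (norm_nonneg _), ofReal_norm]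
  rw [h3, ← h.tsum_eq, ENNReal.ofReal_tsum_of_nonneg (fun n => by positivity) h.summable,
    ← ENNReal.tsum_mul_left]
  refine tsum_congr fun n => ?_
  rw [ENNReal.ofReal_mul (by positivity), ENNReal.ofReal_pow (norm_nonneg _), ofReal_norm]

end Parseval

/-! ### Fourier inversion -/

section Inversion

variable {d : ℕ}

/-- Every smooth compactly supported test function is the transform of a Schwartz function `p`, and
moving the transform from `p` to `u` shows that `u` integrates to `0` against it. -/
lemma ae_eq_zero_of_ft_eq_zero {u : Space d → ℂ} (hu : Integrable u) (h : ∀ t, ft u t = 0) :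
    ∀ᵐ x, u x = 0 := by
  have hF : FourierTransform.fourier u = 0 := by
    ext w; rw [fourier_eq_ft, h]; rfl
  refine ae_eq_zero_of_integral_contDiff_smul_eq_zero hu.locallyIntegrable fun g hg hgc => ?_
  have hc : HasCompactSupport fun x => (g x : ℂ) := hgc.comp_left Complex.ofReal_zero
  have hd : ContDiff ℝ (⊤ : ℕ∞) fun x => (g x : ℂ) := Complex.ofRealCLM.contDiff.comp hg
  set f : SchwartzMap (Space d) ℂ := hc.toSchwartzMap hd with hf
  set p := FourierTransformInv.fourierInv f with hp
  have hpf : FourierTransform.fourier p = f := FourierTransform.fourier_fourierInv_eq f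
  have key := VectorFourier.integral_fourierIntegral_smul_eq_flip (L := innerₗ (Space d))
    (μ := (volume : Measure (Space d))) (ν := (volume : Measure (Space d))) (f := u) (g := ⇑p)
    Real.continuous_fourierChar (by exact continuous_inner) hu p.integrable
  have e1 : ∀ ξ, VectorFourier.fourierIntegral Real.fourierChar volume (innerₗ (Space d)) u ξ = 0 := by
    intro ξ
    have := congrFun hF ξ
    exact this
  have e2 : ∀ x, VectorFourier.fourierIntegral Real.fourierChar volume (innerₗ (Space d)).flip (⇑p) x
      = (g x : ℂ) := by
    intro x
    have h1 : FourierTransform.fourier (⇑p) x = f x := by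
      rw [← SchwartzMap.fourier_coe, hpf]
    rw [flip_innerₗ]
    exact h1
  simp_rw [e1, e2, zero_smul, integral_zero] at key
  rw [key]
  refine integral_congr_ae (Eventually.of_forall fun x => ?_)
  simp [mul_comm]

lemma continuous_ft {f : Space d → ℂ} (hf : Integrable f) : Continuous (ft f) := by
  refine continuous_of_dominated (fun t => (integrable_mul_expFun hf t).aestronglyMeasurable)
    (bound := fun x => ‖f x‖) (fun t => Eventually.of_forall fun x => ?_) hf.norm
    (Eventually.of_forall fun x => ?_)
  · rw [norm_mul, norm_expFun, mul_one]
  · exact continuous_const.mul (continuous_expFun.comp (by fun_prop : Continuous fun t => (t, x)))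

/-- The coefficients of the Fourier series of `f` on the cube. -/
def seriesCoef (f : Space d → ℂ) (n : Fin d → ℤ) : ℂ :=
  ((2 * Real.pi : ℝ) : ℂ)⁻¹ ^ d * ft f (intVec n)

variable {A : Set (Space d)} {η : ℝ → ℝ} {χ : Space d → ℝ}

lemma IsCutoff.continuous (h : IsCutoff A η χ) : Continuous χ := h.contDiff.continuous

lemma IsCutoff.integrable (h : IsCutoff A η χ) : Integrable fun x => (χ x : ℂ) :=
  (h.continuous.integrable_of_hasCompactSupport h.hasCompactSupport).ofReal

lemma IsCutoff.integrable_mul_series (h : IsCutoff A η χ) {c : (Fin d → ℤ) → ℂ}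
    (hc : Summable c) : Integrable fun x => (χ x : ℂ) * series c x :=
  h.integrable.mul_bdd (c := ∑' n, ‖c n‖) (continuous_series hc).aestronglyMeasurable
    (Eventually.of_forall fun x => norm_series_le hc x)

lemma summable_seriesCoef {f : Space d → ℂ} (hs : Summable fun n : Fin d → ℤ => ft f (intVec n)) :
    Summable (seriesCoef f) := hs.mul_left _

/-- Both sides are integrable and have the same Fourier transform: termwise integration of the
right-hand side gives precisely the sampling expansion of `ft f`. -/
lemma IsCutoff.ae_eq_mul_series (h : IsCutoff A η χ) (hAc : A ⊆ openCube d) {f : Space d → ℂ}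
    (hf : Integrable f) (hfA : Function.support f ⊆ A)
    (hs : Summable fun n : Fin d → ℤ => ft f (intVec n)) :
    ∀ᵐ x, f x = (χ x : ℂ) * series (seriesCoef f) x := by
  have hc := summable_seriesCoef hs
  have hi := h.integrable_mul_series hc
  have key := ae_eq_zero_of_ft_eq_zero (hf.sub hi) fun t => ?_
  · filter_upwards [key] with x hx
    exact sub_eq_zero.1 hx
  · have e1 : ft (f - fun x => (χ x : ℂ) * series (seriesCoef f) x) t
        = ft f t - ft (fun x => (χ x : ℂ) * series (seriesCoef f) x) t := by
      simp only [ft, Pi.sub_apply, sub_mul]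
      exact integral_sub (integrable_mul_expFun hf t) (integrable_mul_expFun hi t)
    rw [e1, sub_eq_zero]
    have h2 := hasSum_integral_mul_series hc (integrable_mul_expFun h.integrable t)
    have h3 := h.hasSum_ft hAc hf hfA t
    have e3 : ft (fun x => (χ x : ℂ) * series (seriesCoef f) x) t
        = ∫ x, (χ x : ℂ) * expFun t x * series (seriesCoef f) x := by
      refine integral_congr_ae (Eventually.of_forall fun x => ?_)
      simp only; ring
    rw [e3]
    refine h3.unique ?_
    convert h2 using 1
    ext n
    rw [seriesCoef, ft, mul_right_comm]
    congr 1
    refine integral_congr_ae (Eventually.of_forall fun x => ?_)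
    simp only
    rw [sub_eq_add_neg, expFun_add]; ring

lemma IsCutoff.pos (h : IsCutoff A η χ) {x : Space d} (hx : x ∈ openCube d) : 0 < χ x := by
  rw [h.eq_prod]
  exact Finset.prod_pos fun k _ => h.one_pos _ (hx k)

/-- On `A` the cutoff equals `1`. Elsewhere in the open cube `f = 0` while `χ > 0`, so the series
vanishes there too almost everywhere; the boundary of the cube is a null set. -/
lemma IsCutoff.ae_closedCube_eq_series (h : IsCutoff A η χ) (hAc : A ⊆ openCube d)
    {f : Space d → ℂ} (hf : Integrable f) (hfA : Function.support f ⊆ A)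
    (hs : Summable fun n : Fin d → ℤ => ft f (intVec n)) :
    ∀ᵐ x, x ∈ closedCube d → f x = series (seriesCoef f) x := by
  filter_upwards [h.ae_eq_mul_series hAc hf hfA hs, openCube_ae_eq_closedCube (d := d)]
    with x hx hcube hxc
  have hxo : x ∈ openCube d := by
    have e : (x ∈ openCube d) = (x ∈ closedCube d) := hcube
    rwa [e]
  by_cases hxA : x ∈ A
  · rw [hx, h.eq_one x hxA, Complex.ofReal_one, one_mul]
  · have h0 : f x = 0 := by by_contra h'; exact hxA (hfA h')
    rw [h0] at hx
    have h1 : (χ x : ℂ) ≠ 0 := by exact_mod_cast (h.pos hxo).ne'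
    rw [h0, (mul_eq_zero.1 hx.symm).resolve_left h1]

/-- The Fourier inversion formula for the continuous version of `f`. -/
lemma IsCutoff.mul_series_eq_integral (h : IsCutoff A η χ) (hAc : A ⊆ openCube d)
    {f : Space d → ℂ} (hf : Integrable f) (hfA : Function.support f ⊆ A)
    (hs : Summable fun n : Fin d → ℤ => ft f (intVec n)) (hi : Integrable (ft f)) (v : Space d) :
    (χ v : ℂ) * series (seriesCoef f) v
      = ((2 * Real.pi : ℝ) : ℂ)⁻¹ ^ d * ∫ t, ft f t * expFun (-t) v := by
  have h2 : (0 : ℝ) < 2 * Real.pi := by positivity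
  have hc := summable_seriesCoef hs
  have hae := h.ae_eq_mul_series hAc hf hfA hs
  obtain ⟨f₀, hf₀⟩ : ∃ f₀ : Space d → ℂ, f₀ = fun x => (χ x : ℂ) * series (seriesCoef f) x := ⟨_, rfl⟩
  have hcont : Continuous f₀ := by
    rw [hf₀]
    exact (Complex.continuous_ofReal.comp h.continuous).mul (continuous_series hc)
  have hint : Integrable f₀ := by rw [hf₀]; exact h.integrable_mul_series hc
  have hae' : f =ᵐ[volume] f₀ := by rw [hf₀]; exact hae
  have hft : ∀ t, ft f₀ t = ft f t := fun t => by
    refine integral_congr_ae ?_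
    filter_upwards [hae'] with x hx
    rw [hx]
  have hF : FourierTransform.fourier f₀ = fun w => ft f (-(2 * Real.pi) • w) := by
    ext w; rw [fourier_eq_ft, hft]
  have hFi : Integrable (FourierTransform.fourier f₀) := by
    rw [hF]
    exact hi.comp_smul (neg_ne_zero.2 h2.ne')
  have key := hint.fourierInv_fourier_eq hFi (v := v) hcont.continuousAt
  have e0 : (χ v : ℂ) * series (seriesCoef f) v = f₀ v := by rw [hf₀]
  rw [e0, ← key, Real.fourierInv_eq', hF]
  have e := Measure.integral_comp_smul (volume : Measure (Space d))
    (fun t => ft f t * expFun (-t) v) (-(2 * Real.pi))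
  rw [finrank_euclideanSpace_fin, abs_inv, abs_pow, abs_neg, abs_of_pos h2, Complex.real_smul] at e
  rw [inv_pow, ← Complex.ofReal_pow, ← Complex.ofReal_inv, ← e]
  refine integral_congr_ae (Eventually.of_forall fun w => ?_)
  simp only [smul_eq_mul]
  rw [mul_comm, expFun]
  congr 2
  rw [PiLp.inner_apply, mul_comm]
  congr 2
  rw [Finset.mul_sum]
  refine Finset.sum_congr rfl fun k _ => ?_
  simp; ring

end Inversion

/-! ### Taylor approximation -/

section Taylor

variable {d : ℕ}

/-- The bound must hold for all real `x`, since frequencies are unbounded. For `|x| ≤ 1` it is the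
usual remainder estimate; for `|x| > 1` the exponential and each retained power are bounded
separately, using `1 + e ≤ 4`. -/
lemma norm_exp_I_mul_sub_sum_le (x : ℝ) (n : ℕ) :
    ‖Complex.exp (Complex.I * x) - ∑ m ∈ Finset.range n, (Complex.I * x) ^ m / m.factorial‖
      ≤ 4 * |x| ^ n := by
  have hn : ‖Complex.I * (x : ℂ)‖ = |x| := by simp
  have he : Real.exp 1 ≤ 3 := by have := Real.exp_one_lt_d9; linarith
  rcases le_or_gt |x| 1 with h | h
  · refine (Complex.norm_exp_sub_sum_le_norm_mul_exp _ n).trans ?_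
    rw [hn, mul_comm]
    have : Real.exp |x| ≤ Real.exp 1 := Real.exp_le_exp.2 h
    gcongr
    linarith
  · have h1 : (1 : ℝ) ≤ |x| ^ n := one_le_pow₀ h.le
    have h2 : ‖Complex.exp (Complex.I * x)‖ = 1 := by
      rw [mul_comm, Complex.norm_exp_ofReal_mul_I]
    have h3 : ‖∑ m ∈ Finset.range n, (Complex.I * (x : ℂ)) ^ m / m.factorial‖ ≤ 3 * |x| ^ n := by
      refine (norm_sum_le _ _).trans ?_
      calc ∑ m ∈ Finset.range n, ‖(Complex.I * (x : ℂ)) ^ m / m.factorial‖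
          ≤ ∑ m ∈ Finset.range n, |x| ^ n * (1 ^ m / m.factorial) := by
            refine Finset.sum_le_sum fun m hm => ?_
            rw [norm_div, norm_pow, hn, one_pow, Complex.norm_natCast, ← mul_one_div]
            gcongr
            · exact h.le
            · exact (Finset.mem_range.1 hm).le
        _ = |x| ^ n * ∑ m ∈ Finset.range n, (1 : ℝ) ^ m / m.factorial := by rw [Finset.mul_sum]
        _ ≤ |x| ^ n * Real.exp 1 := by
            gcongr
            exact Real.sum_le_exp_of_nonneg zero_le_one n
        _ ≤ 3 * |x| ^ n := by rw [mul_comm]; gcongr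
    refine (norm_sub_le _ _).trans ?_
    rw [h2]; linarith

/-- The coefficient of `s ^ κ y ^ κ` in the Taylor polynomial of degree `< L` of
`exp (i ⟨s, y⟩)`. -/
def expTaylorCoef (L : ℕ) (κ : Fin d → ℕ) : ℂ :=
  if ∑ k, κ k < L then
    Complex.I ^ (∑ k, κ k) / (∑ k, κ k).factorial * Nat.multinomial Finset.univ κ else 0

/-- Multinomial theorem, with the multi-indices grouped by their total degree `m`. -/
lemma sum_exp_taylor_eq (L : ℕ) (s y : Fin d → ℝ) :
    ∑ m ∈ Finset.range L, (Complex.I * ((∑ k, s k * y k : ℝ) : ℂ)) ^ m / m.factorial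
      = ∑ κ : multiIndices d L, expTaylorCoef L κ.1 * (∏ k, (s k : ℂ) ^ κ.1 k) *
          ((∏ k, y k ^ κ.1 k : ℝ) : ℂ) := by
  rw [Finset.sum_coe_sort (multiIndices d L) (fun κ => expTaylorCoef L κ *
    (∏ k, (s k : ℂ) ^ κ k) * ((∏ k, y k ^ κ k : ℝ) : ℂ))]
  have e1 : ∑ κ ∈ multiIndices d L, expTaylorCoef L κ *
      (∏ k, (s k : ℂ) ^ κ k) * ((∏ k, y k ^ κ k : ℝ) : ℂ)
      = ∑ κ ∈ (multiIndices d L).filter (fun κ => ∑ k, κ k < L), expTaylorCoef L κ *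
      (∏ k, (s k : ℂ) ^ κ k) * ((∏ k, y k ^ κ k : ℝ) : ℂ) := by
    rw [Finset.sum_filter]
    refine Finset.sum_congr rfl fun κ _ => ?_
    split_ifs with h
    · rfl
    · simp [expTaylorCoef, h]
  rw [e1, ← Finset.sum_fiberwise_of_maps_to (t := Finset.range L)
    (g := fun κ : Fin d → ℕ => ∑ k, κ k) (fun κ hκ => Finset.mem_range.2 (Finset.mem_filter.1 hκ).2)]
  refine Finset.sum_congr rfl fun m hm => ?_
  have hm' := Finset.mem_range.1 hm
  have e2 : ((multiIndices d L).filter (fun κ => ∑ k, κ k < L)).filter (fun κ => ∑ k, κ k = m)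
      = Finset.piAntidiag Finset.univ m := by
    ext κ
    simp only [Finset.mem_filter, Finset.mem_piAntidiag, Finset.mem_univ, implies_true, and_true]
    constructor
    · exact fun h => h.2
    · intro h
      refine ⟨⟨mem_multiIndices ?_, ?_⟩, h⟩
      · exact h.le.trans hm'.le
      · exact h.trans_lt hm'
  rw [e2, mul_pow, Complex.ofReal_sum, Finset.sum_pow_eq_sum_piAntidiag, Finset.mul_sum,
    Finset.sum_div]
  refine Finset.sum_congr rfl fun κ hκ => ?_
  have hκm : ∑ k, κ k = m := (Finset.mem_piAntidiag.1 hκ).1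
  rw [expTaylorCoef, if_pos (hκm.trans_lt hm'), hκm]
  push_cast
  simp_rw [mul_pow]
  rw [Finset.prod_mul_distrib]
  ring

lemma norm_prod_pow_le (s : Space d) (κ : Fin d → ℕ) :
    ‖∏ k, ((s k : ℝ) : ℂ) ^ κ k‖ ≤ ‖s‖ ^ (∑ k, κ k) := by
  rw [norm_prod, ← Finset.prod_pow_eq_pow_sum]
  refine Finset.prod_le_prod (fun _ _ => norm_nonneg _) fun k _ => ?_
  rw [norm_pow, Complex.norm_real]
  gcongr
  exact PiLp.norm_apply_le s k

lemma abs_sum_mul_le (s y : Space d) : |∑ k, s k * y k| ≤ ‖s‖ * ‖y‖ := by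
  have h := abs_real_inner_le_norm y s
  rw [PiLp.inner_apply] at h
  rw [mul_comm ‖s‖]
  simpa using h

/-- Functions whose Fourier transform has an integrable moment of order `L` have Taylor
approximations of order `L`. -/
lemma hasTaylorBound_of_integrable {L : ℕ} (hL : 0 < L) {G : Space d → ℂ}
    (hGm : Measurable G) {B : ℝ} (hB : 0 ≤ B)
    (hG : ∫⁻ t, ENNReal.ofReal ((1 + ‖t‖) ^ L) * ‖G t‖ₑ ≤ ENNReal.ofReal B) (v : Space d) :
    HasTaylorBound L (4 * B * (1 + ‖v‖) ^ L) fun z => ∫ t, G t * expFun (v - t) z := by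
  have hint : Integrable fun t => (1 + ‖t‖) ^ L * ‖G t‖ := by
    refine ⟨by fun_prop, ?_⟩
    refine lt_of_le_of_lt (le_of_eq ?_) (hG.trans_lt ENNReal.ofReal_lt_top)
    refine lintegral_congr fun t => ?_
    rw [enorm_mul, Real.enorm_of_nonneg (by positivity), enorm_norm]
  have hintB : ∫ t, (1 + ‖t‖) ^ L * ‖G t‖ ≤ B := by
    rw [integral_eq_lintegral_of_nonneg_ae (Eventually.of_forall fun t => by positivity) (by fun_prop)]
    refine ENNReal.toReal_le_of_le_ofReal hB (le_trans (le_of_eq ?_) hG)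
    refine lintegral_congr fun t => ?_
    rw [ENNReal.ofReal_mul (by positivity), ofReal_norm]
  have hshift : ∀ t, ‖v - t‖ ≤ (1 + ‖v‖) * (1 + ‖t‖) := fun t => by
    have := norm_sub_le v t
    nlinarith [norm_nonneg v, norm_nonneg t, mul_nonneg (norm_nonneg v) (norm_nonneg t)]
  have hexpm : ∀ z, Measurable fun t => expFun (v - t) z := fun z =>
    (continuous_expFun.comp (by fun_prop : Continuous fun t => (v - t, z))).measurable
  have hi : ∀ (z : Space d) (κ : Fin d → ℕ), ∑ k, κ k ≤ L →
      Integrable fun t => G t * expFun (v - t) z * ∏ k, (((v - t) k : ℝ) : ℂ) ^ κ k := by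
    intro z κ hκ
    have hm : Measurable fun t => G t * expFun (v - t) z * ∏ k, (((v - t) k : ℝ) : ℂ) ^ κ k := by
      refine (hGm.mul (hexpm z)).mul (Continuous.measurable ?_)
      fun_prop
    refine (hint.const_mul ((1 + ‖v‖) ^ L)).mono' hm.aestronglyMeasurable
      (Eventually.of_forall fun t => ?_)
    rw [norm_mul, norm_mul, norm_expFun, mul_one]
    have h1 : ‖∏ k, (((v - t) k : ℝ) : ℂ) ^ κ k‖ ≤ (1 + ‖v‖) ^ L * (1 + ‖t‖) ^ L := by
      refine (norm_prod_pow_le _ _).trans ?_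
      rw [← mul_pow]
      calc ‖v - t‖ ^ (∑ k, κ k) ≤ ((1 + ‖v‖) * (1 + ‖t‖)) ^ (∑ k, κ k) := by
            gcongr; exact hshift t
        _ ≤ _ := by
            refine pow_le_pow_right₀ ?_ hκ
            nlinarith [norm_nonneg v, norm_nonneg t, mul_nonneg (norm_nonneg v) (norm_nonneg t)]
    calc ‖G t‖ * ‖∏ k, (((v - t) k : ℝ) : ℂ) ^ κ k‖
        ≤ ‖G t‖ * ((1 + ‖v‖) ^ L * (1 + ‖t‖) ^ L) := by gcongr
      _ = _ := by ring
  have hi0 : ∀ z, Integrable fun t => G t * expFun (v - t) z := fun z => by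
    have := hi z 0 (by simp)
    simpa using this
  intro z
  refine ⟨fun κ => expTaylorCoef L κ.1 *
    ∫ t, G t * expFun (v - t) z * ∏ k, (((v - t) k : ℝ) : ℂ) ^ κ.1 k, ?_, fun w => ?_⟩
  -- The Taylor polynomial retains degrees below `L`, so its constant term is present only because
  -- `0 < L`.
  · have : expTaylorCoef L (0 : Fin d → ℕ) = 1 := by
      simp [expTaylorCoef, hL, Nat.multinomial]
    simp [zeroIndex, this]
  · have e1 : ∀ κ : multiIndices d L, (expTaylorCoef L κ.1 *
        ∫ t, G t * expFun (v - t) z * ∏ k, (((v - t) k : ℝ) : ℂ) ^ κ.1 k) *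
          (monomials L z w κ : ℂ) = ∫ t, G t * expFun (v - t) z * (expTaylorCoef L κ.1 *
            (∏ k, (((v - t) k : ℝ) : ℂ) ^ κ.1 k) * (monomials L z w κ : ℂ)) := by
      intro κ
      rw [← integral_const_mul, ← integral_mul_const]
      refine integral_congr_ae (Eventually.of_forall fun t => ?_)
      simp only; ring
    have hκL : ∀ κ : multiIndices d L, ∑ k, κ.1 k ≤ L := fun κ => multiIndices_sum_le κ
    have hi2 : ∀ κ : multiIndices d L, Integrable fun t => G t * expFun (v - t) z *
        (expTaylorCoef L κ.1 * (∏ k, (((v - t) k : ℝ) : ℂ) ^ κ.1 k) *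
          (monomials L z w κ : ℂ)) := by
      intro κ
      refine ((hi z κ.1 (hκL κ)).const_mul (expTaylorCoef L κ.1 *
        (monomials L z w κ : ℂ))).congr (Eventually.of_forall fun t => ?_)
      simp only; ring
    have hsumint := integrable_finsetSum Finset.univ fun κ _ => hi2 κ
    simp_rw [e1]
    rw [← integral_finsetSum _ fun κ _ => hi2 κ, ← integral_sub (hi0 w) hsumint]
    have hpt : ∀ t, ‖G t * expFun (v - t) w - ∑ κ : multiIndices d L, G t * expFun (v - t) z *
        (expTaylorCoef L κ.1 * (∏ k, (((v - t) k : ℝ) : ℂ) ^ κ.1 k) *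
          (monomials L z w κ : ℂ))‖ ≤ 4 * (1 + ‖v‖) ^ L * ‖w - z‖ ^ L *
            ((1 + ‖t‖) ^ L * ‖G t‖) := by
      intro t
      have e2 : expFun (v - t) w = expFun (v - t) z *
          Complex.exp (Complex.I * ((∑ k, (v - t) k * (w - z) k : ℝ) : ℂ)) := by
        have : w = z + (w - z) := by abel
        conv_lhs => rw [this, expFun_add_right]
        rfl
      have e3 := sum_exp_taylor_eq L (v - t).ofLp (w - z).ofLp
      have e4 : ∑ κ : multiIndices d L, G t * expFun (v - t) z *
        (expTaylorCoef L κ.1 * (∏ k, (((v - t) k : ℝ) : ℂ) ^ κ.1 k) *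
          (monomials L z w κ : ℂ)) = G t * expFun (v - t) z * ∑ m ∈ Finset.range L,
            (Complex.I * ((∑ k, (v - t) k * (w - z) k : ℝ) : ℂ)) ^ m / m.factorial := by
        rw [e3, Finset.mul_sum]
        rfl
      rw [e4, e2, ← mul_assoc, ← mul_sub, norm_mul, norm_mul, norm_expFun, mul_one]
      have h5 := norm_exp_I_mul_sub_sum_le (∑ k, (v - t) k * (w - z) k) L
      calc _ ≤ ‖G t‖ * (4 * |∑ k, (v - t) k * (w - z) k| ^ L) := by gcongr
        _ ≤ ‖G t‖ * (4 * ((1 + ‖v‖) * (1 + ‖t‖) * ‖w - z‖) ^ L) := by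
            gcongr
            refine (abs_sum_mul_le _ _).trans ?_
            gcongr
            exact hshift t
        _ = _ := by rw [mul_pow, mul_pow]; ring
    refine (norm_integral_le_of_norm_le (hint.const_mul _) (Eventually.of_forall hpt)).trans ?_
    rw [integral_const_mul]
    calc 4 * (1 + ‖v‖) ^ L * ‖w - z‖ ^ L * ∫ t, (1 + ‖t‖) ^ L * ‖G t‖
        ≤ 4 * (1 + ‖v‖) ^ L * ‖w - z‖ ^ L * B := by gcongr
      _ = _ := by ring

end Taylor

/-! ### The calibrated regression function -/

section Calibrated

variable {d : ℕ}

lemma ft_def (f : Space d → ℂ) (t : Space d) : ft f t = ∫ x, f x * expFun t x := rfl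

/-- In this form the convolution is visibly the conditional mean of the response at the design point
`z`. -/
lemma calibrated_eq (h f : Space d → ℝ) (z : Space d) :
    calibrated h f z = ∫ x, h (z + x) * f x := by
  rw [calibrated, convolution, ← integral_add_left_eq_self _ z]
  refine integral_congr_ae (Eventually.of_forall fun x => ?_)
  simp

/-- The convolution theorem, based on `φ_j(z) = φ_j(t) φ_j(z - t)`; the reflection of `f` turns the
second frequency into `-j`. -/
lemma integral_calibrated_mul_basisFun {h f : Space d → ℝ} (hh : Integrable h)
    (hf : Integrable f) (j : Fin d → ℤ) :
    ∫ z, (calibrated h f z : ℂ) * basisFun j z = fourierCoef h j * fourierCoef f (-j) := by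
  have i1 : Integrable fun x => (h x : ℂ) * basisFun j x :=
    integrable_mul_expFun hh.ofReal (intVec j)
  have i2 : Integrable fun x => ((f (-x) : ℝ) : ℂ) * basisFun j x :=
    integrable_mul_expFun hf.comp_neg.ofReal (intVec j)
  have key := integral_convolution (L := ContinuousLinearMap.mul ℂ ℂ) (μ := volume) (ν := volume) i1 i2
  have e1 : ∫ x, ((f (-x) : ℝ) : ℂ) * basisFun j x = fourierCoef f (-j) := by
    rw [fourierCoef, ← integral_neg_eq_self]
    refine integral_congr_ae (Eventually.of_forall fun x => ?_)
    simp [basisFun]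
  rw [ContinuousLinearMap.mul_apply', e1] at key
  rw [fourierCoef, ← key]
  refine integral_congr_ae (Eventually.of_forall fun z => ?_)
  simp only [convolution, ContinuousLinearMap.mul_apply', calibrated]
  rw [← integral_complex_ofReal, ← integral_mul_const]
  refine integral_congr_ae (Eventually.of_forall fun t => ?_)
  simp only
  have : basisFun j z = basisFun j t * basisFun j (z - t) := by
    rw [basisFun_eq_expFun, basisFun_eq_expFun, basisFun_eq_expFun, ← expFun_add_right,
      add_sub_cancel]
  rw [this]; push_cast; ring

variable {A : Set (Space d)} {η : ℝ → ℝ} {χ : Space d → ℝ}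

/-- The Fourier representation of the calibrated regression function. -/
lemma IsCutoff.calibrated_eq_ft (hχ : IsCutoff A η χ) (hAc : A ⊆ openCube d) {h f : Space d → ℝ}
    (hh : Integrable h) (hhA : Function.support h ⊆ A)
    (hs : Summable fun n : Fin d → ℤ => fourierCoef h n)
    (hi : Integrable (ft fun x => (h x : ℂ))) (hf : Integrable f) (z : Space d) :
    (calibrated h f z : ℂ) = ft (fun t => ((2 * Real.pi : ℝ) : ℂ)⁻¹ ^ d *
      (ft (fun x => (h x : ℂ)) t * ft (fun x => (f x : ℂ)) (-t))) (-z) := by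
  have hhc : Integrable fun x => (h x : ℂ) := hh.ofReal
  have hhA' : Function.support (fun x => (h x : ℂ)) ⊆ A := fun x hx => hhA (by
    intro h0; exact hx (by simp [h0]))
  have hae := hχ.ae_eq_mul_series hAc hhc hhA' hs
  have hinv := hχ.mul_series_eq_integral hAc hhc hhA' hs hi
  have e1 : (calibrated h f z : ℂ) = ∫ x, (∫ t, ((2 * Real.pi : ℝ) : ℂ)⁻¹ ^ d *
      (ft (fun x => (h x : ℂ)) t * expFun (-t) (z + x) * (f x : ℂ))) := by
    rw [calibrated_eq, ← integral_complex_ofReal]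
    refine integral_congr_ae ?_
    have := (measurePreserving_add_left (volume : Measure (Space d)) z).quasiMeasurePreserving.ae hae
    filter_upwards [this] with x hx
    rw [integral_const_mul, integral_mul_const, ← mul_assoc, ← hinv, ← hx]
    push_cast; rfl
  rw [e1, integral_integral_swap, ft]
  · refine integral_congr_ae (Eventually.of_forall fun t => ?_)
    simp only
    rw [integral_const_mul, mul_assoc]
    congr 1
    rw [mul_assoc, ft_def (fun x => (f x : ℂ)), ← integral_mul_const, ← integral_const_mul]
    refine integral_congr_ae (Eventually.of_forall fun x => ?_)
    simp only
    rw [expFun_add_right]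
    have : expFun (-t) z = expFun (-z) t := by simp [expFun, mul_comm]
    rw [this]; ring
  · have i0 : Integrable (fun p : Space d × Space d =>
        (f p.1 : ℂ) * ft (fun x => (h x : ℂ)) p.2) (volume.prod volume) :=
      Integrable.mul_prod (f := fun x => (f x : ℂ)) hf.ofReal hi
    refine ((i0.mul_bdd (c := 1) (g := fun p => expFun (-p.2) (z + p.1)) ?_ ?_).const_mul
      (((2 * Real.pi : ℝ) : ℂ)⁻¹ ^ d)).congr (Eventually.of_forall fun p => ?_)
    · exact (continuous_expFun.comp (by fun_prop :
        Continuous fun p : Space d × Space d => (-p.2, z + p.1))).aestronglyMeasurable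
    · exact Eventually.of_forall fun p => (norm_expFun _ _).le
    · simp only [Function.uncurry]; ring

end Calibrated

/-! ### The Sobolev class -/

section Class

variable {d : ℕ} {A Sstar : Set (Space d)} {fδ : Space d → ℝ} {α R : ℝ}

/-- The squared Sobolev norm of the Fourier coefficients. -/
def energy (α : ℝ) (h : Space d → ℝ) : ENNReal :=
  ∑' n : Fin d → ℤ, ENNReal.ofReal ((1 + ‖intVec n‖) ^ (2 * α)) * ‖fourierCoef h n‖ₑ ^ 2

lemma one_add_rpow_le {x s : ℝ} (hx : 0 ≤ x) (hs : 0 ≤ s) :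
    (1 + x) ^ s ≤ 2 ^ s * (1 + x ^ s) := by
  have h0 : 0 ≤ x ^ s := by positivity
  have h2 : (0 : ℝ) ≤ 2 ^ s := by positivity
  rcases le_total x 1 with h | h
  · calc (1 + x) ^ s ≤ 2 ^ s := Real.rpow_le_rpow (by linarith) (by linarith) hs
      _ ≤ _ := by nlinarith
  · calc (1 + x) ^ s ≤ (2 * x) ^ s := Real.rpow_le_rpow (by linarith) (by linarith) hs
      _ = 2 ^ s * x ^ s := Real.mul_rpow (by norm_num) hx
      _ ≤ _ := by nlinarith

/-- The weight `1 + ‖j‖^{2α}` is exchanged for `(1 + ‖j‖)^{2α}`, to which Peetre's inequality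
applies. -/
lemma SobolevClass.energy_le {h : Space d → ℝ} (hh : SobolevClass fδ A Sstar α R h) (hα : 0 ≤ α) :
    energy α h ≤ ENNReal.ofReal (2 ^ (2 * α) * R) := by
  have h1 : ∀ n : Fin d → ℤ, ENNReal.ofReal ((1 + ‖intVec n‖) ^ (2 * α)) * ‖fourierCoef h n‖ₑ ^ 2
      ≤ ENNReal.ofReal (2 ^ (2 * α)) *
        ENNReal.ofReal (‖fourierCoef h n‖ ^ 2 * (1 + ‖intVec n‖ ^ (2 * α))) := by
    intro n
    rw [← ENNReal.ofReal_mul (by positivity), ← ofReal_norm, ← ENNReal.ofReal_pow (norm_nonneg _),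
      ← ENNReal.ofReal_mul (by positivity)]
    refine ENNReal.ofReal_le_ofReal ?_
    have := one_add_rpow_le (norm_nonneg (intVec n)) (by positivity : 0 ≤ 2 * α)
    calc _ ≤ (2 ^ (2 * α) * (1 + ‖intVec n‖ ^ (2 * α))) * ‖fourierCoef h n‖ ^ 2 := by gcongr
      _ = _ := by ring
  refine (ENNReal.tsum_le_tsum h1).trans ?_
  rw [ENNReal.tsum_mul_left, ← ENNReal.ofReal_tsum_of_nonneg (fun n => by positivity) hh.summable,
    ← ENNReal.ofReal_mul (by positivity)]
  gcongr
  exact hh.sum_le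

/-- Cauchy–Schwarz with the weights `(1 + ‖n‖)^{±α}`; the negative one is square summable over the
lattice since `2α > d`. -/
lemma exists_tsum_fourierCoef_le (hα : (d : ℝ) < 2 * α) :
    ∃ W : ENNReal, W ≠ ⊤ ∧ ∀ h : Space d → ℝ,
      (∑' n : Fin d → ℤ, ‖fourierCoef h n‖ₑ) ^ 2 ≤ W * energy α h := by
  obtain ⟨W, hW, hWb⟩ := exists_tsum_one_add_norm_sub_le (d := d) hα
  refine ⟨W, hW, fun h => ?_⟩
  have h1 := sq_tsum_mul_le (fun n : Fin d → ℤ => ENNReal.ofReal ((1 + ‖intVec n‖) ^ (-α)))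
    (fun n => ENNReal.ofReal ((1 + ‖intVec n‖) ^ α) * ‖fourierCoef h n‖ₑ)
  have e1 : ∀ n : Fin d → ℤ, ENNReal.ofReal ((1 + ‖intVec n‖) ^ (-α)) *
      (ENNReal.ofReal ((1 + ‖intVec n‖) ^ α) * ‖fourierCoef h n‖ₑ) = ‖fourierCoef h n‖ₑ := by
    intro n
    rw [← mul_assoc, ← ENNReal.ofReal_mul (by positivity), ← Real.rpow_add (by positivity)]
    simp
  have e2 : ∀ (s : ℝ) (n : Fin d → ℤ), ENNReal.ofReal ((1 + ‖intVec n‖) ^ s) ^ 2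
      = ENNReal.ofReal ((1 + ‖intVec n‖) ^ (2 * s)) := by
    intro s n
    rw [← ENNReal.ofReal_pow (by positivity), ← Real.rpow_natCast, ← Real.rpow_mul (by positivity)]
    congr 2; push_cast; ring
  simp_rw [e1, mul_pow, e2] at h1
  refine h1.trans ?_
  rw [energy]
  gcongr
  refine le_trans (le_of_eq ?_) (hWb 0)
  refine tsum_congr fun n => ?_
  rw [zero_sub, norm_neg]; congr 2; ring

lemma lintegral_ofReal_rpow_mul_sq_le (s : ℝ) {F : Space d → ENNReal} (hF : Measurable F) :
    (∫⁻ t, ENNReal.ofReal ((1 + ‖t‖) ^ (-s)) * F t) ^ 2 ≤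
      (∫⁻ t : Space d, ENNReal.ofReal ((1 + ‖t‖) ^ (-(2 * s)))) * ∫⁻ t, F t ^ 2 := by
  refine (sq_lintegral_mul_le volume (by fun_prop) hF.aemeasurable).trans (le_of_eq ?_)
  congr 1
  refine lintegral_congr fun t => ?_
  rw [← ENNReal.ofReal_pow (by positivity), ← Real.rpow_natCast, ← Real.rpow_mul (by positivity)]
  congr 2; push_cast; ring

lemma le_ofReal_sqrt_of_sq_le {a c : ENNReal} (hc : c ≠ ⊤) (h : a ^ 2 ≤ c) :
    a ≤ ENNReal.ofReal (Real.sqrt c.toReal) := by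
  have h1 : ENNReal.ofReal (Real.sqrt c.toReal) ^ 2 = c := by
    rw [← ENNReal.ofReal_pow (Real.sqrt_nonneg _), Real.sq_sqrt ENNReal.toReal_nonneg,
      ENNReal.ofReal_toReal hc]
  exact (ENNReal.pow_le_pow_left_iff two_ne_zero).1 (h.trans h1.ge)

end Class

/-! ### Bounds for regression functions -/

section Regression

variable {d : ℕ} {A Sstar : Set (Space d)} {fδ : Space d → ℝ} {α R γ : ℝ}

/-- If `fδ` were not integrable, its coefficient at frequency `0` would be `0` by the convention for
the integral, against the positive lower bound. -/
lemma OrdinarySmoothDensity.integrable (hδ : OrdinarySmoothDensity fδ A γ) : Integrable fδ := by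
  obtain ⟨c, C, hc, hb⟩ := hδ.smooth
  by_contra h
  have h1 : fourierCoef fδ 0 = 0 := by
    refine integral_undef fun hi => h ?_
    have : Integrable fun x => (fδ x : ℂ) := by
      refine hi.congr (Eventually.of_forall fun x => ?_)
      simp [basisFun]
    simpa using this.re
  have h2 := (hb 0).1
  rw [h1, norm_zero] at h2
  have : 0 < c * (1 + ‖intVec (0 : Fin d → ℤ)‖) ^ (-γ) := by positivity
  linarith

lemma OrdinarySmoothDensity.exists_norm_ft_le (hδ : OrdinarySmoothDensity fδ A γ)
    (hA : IsCompact A) (hAc : A ⊆ openCube d) (hγ : 0 ≤ γ) :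
    ∃ C : ℝ, 0 < C ∧ ∀ t : Space d, ‖ft (fun x => (fδ x : ℂ)) t‖ ≤ C * (1 + ‖t‖) ^ (-γ) := by
  obtain ⟨η, χ, hχ⟩ := exists_isCutoff hA hAc
  obtain ⟨c, C, hc, hb⟩ := hδ.smooth
  refine hχ.exists_norm_ft_le_of_coef hAc hδ.integrable.ofReal (fun x hx => hδ.support_subset ?_) hγ
    fun n => (hb n).2
  intro h0; exact hx (by simp [h0])

/-- The properties of the regression functions in the Sobolev class that the risk bound uses. -/
structure RegressionBounds (fδ : Space d → ℝ) (Sstar : Set (Space d)) (L : ℕ) (M B : ℝ)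
    (h : Space d → ℝ) : Prop where
  ae_abs_le : ∀ᵐ x, |h x| ≤ M
  summable : Summable fun n : Fin d → ℤ => fourierCoef h n
  ae_eq_series : ∀ᵐ x, x ∈ closedCube d → (h x : ℂ) = series (seriesCoef fun x => (h x : ℂ)) x
  taylor : ∀ j : Fin d → ℤ, HasTaylorBound L (B * (1 + ‖intVec j‖) ^ L)
    fun z => (calibrated h fδ z : ℂ) * basisFun j z
  continuous : Continuous fun z => (calibrated h fδ z : ℂ)
  setIntegral_eq : ∀ j : Fin d → ℤ, ∫ z in Sstar, (calibrated h fδ z : ℂ) * basisFun j z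
    = fourierCoef h j * fourierCoef fδ (-j)

/-- Summable coefficients bound `h` and give its pointwise series. The calibrated function is the
inverse transform of `ft h (t) · ft fδ (-t)`. As `L ≤ α`, the moment of order `L` of this product is
the pairing of `(1 + ‖t‖)^α |ft h|`, in `L²` by the Sobolev bound, with `(1 + ‖t‖)^{-γ}`, in `L²`
because `2γ > d`. Multiplication by `φ_j` shifts frequencies by `j`, which costs the factor `(1 +
‖j‖)^L`. -/
theorem exists_regressionBounds (hA : IsCompact A) (hAc : A ⊆ openCube d)
    (hδ : OrdinarySmoothDensity fδ A γ) (hγ : (d : ℝ) < 2 * γ) (hα : (d : ℝ) < 2 * α) {L : ℕ}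
    (hL : 0 < L) (hLα : (L : ℝ) ≤ α) :
    ∃ M B : ℝ, 0 < M ∧ 0 < B ∧ ∀ h : Space d → ℝ, SobolevClass fδ A Sstar α R h →
      RegressionBounds fδ Sstar L M B h := by
  have hα0 : 0 ≤ α := (Nat.cast_nonneg L).trans hLα
  have hγ0 : 0 ≤ γ := by have : (0 : ℝ) ≤ d := Nat.cast_nonneg d; linarith
  obtain ⟨η, χ, hχ⟩ := exists_isCutoff hA hAc
  obtain ⟨Cδ, hCδ, hδb⟩ := hδ.exists_norm_ft_le hA hAc hγ0
  obtain ⟨W, hW, hWb⟩ := exists_tsum_fourierCoef_le (d := d) hα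
  obtain ⟨C₂, hC₂, hb₂⟩ := hχ.exists_lintegral_ft_sq_le hAc (s := 2 * α) (by linarith)
  have hfi := hδ.integrable
  set E := ENNReal.ofReal (2 ^ (2 * α) * R) with hE
  obtain ⟨Iα, hIα⟩ : ∃ I : ENNReal, I = ∫⁻ t : Space d, ENNReal.ofReal ((1 + ‖t‖) ^ (-(2 * α))) :=
    ⟨_, rfl⟩
  obtain ⟨Iγ, hIγ⟩ : ∃ I : ENNReal, I = ∫⁻ t : Space d, ENNReal.ofReal ((1 + ‖t‖) ^ (-(2 * γ))) :=
    ⟨_, rfl⟩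
  have hIα' : Iα ≠ ⊤ := by
    rw [hIα]; exact (finite_integral_one_add_norm (by simpa using hα)).ne
  have hIγ' : Iγ ≠ ⊤ := by
    rw [hIγ]; exact (finite_integral_one_add_norm (by simpa using hγ)).ne
  refine ⟨Real.sqrt (W * E).toReal + 1,
    4 * (Cδ * Real.sqrt (Iγ * (C₂ * E)).toReal) + 1, by positivity, by positivity, fun h hh => ?_⟩
  have hen := hh.energy_le hα0
  have hhc : Integrable fun x => (h x : ℂ) := hh.integrable.ofReal
  have hhA' : Function.support (fun x => (h x : ℂ)) ⊆ A := fun x hx => hh.support_subset (by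
    intro h0; exact hx (by simp [h0]))
  have hsumE : ∑' n : Fin d → ℤ, ‖fourierCoef h n‖ₑ ≤ ENNReal.ofReal (Real.sqrt (W * E).toReal) :=
    le_ofReal_sqrt_of_sq_le (by finiteness) ((hWb h).trans (by gcongr))
  have hs : Summable fun n : Fin d → ℤ => fourierCoef h n := by
    refine Summable.of_norm ?_
    have := ENNReal.summable_toReal (ne_top_of_le_ne_top ENNReal.ofReal_ne_top hsumE)
    simpa using this
  have hsum : ∑' n : Fin d → ℤ, ‖fourierCoef h n‖ ≤ Real.sqrt (W * E).toReal := by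
    have h1 := ENNReal.toReal_mono ENNReal.ofReal_ne_top hsumE
    rw [ENNReal.toReal_ofReal (Real.sqrt_nonneg _), ENNReal.tsum_toReal_eq (by simp)] at h1
    simpa using h1
  have hsq : ∫⁻ t, (ENNReal.ofReal ((1 + ‖t‖) ^ α) * ‖ft (fun x => (h x : ℂ)) t‖ₑ) ^ 2 ≤ C₂ * E := by
    refine le_trans (le_of_eq ?_) ((hb₂ _ hhc hhA').trans (mul_le_mul_right hen _))
    refine lintegral_congr fun t => ?_
    rw [mul_pow, ← ENNReal.ofReal_pow (by positivity), ← Real.rpow_natCast,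
      ← Real.rpow_mul (by positivity)]
    congr 3; push_cast; ring
  have hftm : Measurable fun t => ‖ft (fun x => (h x : ℂ)) t‖ₑ :=
    (continuous_ft hhc).measurable.enorm
  have hFm : Measurable fun t : Space d =>
      ENNReal.ofReal ((1 + ‖t‖) ^ α) * ‖ft (fun x => (h x : ℂ)) t‖ₑ := by fun_prop
  have hi : Integrable (ft fun x => (h x : ℂ)) := by
    refine ⟨(continuous_ft hhc).aestronglyMeasurable, ?_⟩
    have h1 := (lintegral_ofReal_rpow_mul_sq_le α hFm).trans (mul_le_mul_right hsq _)
    rw [← hIα] at h1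
    have h2 := le_ofReal_sqrt_of_sq_le (by finiteness) h1
    refine lt_of_le_of_lt (le_trans (le_of_eq ?_) h2) ENNReal.ofReal_lt_top
    refine lintegral_congr fun t => ?_
    rw [← mul_assoc, ← ENNReal.ofReal_mul (by positivity), ← Real.rpow_add (by positivity)]
    simp
  have hrep := hχ.calibrated_eq_ft hAc hh.integrable hh.support_subset hs hi hfi
  obtain ⟨G, hG⟩ : ∃ G : Space d → ℂ, G = fun t => ((2 * Real.pi : ℝ) : ℂ)⁻¹ ^ d *
      (ft (fun x => (h x : ℂ)) t * ft (fun x => (fδ x : ℂ)) (-t)) := ⟨_, rfl⟩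
  rw [← hG] at hrep
  have hGc : Continuous G := by
    rw [hG]
    exact continuous_const.mul ((continuous_ft hhc).mul
      ((continuous_ft hfi.ofReal).comp continuous_neg))
  have hGle : ∀ t, ENNReal.ofReal ((1 + ‖t‖) ^ L) * ‖G t‖ₑ ≤ ENNReal.ofReal Cδ *
      (ENNReal.ofReal ((1 + ‖t‖) ^ (-γ)) *
        (ENNReal.ofReal ((1 + ‖t‖) ^ α) * ‖ft (fun x => (h x : ℂ)) t‖ₑ)) := by
    intro t
    have h1 : ‖G t‖ₑ ≤ ‖ft (fun x => (h x : ℂ)) t‖ₑ *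
        ENNReal.ofReal (Cδ * (1 + ‖t‖) ^ (-γ)) := by
      rw [hG, enorm_mul, enorm_mul]
      calc _ ≤ 1 * (‖ft (fun x => (h x : ℂ)) t‖ₑ * ‖ft (fun x => (fδ x : ℂ)) (-t)‖ₑ) := by
            gcongr
            rw [enorm_pow]
            refine pow_le_one' ?_ d
            refine (enorm_le_ofReal_of_norm_le (c := 1) ?_).trans (by simp)
            rw [norm_inv, Complex.norm_real, Real.norm_of_nonneg (by positivity)]
            exact inv_le_one_of_one_le₀ (by linarith [Real.pi_gt_three])
        _ ≤ _ := by
            rw [one_mul]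
            gcongr
            refine enorm_le_ofReal_of_norm_le ?_
            have := hδb (-t)
            rwa [norm_neg] at this
    have h2 : (1 + ‖t‖) ^ L ≤ (1 + ‖t‖) ^ α := by
      rw [← Real.rpow_natCast]
      exact Real.rpow_le_rpow_of_exponent_le (by linarith [norm_nonneg t]) hLα
    calc _ ≤ ENNReal.ofReal ((1 + ‖t‖) ^ α) * (‖ft (fun x => (h x : ℂ)) t‖ₑ *
        ENNReal.ofReal (Cδ * (1 + ‖t‖) ^ (-γ))) := by gcongr
      _ = _ := by rw [ENNReal.ofReal_mul hCδ.le]; ring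
  have hGint : ∫⁻ t, ENNReal.ofReal ((1 + ‖t‖) ^ L) * ‖G t‖ₑ ≤
      ENNReal.ofReal (Cδ * Real.sqrt (Iγ * (C₂ * E)).toReal) := by
    refine (lintegral_mono hGle).trans ?_
    rw [lintegral_const_mul _ (by fun_prop), ENNReal.ofReal_mul hCδ.le]
    gcongr
    have h1 := (lintegral_ofReal_rpow_mul_sq_le γ hFm).trans (mul_le_mul_right hsq _)
    rw [← hIγ] at h1
    exact le_ofReal_sqrt_of_sq_le (by finiteness) h1
  have hGi : Integrable G := by
    refine ⟨hGc.aestronglyMeasurable, lt_of_le_of_lt (le_trans (lintegral_mono fun t => ?_) hGint)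
      ENNReal.ofReal_lt_top⟩
    refine le_mul_of_one_le_left' ?_
    rw [ENNReal.one_le_ofReal]
    exact one_le_pow₀ (by linarith [norm_nonneg t])
  have hc : Continuous fun z => (calibrated h fδ z : ℂ) := by
    simp_rw [hrep]
    exact (continuous_ft hGi).comp continuous_neg
  have haes := hχ.ae_closedCube_eq_series hAc hhc hhA' hs
  refine ⟨?_, hs, haes, fun j => ?_, hc, fun j => ?_⟩
  · filter_upwards [haes] with x hx
    by_cases hxA : x ∈ A
    · have h1 := hx fun k => ⟨(hAc hxA k).1.le, (hAc hxA k).2.le⟩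
      have h2 := norm_series_le (summable_seriesCoef (f := fun x => (h x : ℂ)) hs) x
      rw [← h1, Complex.norm_real, Real.norm_eq_abs] at h2
      have h3 : ∑' n, ‖seriesCoef (fun x => (h x : ℂ)) n‖ ≤ ∑' n : Fin d → ℤ, ‖fourierCoef h n‖ := by
        refine Summable.tsum_le_tsum (fun n => ?_)
          (summable_seriesCoef (f := fun x => (h x : ℂ)) hs).norm hs.norm
        rw [seriesCoef, norm_mul]
        refine mul_le_of_le_one_left (norm_nonneg _) ?_
        rw [norm_pow]
        refine pow_le_one₀ (norm_nonneg _) ?_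
        rw [norm_inv, Complex.norm_real, Real.norm_of_nonneg (by positivity)]
        exact inv_le_one_of_one_le₀ (by linarith [Real.pi_gt_three])
      linarith
    · have h0 : h x = 0 := by by_contra h'; exact hxA (hh.support_subset h')
      rw [h0, abs_zero]; positivity
  · have h1 := hasTaylorBound_of_integrable hL hGc.measurable (by positivity) hGint (intVec j)
    have e : (fun z => (calibrated h fδ z : ℂ) * basisFun j z)
        = fun z => ∫ t, G t * expFun (intVec j - t) z := by
      ext z
      rw [hrep, ft, ← integral_mul_const]
      refine integral_congr_ae (Eventually.of_forall fun t => ?_)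
      simp only
      rw [sub_eq_add_neg, expFun_add, basisFun_eq_expFun]
      have : expFun (-t) z = expFun (-z) t := by simp [expFun, mul_comm]
      rw [this]; ring
    rw [e]
    intro z
    obtain ⟨c, hc0, hcb⟩ := h1 z
    refine ⟨c, hc0, fun w => (hcb w).trans ?_⟩
    gcongr
    linarith
  · rw [setIntegral_eq_integral_of_forall_compl_eq_zero,
      integral_calibrated_mul_basisFun hh.integrable hfi]
    intro z hz
    have : calibrated h fδ z = 0 := by
      by_contra h'
      exact hz (hh.support_conv h')
    simp [this]

end Regression

/-! ### Variance of linear statistics -/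

section Variance

lemma integral_comp_measurePreserving {X Y : Type*} [MeasurableSpace X] [MeasurableSpace Y]
    {μ : Measure X} {ν : Measure Y} {f : X → Y} (hf : MeasurePreserving f μ ν) {g : Y → ℝ}
    (hg : AEStronglyMeasurable g ν) : ∫ x, g (f x) ∂μ = ∫ y, g y ∂ν := by
  rw [← hf.map_eq] at hg ⊢
  rw [integral_map hf.aemeasurable hg]

lemma enorm_add_sq_le {E : Type*} [SeminormedAddCommGroup E] (x y : E) :
    ‖x + y‖ₑ ^ 2 ≤ 2 * ‖x‖ₑ ^ 2 + 2 * ‖y‖ₑ ^ 2 := by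
  simp only [← ofReal_norm]
  rw [← ENNReal.ofReal_pow (norm_nonneg _), ← ENNReal.ofReal_pow (norm_nonneg _),
    ← ENNReal.ofReal_pow (norm_nonneg _), ← ENNReal.ofReal_ofNat, ← ENNReal.ofReal_mul (by norm_num),
    ← ENNReal.ofReal_mul (by norm_num), ← ENNReal.ofReal_add (by positivity) (by positivity)]
  refine ENNReal.ofReal_le_ofReal ?_
  have := norm_add_le x y
  nlinarith [sq_nonneg (‖x‖ - ‖y‖), norm_nonneg (x + y), norm_nonneg x, norm_nonneg y]

variable {n : ℕ} {E : Type*} [MeasurableSpace E] (ν : Measure E) [IsProbabilityMeasure ν]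

lemma lintegral_pi_sum_sq_eq {Y : Fin n → E → ℝ} (hY : ∀ i, MemLp (Y i) 2 ν) (b : Fin n → ℝ) :
    ∫⁻ ξ : Fin n → E, ‖∑ i, b i * (Y i (ξ i) - ∫ x, Y i x ∂ν)‖ₑ ^ 2 ∂(Measure.pi fun _ => ν)
      = ENNReal.ofReal (∑ i, b i ^ 2 * Var[Y i; ν]) := by
  have hX : ∀ i, MemLp (fun x => b i * Y i x) 2 ν := fun i => (hY i).const_mul (b i)
  have hv := variance_sum_pi (μ := fun _ : Fin n => ν) (X := fun i x => b i * Y i x) hX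
  simp_rw [variance_const_mul] at hv
  have hX' : ∀ i : Fin n, MemLp (fun ξ : Fin n → E => b i * Y i (ξ i)) 2 (Measure.pi fun _ => ν) :=
    fun i => (hX i).comp_measurePreserving (measurePreserving_eval (fun _ : Fin n => ν) i)
  have hS : MemLp (∑ i, fun ξ : Fin n → E => b i * Y i (ξ i)) 2 (Measure.pi fun _ => ν) :=
    memLp_finsetSum' _ fun i _ => hX' i
  rw [← hv, ofReal_variance hS, evariance]
  refine lintegral_congr fun ξ => ?_
  congr 2
  have hm : ∫ ξ, (∑ i, fun ξ : Fin n → E => b i * Y i (ξ i)) ξ ∂(Measure.pi fun _ => ν)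
      = ∑ i, b i * ∫ x, Y i x ∂ν := by
    simp only [Finset.sum_apply]
    rw [integral_finsetSum _ fun i _ => (hX' i).integrable one_le_two]
    refine Finset.sum_congr rfl fun i _ => ?_
    rw [integral_const_mul]
    congr 1
    exact integral_comp_measurePreserving (measurePreserving_eval (fun _ : Fin n => ν) i) (hY i).1
  rw [hm, Finset.sum_apply, ← Finset.sum_sub_distrib]
  simp only [mul_sub]

/-- Bias–variance split with a crude factor `2` instead of the vanishing cross term. Real and
imaginary parts of the coefficients are treated separately, the variance being that of real
variables. -/
lemma lintegral_pi_linear_sq_le {Y : Fin n → E → ℝ} (hY : ∀ i, MemLp (Y i) 2 ν) {v : ℝ}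
    (hv : ∀ i, Var[Y i; ν] ≤ v) (a : Fin n → ℂ) (c : ℂ) :
    ∫⁻ ξ : Fin n → E, ‖∑ i, a i * (Y i (ξ i) : ℂ) - c‖ₑ ^ 2 ∂(Measure.pi fun _ => ν)
      ≤ 2 * (ENNReal.ofReal v * ∑ i, ‖a i‖ₑ ^ 2)
        + 2 * ‖∑ i, a i * ((∫ x, Y i x ∂ν : ℝ) : ℂ) - c‖ₑ ^ 2 := by
  have hm : ∀ b : Fin n → ℝ, AEMeasurable (fun ξ : Fin n → E =>
      ‖∑ i, b i * (Y i (ξ i) - ∫ x, Y i x ∂ν)‖ₑ ^ 2) (Measure.pi fun _ => ν) := by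
    intro b
    refine AEMeasurable.pow_const (AEMeasurable.enorm ?_) 2
    refine Finset.aemeasurable_fun_sum _ fun i _ => ?_
    exact (((hY i).comp_measurePreserving
      (measurePreserving_eval (fun _ : Fin n => ν) i)).1.aemeasurable.sub_const _).const_mul _
  have hpt : ∀ ξ : Fin n → E, ‖∑ i, a i * (Y i (ξ i) : ℂ) - c‖ₑ ^ 2 ≤
      2 * (‖∑ i, (a i).re * (Y i (ξ i) - ∫ x, Y i x ∂ν)‖ₑ ^ 2 +
        ‖∑ i, (a i).im * (Y i (ξ i) - ∫ x, Y i x ∂ν)‖ₑ ^ 2)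
      + 2 * ‖∑ i, a i * ((∫ x, Y i x ∂ν : ℝ) : ℂ) - c‖ₑ ^ 2 := by
    intro ξ
    have e : ∑ i, a i * (Y i (ξ i) : ℂ) - c
        = ∑ i, a i * ((Y i (ξ i) - ∫ x, Y i x ∂ν : ℝ) : ℂ)
          + (∑ i, a i * ((∫ x, Y i x ∂ν : ℝ) : ℂ) - c) := by
      rw [← add_sub_assoc, ← Finset.sum_add_distrib]
      congr 1
      refine Finset.sum_congr rfl fun i _ => ?_
      push_cast; ring
    rw [e]
    refine (enorm_add_sq_le _ _).trans (le_of_eq ?_)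
    congr 2
    have hre : (∑ i, a i * ((Y i (ξ i) - ∫ x, Y i x ∂ν : ℝ) : ℂ)).re
        = ∑ i, (a i).re * (Y i (ξ i) - ∫ x, Y i x ∂ν) := by
      rw [Complex.re_sum]; exact Finset.sum_congr rfl fun i _ => Complex.re_mul_ofReal _ _
    have him : (∑ i, a i * ((Y i (ξ i) - ∫ x, Y i x ∂ν : ℝ) : ℂ)).im
        = ∑ i, (a i).im * (Y i (ξ i) - ∫ x, Y i x ∂ν) := by
      rw [Complex.im_sum]; exact Finset.sum_congr rfl fun i _ => Complex.im_mul_ofReal _ _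
    rw [← hre, ← him]
    simp only [← ofReal_norm]
    rw [← ENNReal.ofReal_pow (norm_nonneg _), ← ENNReal.ofReal_pow (norm_nonneg _),
      ← ENNReal.ofReal_pow (norm_nonneg _), ← ENNReal.ofReal_add (by positivity) (by positivity)]
    congr 1
    rw [← Complex.normSq_eq_norm_sq, Complex.normSq_apply, Real.norm_eq_abs, Real.norm_eq_abs,
      sq_abs, sq_abs]
    ring
  refine (lintegral_mono hpt).trans ?_
  rw [lintegral_add_right _ measurable_const, lintegral_const, measure_univ, mul_one,
    lintegral_const_mul' _ _ (by simp), lintegral_add_left' (hm fun i => (a i).re),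
    lintegral_pi_sum_sq_eq ν hY fun i => (a i).re, lintegral_pi_sum_sq_eq ν hY fun i => (a i).im]
  gcongr
  have hvar : ∀ i, 0 ≤ Var[Y i; ν] := fun i => variance_nonneg _ _
  rw [← ENNReal.ofReal_add (Finset.sum_nonneg fun i _ => mul_nonneg (sq_nonneg _) (hvar i))
    (Finset.sum_nonneg fun i _ => mul_nonneg (sq_nonneg _) (hvar i))]
  have e : ∑ i, ‖a i‖ₑ ^ 2 = ENNReal.ofReal (∑ i, ‖a i‖ ^ 2) := by
    rw [ENNReal.ofReal_sum_of_nonneg fun i _ => by positivity]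
    refine Finset.sum_congr rfl fun i _ => ?_
    rw [ENNReal.ofReal_pow (norm_nonneg _), ofReal_norm]
  rw [e]
  -- Nonnegativity of `v` comes from some variance, hence needs at least one index.
  rcases isEmpty_or_nonempty (Fin n) with hn | hn
  · simp
  have hv0 : 0 ≤ v := (hvar (Classical.arbitrary _)).trans (hv _)
  rw [← ENNReal.ofReal_mul hv0]
  refine ENNReal.ofReal_le_ofReal ?_
  rw [← Finset.sum_add_distrib, Finset.mul_sum]
  refine Finset.sum_le_sum fun i _ => ?_
  rw [← add_mul, ← Complex.normSq_eq_norm_sq, Complex.normSq_apply, mul_comm, sq, sq]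
  exact mul_le_mul_of_nonneg_right (hv i) (add_nonneg (mul_self_nonneg _) (mul_self_nonneg _))

end Variance

/-! ### The law of the observations -/

section Law

variable {d : ℕ} {Ω : Type*} [MeasurableSpace Ω] {P : Measure Ω} [IsProbabilityMeasure P]
  {fZ fδ : Space d → ℝ} {Z δ : ℕ → Ω → Space d} {ε : ℕ → Ω → ℝ}

/-- The law of the pair `(δ i, ε i)`. -/
def noiseLaw (P : Measure Ω) (fδ : Space d → ℝ) (ε : ℕ → Ω → ℝ) : Measure (Space d × ℝ) :=
  (volume.withDensity fun x => ENNReal.ofReal (fδ x)).prod (P.map (ε 0))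

lemma ErrorsInVariables.isProbabilityMeasure_Z (hm : ErrorsInVariables P fZ fδ Z δ ε) :
    IsProbabilityMeasure ((volume : Measure (Space d)).withDensity fun z => ENNReal.ofReal (fZ z)) := by
  rw [← hm.law_Z 0]
  exact Measure.isProbabilityMeasure_map (hm.measurable_Z 0).aemeasurable

lemma ErrorsInVariables.isProbabilityMeasure_δ (hm : ErrorsInVariables P fZ fδ Z δ ε) :
    IsProbabilityMeasure ((volume : Measure (Space d)).withDensity fun z => ENNReal.ofReal (fδ z)) := by
  rw [← hm.law_δ 0]
  exact Measure.isProbabilityMeasure_map (hm.measurable_δ 0).aemeasurable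

lemma ErrorsInVariables.isProbabilityMeasure_noiseLaw (hm : ErrorsInVariables P fZ fδ Z δ ε) :
    IsProbabilityMeasure (noiseLaw P fδ ε) := by
  have := hm.isProbabilityMeasure_δ
  have := Measure.isProbabilityMeasure_map (μ := P) (hm.measurable_ε 0).aemeasurable
  unfold noiseLaw; infer_instance

/-- The joint law is a product of the design part and the noise part, so conditioning on the design
becomes Fubini's theorem. -/
lemma ErrorsInVariables.measurePreserving (hm : ErrorsInVariables P fZ fδ Z δ ε) (n : ℕ) :
    MeasurePreserving (fun ω => ((fun i : Fin n => Z i ω), fun i : Fin n => (δ i ω, ε i ω))) P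
      ((Measure.pi fun _ : Fin n => volume.withDensity fun z => ENNReal.ofReal (fZ z)).prod
        (Measure.pi fun _ : Fin n => noiseLaw P fδ ε)) := by
  have i1 := hm.isProbabilityMeasure_Z
  have i2 := hm.isProbabilityMeasure_noiseLaw
  have hmeas : ∀ i, Measurable fun ω => (Z i ω, δ i ω, ε i ω) := fun i =>
    (hm.measurable_Z i).prodMk ((hm.measurable_δ i).prodMk (hm.measurable_ε i))
  have hlaw : ∀ i, P.map (fun ω => (Z i ω, δ i ω, ε i ω)) =
      (volume.withDensity fun z => ENNReal.ofReal (fZ z)).prod (noiseLaw P fδ ε) := by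
    intro i
    have h1 := (indepFun_iff_map_prod_eq_prod_map_map (hm.measurable_Z i).aemeasurable
      ((hm.measurable_δ i).prodMk (hm.measurable_ε i)).aemeasurable).1 (hm.indep_Z i)
    have h2 := (indepFun_iff_map_prod_eq_prod_map_map (hm.measurable_δ i).aemeasurable
      (hm.measurable_ε i).aemeasurable).1 (hm.indep_δ i)
    rw [h1, h2, hm.law_Z, hm.law_δ, (hm.ident_ε i).map_eq, noiseLaw]
  have hind : iIndepFun (fun (i : Fin n) ω => (Z i ω, δ i ω, ε i ω)) P :=
    hm.indep.precomp Fin.val_injective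
  have hmap := (iIndepFun_iff_map_fun_eq_pi_map fun i : Fin n => (hmeas i).aemeasurable).1 hind
  simp_rw [hlaw] at hmap
  have h3 : MeasurePreserving (fun ω (i : Fin n) => (Z i ω, δ i ω, ε i ω)) P
      (Measure.pi fun _ : Fin n => (volume.withDensity fun z => ENNReal.ofReal (fZ z)).prod
        (noiseLaw P fδ ε)) := ⟨measurable_pi_lambda _ fun i => hmeas i, hmap⟩
  exact (measurePreserving_arrowProdEquivProdArrow _ _ (Fin n)
    (fun _ => volume.withDensity fun z => ENNReal.ofReal (fZ z)) (fun _ => noiseLaw P fδ ε)).comp h3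

/-- Moments of the response given the position of the design point. -/
lemma ErrorsInVariables.response_moments (hm : ErrorsInVariables P fZ fδ Z δ ε)
    (hfm : Measurable fδ) (hf0 : ∀ x, 0 ≤ fδ x) {h : Space d → ℝ} (hh : Measurable h) {M : ℝ}
    (hM : ∀ᵐ x, |h x| ≤ M) (z : Space d) :
    MemLp (fun p : Space d × ℝ => h (z + p.1) + p.2) 2 (noiseLaw P fδ ε) ∧
    ∫ p, (h (z + p.1) + p.2) ∂(noiseLaw P fδ ε) = calibrated h fδ z ∧
    Var[fun p : Space d × ℝ => h (z + p.1) + p.2; noiseLaw P fδ ε]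
      ≤ 2 * M ^ 2 + 2 * ∫ ω, ε 0 ω ^ 2 ∂P := by
  have i1 := hm.isProbabilityMeasure_δ
  have i2 := Measure.isProbabilityMeasure_map (μ := P) (hm.measurable_ε 0).aemeasurable
  have i3 := hm.isProbabilityMeasure_noiseLaw
  have p1 : MeasurePreserving Prod.fst (noiseLaw P fδ ε)
      (volume.withDensity fun x => ENNReal.ofReal (fδ x)) := measurePreserving_fst
  have p2 : MeasurePreserving Prod.snd (noiseLaw P fδ ε) (P.map (ε 0)) := measurePreserving_snd
  have hbd : ∀ᵐ x ∂((volume : Measure (Space d)).withDensity fun x => ENNReal.ofReal (fδ x)),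
      |h (z + x)| ≤ M := by
    refine (withDensity_absolutelyContinuous _ _).ae_le ?_
    exact (measurePreserving_add_left (volume : Measure (Space d)) z).quasiMeasurePreserving.ae hM
  have hz : Measurable fun x => h (z + x) := hh.comp (measurable_const_add z)
  have m1 : MemLp (fun x => h (z + x)) 2
      ((volume : Measure (Space d)).withDensity fun x => ENNReal.ofReal (fδ x)) :=
    MemLp.of_bound hz.aestronglyMeasurable M hbd
  have m2 : MemLp (fun x : ℝ => x) 2 (P.map (ε 0)) := by
    exact (memLp_map_measure_iff (g := fun x : ℝ => x) aestronglyMeasurable_id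
      (hm.measurable_ε 0).aemeasurable).2 hm.memLp_ε
  have m1' : MemLp (fun p : Space d × ℝ => h (z + p.1)) 2 (noiseLaw P fδ ε) :=
    m1.comp_measurePreserving p1
  have m2' : MemLp (fun p : Space d × ℝ => p.2) 2 (noiseLaw P fδ ε) :=
    m2.comp_measurePreserving p2
  refine ⟨m1'.add m2', ?_, ?_⟩
  · rw [integral_add (m1'.integrable one_le_two) (m2'.integrable one_le_two)]
    have e1 : ∫ p, h (z + p.1) ∂(noiseLaw P fδ ε) = calibrated h fδ z := by
      rw [integral_comp_measurePreserving p1 (g := fun x => h (z + x)) m1.1,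
        integral_withDensity_eq_integral_toReal_smul (by fun_prop) (by simp), calibrated_eq]
      refine integral_congr_ae (Eventually.of_forall fun x => ?_)
      simp [ENNReal.toReal_ofReal (hf0 x), mul_comm]
    have e2 : ∫ p, p.2 ∂(noiseLaw P fδ ε) = 0 := by
      rw [integral_comp_measurePreserving p2 (g := fun x => x) m2.1,
        integral_map (f := fun y : ℝ => y) (hm.measurable_ε 0).aemeasurable aestronglyMeasurable_id]
      exact hm.centred_ε
    rw [e1, e2, add_zero]
  · refine (variance_le_expectation_sq (m1'.add m2').1).trans ?_
    have e2 : ∫ p, p.2 ^ 2 ∂(noiseLaw P fδ ε) = ∫ ω, ε 0 ω ^ 2 ∂P := by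
      rw [integral_comp_measurePreserving p2 (g := fun x => x ^ 2) (by fun_prop),
        integral_map (hm.measurable_ε 0).aemeasurable (by fun_prop)]
    have hb' : ∀ᵐ p ∂(noiseLaw P fδ ε), |h (z + p.1)| ≤ M := p1.quasiMeasurePreserving.ae hbd
    have hi2 : Integrable (fun p : Space d × ℝ => p.2 ^ 2) (noiseLaw P fδ ε) := m2'.integrable_sq
    have := integral_mono_ae (μ := noiseLaw P fδ ε) (f := (fun p : Space d × ℝ => h (z + p.1) + p.2) ^ 2)
      (g := fun p => 2 * M ^ 2 + 2 * p.2 ^ 2) (m1'.add m2').integrable_sq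
      ((integrable_const _).add (hi2.const_mul 2)) ?_
    · refine this.trans (le_of_eq ?_)
      rw [integral_add (integrable_const _) (hi2.const_mul 2), integral_const, probReal_univ,
        one_smul, integral_const_mul 2, e2]
    · filter_upwards [hb'] with p hp
      have h1 := abs_le.1 hp
      have h2 : h (z + p.1) ^ 2 ≤ M ^ 2 := sq_le_sq' h1.1 h1.2
      simp only [Pi.pow_apply]
      nlinarith [sq_nonneg (h (z + p.1) - p.2)]

end Law

/-! ### The design -/

section Design

variable {d : ℕ} {fZ : Space d → ℝ} {S Sstar : Set (Space d)}

/-- The law of the design points. -/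
def designLaw (fZ : Space d → ℝ) : Measure (Space d) :=
  volume.withDensity fun z => ENNReal.ofReal (fZ z)

lemma DesignDensity.exists_designLaw_le (hZ : DesignDensity fZ S Sstar) :
    ∃ c : ENNReal, c ≠ ⊤ ∧ designLaw fZ ≤ c • volume.restrict S := by
  obtain ⟨ρ, ρ', hρ, hb⟩ := hZ.bounds
  refine ⟨ENNReal.ofReal ρ', ENNReal.ofReal_ne_top, ?_⟩
  have h1 : (fun z => ENNReal.ofReal (fZ z)) ≤ S.indicator fun _ => ENNReal.ofReal ρ' := by
    intro z
    by_cases hz : z ∈ S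
    · rw [Set.indicator_of_mem hz]
      exact ENNReal.ofReal_le_ofReal (hb z hz).2
    · have : fZ z = 0 := by by_contra h; exact hz (hZ.support_subset h)
      simp [this]
  calc designLaw fZ ≤ volume.withDensity (S.indicator fun _ => ENNReal.ofReal ρ') :=
        withDensity_mono (Eventually.of_forall h1)
    _ = ENNReal.ofReal ρ' • volume.restrict S := by
        rw [withDensity_indicator hZ.compact.measurableSet, withDensity_const]

/-- Points of `Sstar` keep a distance `r₀` from the complement of `S`. Shrinking the ball by `κ =
min 1 (r₀ / Rm)` places it inside `S`, where the density is at least `ρ₀`, so one constant serves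
for all radii up to `Rm`. -/
lemma DesignDensity.exists_ball_bound (hZ : DesignDensity fZ S Sstar) :
    ∃ c₀ Rmax : ℝ, 0 < c₀ ∧ (∀ w ∈ S, ∀ z ∈ Sstar, ‖w - z‖ ≤ Rmax) ∧
      ∀ z ∈ Sstar, ∀ ρ, 0 ≤ ρ → ρ ≤ Rmax →
        ENNReal.ofReal (c₀ * ρ ^ d) ≤ designLaw fZ (Metric.closedBall z ρ) := by
  obtain ⟨ρ₀, ρ', hρ₀, hb⟩ := hZ.bounds
  obtain ⟨r₀, hr₀, hsub⟩ := hZ.compact_star.exists_cthickening_subset_open isOpen_interior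
    hZ.star_subset
  set Rm := Metric.diam S + 1 with hRm
  have hRm0 : 0 < Rm := by have := Metric.diam_nonneg (s := S); linarith
  set κ := min 1 (r₀ / Rm) with hκ
  have hκ0 : 0 < κ := lt_min one_pos (by positivity)
  set v := (volume (Metric.ball (0 : Space d) 1)).toReal with hv
  have hv0 : 0 < v := ENNReal.toReal_pos (Metric.measure_ball_pos volume _ one_pos).ne'
    measure_ball_lt_top.ne
  refine ⟨ρ₀ * (κ ^ d * v), Rm, by positivity, ?_, ?_⟩
  · intro w hw z hz
    rw [← dist_eq_norm]
    have := Metric.dist_le_diam_of_mem hZ.compact.isBounded hw (interior_subset (hZ.star_subset hz))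
    linarith
  · intro z hz ρ hρ hρR
    have h1 : κ * ρ ≤ r₀ := by
      calc κ * ρ ≤ r₀ / Rm * Rm := by
            gcongr
            exact min_le_right _ _
        _ = r₀ := by field_simp
    have h2 : Metric.closedBall z (κ * ρ) ⊆ S := by
      refine (Metric.closedBall_subset_closedBall h1).trans ?_
      exact (Metric.closedBall_subset_cthickening hz r₀).trans (hsub.trans interior_subset)
    have h3 : κ * ρ ≤ ρ := mul_le_of_le_one_left hρ (min_le_left _ _)
    calc ENNReal.ofReal (ρ₀ * (κ ^ d * v) * ρ ^ d)
        = ENNReal.ofReal ρ₀ * volume (Metric.closedBall z (κ * ρ)) := by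
          rw [Measure.addHaar_closedBall _ _ (by positivity), finrank_euclideanSpace_fin,
            ← ENNReal.ofReal_toReal (measure_ball_lt_top (x := (0 : Space d)) (r := 1)
              (μ := volume)).ne, ← hv, ← ENNReal.ofReal_mul (by positivity),
            ← ENNReal.ofReal_mul hρ₀.le]
          congr 1; ring
      _ = ∫⁻ _ in Metric.closedBall z (κ * ρ), ENNReal.ofReal ρ₀ := by rw [setLIntegral_const]
      _ ≤ ∫⁻ x in Metric.closedBall z (κ * ρ), ENNReal.ofReal (fZ x) := by
          refine setLIntegral_mono' measurableSet_closedBall fun x hx => ?_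
          exact ENNReal.ofReal_le_ofReal (hb x (h2 hx)).1
      _ = designLaw fZ (Metric.closedBall z (κ * ρ)) := by
          rw [designLaw, withDensity_apply _ measurableSet_closedBall]
      _ ≤ _ := measure_mono (Metric.closedBall_subset_closedBall h3)

/-- Uses `m = 2D + 1` groups: the summand `l = L` of `D` is at least `L`, so `2L < m`, and `K` has
room for `m` disjoint groups of `K*` points. -/
lemma DesignDensity.exists_nnMoment_le (hd : 1 ≤ d) (hZ : DesignDensity fZ S Sstar)
    [IsProbabilityMeasure (designLaw fZ)] {L K : ℕ} (hL : 1 ≤ L)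
    (hK : 2 + (2 * degreeSum d L + 1) * polyDim d L ≤ K) (N : ℕ) :
    ∃ B : ENNReal, B ≠ ⊤ ∧ ∀ (n : ℕ) (τ : ℝ), K ≤ n → 0 < τ → τ ^ d = n → ∀ z ∈ Sstar,
      ∫⁻ Z : Fin n → Space d, nnMoment L K N τ Sstar Z z ∂(Measure.pi fun _ => designLaw fZ) ≤ B := by
  obtain ⟨c, hc, hμ⟩ := hZ.exists_designLaw_le
  obtain ⟨c₀, Rmax, hc₀, hR, hball⟩ := hZ.exists_ball_bound
  have hLD : L ≤ degreeSum d L := by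
    have h1 := Finset.single_le_sum (f := fun l => l * (d + l - 1).choose l)
      (fun i _ => Nat.zero_le _) (Finset.mem_Icc.2 ⟨hL, le_refl L⟩)
    have h2 : 1 ≤ (d + L - 1).choose L := Nat.choose_pos (by omega)
    exact (Nat.le_mul_of_pos_right L h2).trans h1
  obtain ⟨B, hB, hb⟩ := exists_lintegral_fitSqTop_le hd (K := K) (L := L)
    (m := 2 * degreeSum d L + 1) (by omega) (by omega) (by omega) (designLaw fZ) S Sstar
    hZ.compact.measurableSet hc hμ hc₀ hR hball N
  refine ⟨B, hB, fun n τ hn hτ hτn z hz => ?_⟩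
  refine le_trans (le_of_eq ?_) (hb n τ hn hτ hτn z hz)
  unfold nnMoment
  refine lintegral_finsetSum _ fun J _ => ?_
  have h := (measurable_nnMoment_term L N τ hZ.compact_star.measurableSet J).comp
    (measurable_prodMk_right (y := z))
  simpa only [Function.comp_def] using h

end Design

/-! ### Risk of the estimated coefficients -/

section CoefficientRisk

variable {d : ℕ} {Ω : Type*} [MeasurableSpace Ω] {P : Measure Ω} [IsProbabilityMeasure P]
  {fZ fδ : Space d → ℝ} {Z δ : ℕ → Ω → Space d} {ε : ℕ → Ω → ℝ} {S Sstar : Set (Space d)}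

/-- The weighted sum of responses that estimates `∫ g φ_j` over `Sstar`. -/
def linEst {n : ℕ} (L K : ℕ) (Sstar : Set (Space d)) (h : Space d → ℝ) (j : Fin d → ℤ)
    (q : (Fin n → Space d) × (Fin n → Space d × ℝ)) : ℂ :=
  ∑ i, (basisFun j (q.1 i) * (intWeight L K Sstar q.1 i : ℂ)) *
    ((h (q.1 i + (q.2 i).1) + (q.2 i).2 : ℝ) : ℂ)

lemma measurable_basisFun (j : Fin d → ℤ) : Measurable (basisFun j) :=
  (continuous_expFun_right (intVec j)).measurable

lemma measurable_linEst {n : ℕ} (L K : ℕ) (hS : MeasurableSet Sstar) {h : Space d → ℝ}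
    (hh : Measurable h) (j : Fin d → ℤ) : Measurable (linEst (n := n) L K Sstar h j) := by
  unfold linEst
  refine Finset.measurable_sum _ fun i _ => ?_
  have h1 : Measurable fun q : (Fin n → Space d) × (Fin n → Space d × ℝ) =>
      intWeight L K Sstar q.1 i := (measurable_intWeight L K hS i).comp measurable_fst
  have h2 := measurable_basisFun j
  fun_prop

/-- Mean squared error of the estimated Fourier coefficients. -/
theorem exists_coefficient_risk_le (hd : 1 ≤ d) (hm : ErrorsInVariables P fZ fδ Z δ ε)
    (hZ : DesignDensity fZ S Sstar) (hfm : Measurable fδ) (hf0 : ∀ x, 0 ≤ fδ x) {L K : ℕ}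
    (hL : 1 ≤ L) (hK : 2 + (2 * degreeSum d L + 1) * polyDim d L ≤ K) {M B : ℝ} (hB : 0 < B) :
    ∃ C : ENNReal, C ≠ ⊤ ∧ ∀ h : Space d → ℝ, Measurable h →
      RegressionBounds fδ Sstar L M B h → ∀ (n : ℕ) (τ : ℝ), K ≤ n → 0 < τ → τ ^ d = n →
      (∀ᵐ ω ∂P, ∀ j : Fin d → ℤ,
        psiHat Sstar L K (fun u z => (u : ℂ) * basisFun j z)
          (fun i : Fin n => response h Z δ ε i ω) (fun i : Fin n => Z i ω)
        = linEst L K Sstar h j ((fun i : Fin n => Z i ω), fun i : Fin n => (δ i ω, ε i ω))) ∧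
      ∀ j : Fin d → ℤ, ∫⁻ ω, ‖linEst L K Sstar h j
          ((fun i : Fin n => Z i ω), fun i : Fin n => (δ i ω, ε i ω))
            - fourierCoef h j * fourierCoef fδ (-j)‖ₑ ^ 2 ∂P
        ≤ C * ENNReal.ofReal ((τ ^ d)⁻¹ + (1 + ‖intVec j‖) ^ (2 * L) * (τ ^ (2 * L))⁻¹) := by
  have i1 : IsProbabilityMeasure (designLaw fZ) := hm.isProbabilityMeasure_Z
  have i2 := hm.isProbabilityMeasure_noiseLaw
  have hSm : MeasurableSet Sstar := hZ.compact_star.measurableSet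
  have hSfin : volume Sstar ≠ ⊤ := hZ.compact_star.measure_lt_top.ne
  have hK0 : 0 < K := by omega
  -- One moment order serves both parts: `2(d + 1)` for the overlap kernel in the variance and `2L`
  -- for the bias.
  obtain ⟨B₀, hB₀, hmom⟩ := hZ.exists_nnMoment_le hd hL hK (2 * (d + 1) + 2 * L)
  obtain ⟨V, hV⟩ : ∃ V : ENNReal, V = volume Sstar := ⟨_, rfl⟩
  obtain ⟨I, hI⟩ : ∃ I : ENNReal, I = ∫⁻ u : Space d, ENNReal.ofReal (((1 + ‖u‖) ^ (d + 1))⁻¹) :=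
    ⟨_, rfl⟩
  have hIfin : I ≠ ⊤ := by rw [hI]; exact lintegral_inv_one_add_norm_lt_top.ne
  obtain ⟨σ, hσ⟩ : ∃ σ : ℝ, σ = 2 * M ^ 2 + 2 * ∫ ω, ε 0 ω ^ 2 ∂P := ⟨_, rfl⟩
  rw [← hV] at hSfin
  obtain ⟨C₁, hC₁⟩ : ∃ C₁ : ENNReal, C₁ = 2 * (ENNReal.ofReal σ * (2 * B₀ * V * I)) := ⟨_, rfl⟩
  obtain ⟨C₂, hC₂⟩ : ∃ C₂ : ENNReal, C₂ = 2 * (2 * V * (ENNReal.ofReal (K * B ^ 2) * (B₀ * V))) :=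
    ⟨_, rfl⟩
  refine ⟨C₁ + C₂, by rw [hC₁, hC₂]; finiteness, fun h hh hreg n τ hn hτ hτn => ?_⟩
  have hmp := hm.measurePreserving n
  change MeasurePreserving _ P ((Measure.pi fun _ : Fin n => designLaw fZ).prod _) at hmp
  have hb := hmom n τ hn hτ hτn
  have hint := lintegral_nnMoment_le (designLaw fZ) hSm hb
  rw [← hV] at hint
  have hmeasI : Measurable fun Z : Fin n → Space d =>
      ∫⁻ z in Sstar, nnMoment L K (2 * (d + 1) + 2 * L) τ Sstar Z z :=
    (measurable_nnMoment L K (2 * (d + 1) + 2 * L) τ hSm).lintegral_prod_right'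
  have hfin : ∀ᵐ Z : Fin n → Space d ∂(Measure.pi fun _ => designLaw fZ),
      ∫⁻ z in Sstar, nnMoment L K (2 * (d + 1) + 2 * L) τ Sstar Z z < ⊤ :=
    ae_lt_top hmeasI (ne_top_of_le_ne_top (by finiteness) hint)
  have hcells := ae_ae_mem_cell (designLaw fZ) (n := n) (K := K) (Sstar := Sstar) hd
    (withDensity_absolutelyContinuous _ _) hn
  have hZmp : MeasurePreserving (fun ω => fun i : Fin n => Z i ω) P
      (Measure.pi fun _ : Fin n => designLaw fZ) := by
    have := (measurePreserving_fst (μ := Measure.pi fun _ : Fin n => designLaw fZ)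
      (ν := Measure.pi fun _ : Fin n => noiseLaw P fδ ε)).comp hmp
    exact this
  refine ⟨?_, fun j => ?_⟩
  · filter_upwards [hZmp.quasiMeasurePreserving.ae hfin] with ω hω j
    rw [psiHat_eq_sum hτ hSm (by rwa [← hV]) hω.ne]
    refine Finset.sum_congr rfl fun i _ => ?_
    simp only [response]
    push_cast; ring
  · have hmeas : Measurable fun q : (Fin n → Space d) × (Fin n → Space d × ℝ) =>
        ‖linEst L K Sstar h j q - fourierCoef h j * fourierCoef fδ (-j)‖ₑ ^ 2 :=
      ((measurable_linEst L K hSm hh j).sub_const _).enorm.pow_const 2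
    rw [hmp.lintegral_comp hmeas, lintegral_prod _ hmeas.aemeasurable]
    have hF := hreg.taylor j
    have hFc : Continuous fun z => (calibrated h fδ z : ℂ) * basisFun j z :=
      hreg.continuous.mul (continuous_expFun_right (intVec j))
    -- With the design fixed, the first term is the variance and the second the squared bias; the
    -- modulus of `φ_j` is `1`, so `j` enters only through the Taylor constant.
    have hinner : ∀ᵐ Z : Fin n → Space d ∂(Measure.pi fun _ => designLaw fZ),
        ∫⁻ ξ, ‖linEst L K Sstar h j (Z, ξ) - fourierCoef h j * fourierCoef fδ (-j)‖ₑ ^ 2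
          ∂(Measure.pi fun _ : Fin n => noiseLaw P fδ ε) ≤
        2 * (ENNReal.ofReal σ * ∑ i, ‖intWeight L K Sstar Z i‖ₑ ^ 2) +
        2 * (2 * V * (ENNReal.ofReal (K * (B * (1 + ‖intVec j‖) ^ L) ^ 2 * (τ ^ (2 * L))⁻¹) *
          ∫⁻ z in Sstar, nnMoment L K (2 * (d + 1) + 2 * L) τ Sstar Z z)) := by
      filter_upwards [hfin, hcells] with Z hZfin hZcell
      have hmom := fun i : Fin n => hm.response_moments hfm hf0 hh hreg.ae_abs_le (Z i)
      have h1 := lintegral_pi_linear_sq_le (noiseLaw P fδ ε)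
        (Y := fun (i : Fin n) p => h (Z i + p.1) + p.2) (fun i => (hmom i).1)
        (fun i => (hmom i).2.2) (fun i => basisFun j (Z i) * (intWeight L K Sstar Z i : ℂ))
        (fourierCoef h j * fourierCoef fδ (-j))
      rw [← hσ] at h1
      refine h1.trans ?_
      have hbias := bias_sq_le (Z := Z) (K := K) (N := 2 * (d + 1) + 2 * L) hτ hK0 (by omega) hSm
        (by rwa [← hV]) hZfin.ne hZcell hFc.measurable
        (hFc.continuousOn.integrableOn_compact hZ.compact_star) (by positivity) hF
      rw [hreg.setIntegral_eq j, ← hV] at hbias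
      gcongr with i _
      · rw [enorm_mul]
        have e1 : ‖basisFun j (Z i)‖ₑ = 1 := by
          rw [← ofReal_norm, basisFun_eq_expFun, norm_expFun, ENNReal.ofReal_one]
        have e2 : ‖((intWeight L K Sstar Z i : ℝ) : ℂ)‖ₑ = ‖intWeight L K Sstar Z i‖ₑ := by
          rw [← ofReal_norm, Complex.norm_real, ofReal_norm]
        rw [e1, e2, one_mul]
      · refine le_trans (le_of_eq ?_) hbias
        congr 3
        refine Finset.sum_congr rfl fun i _ => ?_
        rw [(hmom i).2.1]; ring
    refine (lintegral_mono_ae hinner).trans ?_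
    have hmW : Measurable fun Z : Fin n → Space d => ∑ i, ‖intWeight L K Sstar Z i‖ₑ ^ 2 :=
      Finset.measurable_sum _ fun i _ => (measurable_intWeight L K hSm i).enorm.pow_const 2
    rw [lintegral_add_left (by fun_prop), lintegral_const_mul' _ _ (by simp),
      lintegral_const_mul' _ _ (by simp), lintegral_const_mul' _ _ (by simp),
      lintegral_const_mul' _ _ (by finiteness), lintegral_const_mul' _ _ (by simp)]
    have hvar := lintegral_sum_intWeight_sq_le (designLaw fZ) hτ hSm (by omega) hb
    rw [← hV, ← hI] at hvar
    have hpos : (0 : ℝ) < (τ ^ d)⁻¹ := by positivity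
    calc _ ≤ 2 * (ENNReal.ofReal σ * (ENNReal.ofReal ((τ ^ d)⁻¹) * (2 * B₀ * V * I))) +
        2 * (2 * V * (ENNReal.ofReal (K * (B * (1 + ‖intVec j‖) ^ L) ^ 2 * (τ ^ (2 * L))⁻¹) *
          (B₀ * V))) := by gcongr
      _ = C₁ * ENNReal.ofReal ((τ ^ d)⁻¹) +
          C₂ * ENNReal.ofReal ((1 + ‖intVec j‖) ^ (2 * L) * (τ ^ (2 * L))⁻¹) := by
          have e : (K : ℝ) * (B * (1 + ‖intVec j‖) ^ L) ^ 2 * (τ ^ (2 * L))⁻¹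
              = (K * B ^ 2) * ((1 + ‖intVec j‖) ^ (2 * L) * (τ ^ (2 * L))⁻¹) := by
            rw [mul_pow, ← pow_mul, mul_comm L 2]; ring
          rw [e, ENNReal.ofReal_mul (p := (K : ℝ) * B ^ 2) (by positivity), hC₁, hC₂]; ring
      _ ≤ _ := by
          rw [ENNReal.ofReal_add (by positivity) (by positivity)]
          rw [add_mul, mul_add, mul_add]
          have h1 : ∀ a b c e : ENNReal, a + b ≤ a + c + (e + b) := fun a b c e => by
            rw [add_assoc]; gcongr; rw [← add_assoc]; exact le_add_self
          exact h1 _ _ _ _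

end CoefficientRisk

/-! ### The integrated squared error -/

section IntegratedError

variable {d : ℕ} {A Sstar : Set (Space d)} {fδ : Space d → ℝ} {α γ : ℝ}

/-- The frequencies `{-m, …, m}^d`. -/
def freqBox (d m : ℕ) : Finset (Fin d → ℤ) :=
  Fintype.piFinset fun _ : Fin d => Finset.Icc (-(m : ℤ)) (m : ℤ)

lemma one_add_norm_intVec_le (hd : 1 ≤ d) {m : ℕ} {j : Fin d → ℤ} (hj : j ∈ freqBox d m) :
    1 + ‖intVec j‖ ≤ d * (1 + m : ℝ) := by
  have hd' : (1 : ℝ) ≤ d := by exact_mod_cast hd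
  have h1 : ‖intVec j‖ ^ 2 ≤ (d * m : ℝ) ^ 2 := by
    rw [EuclideanSpace.norm_sq_eq]
    calc ∑ k, ‖(intVec j) k‖ ^ 2 ≤ ∑ _k : Fin d, (m : ℝ) ^ 2 := by
          refine Finset.sum_le_sum fun k _ => ?_
          have h2 := Finset.mem_Icc.1 (Fintype.mem_piFinset.1 hj k)
          have h3 : |(j k : ℝ)| ≤ m := by
            rw [abs_le]; exact ⟨by exact_mod_cast h2.1, by exact_mod_cast h2.2⟩
          rw [Real.norm_eq_abs]
          simp only [intVec]
          gcongr
      _ = d * (m : ℝ) ^ 2 := by simp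
      _ ≤ (d * m : ℝ) ^ 2 := by
          rw [mul_pow]
          gcongr
          nlinarith
  have h2 := (sq_le_sq₀ (norm_nonneg _) (by positivity)).1 h1
  nlinarith

lemma le_norm_intVec {m : ℕ} {j : Fin d → ℤ} (hj : j ∉ freqBox d m) :
    (m : ℝ) ≤ ‖intVec j‖ := by
  simp only [freqBox, Fintype.mem_piFinset, not_forall, Finset.mem_Icc, not_and_or, not_le] at hj
  obtain ⟨k, hk⟩ := hj
  have h1 : (m : ℝ) ≤ |(j k : ℝ)| := by
    rcases hk with hk | hk
    · have : (j k : ℝ) < -(m : ℝ) := by exact_mod_cast hk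
      have := neg_abs_le (j k : ℝ)
      linarith
    · have : (m : ℝ) < j k := by exact_mod_cast hk
      have := le_abs_self (j k : ℝ)
      linarith
  have := PiLp.norm_apply_le (intVec j) k
  rw [Real.norm_eq_abs] at this
  exact h1.trans this

lemma card_freqBox_le (d m : ℕ) : ((freqBox d m).card : ℝ) ≤ (2 * (1 + m : ℝ)) ^ d := by
  have h1 : (freqBox d m).card = (2 * m + 1) ^ d := by
    rw [freqBox, Fintype.card_piFinset]
    simp only [Int.card_Icc, Finset.prod_const, Finset.card_univ, Fintype.card_fin]
    congr 1; omega
  rw [h1]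
  push_cast
  gcongr
  linarith

lemma norm_inv_two_pi_pow_le : ‖(((2 * Real.pi : ℝ) : ℂ)⁻¹ ^ d)‖ₑ ≤ 1 := by
  rw [enorm_pow]
  refine pow_le_one' ?_ d
  refine (enorm_le_ofReal_of_norm_le (c := 1) ?_).trans (by simp)
  rw [norm_inv, Complex.norm_real, Real.norm_of_nonneg (by positivity)]
  exact inv_le_one_of_one_le₀ (by linarith [Real.pi_gt_three])

/-- The integrated squared error in terms of the errors of the estimated coefficients. -/
lemma lintegral_hHat_sub_sq_le {n : ℕ} {L L' K m : ℕ} {M B c : ℝ} (hα : 0 ≤ α) (hc : 0 < c)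
    (hδ : ∀ j : Fin d → ℤ, c * (1 + ‖intVec j‖) ^ (-γ) ≤ ‖fourierCoef fδ j‖)
    {h : Space d → ℝ} (hreg : RegressionBounds fδ Sstar L' M B h) (U : Fin n → ℝ)
    (Z : Fin n → Space d) :
    ∫⁻ x in closedCube d, ‖hHat Sstar fδ L K m U Z x - (h x : ℂ)‖ₑ ^ 2 ≤
      ENNReal.ofReal ((2 * Real.pi) ^ d) *
        (∑ j ∈ freqBox d m, ENNReal.ofReal ((c ^ 2)⁻¹ * (1 + ‖intVec j‖) ^ (2 * γ)) *
          ‖psiHat Sstar L K (fun u z => (u : ℂ) * basisFun j z) U Z -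
            fourierCoef h j * fourierCoef fδ (-j)‖ₑ ^ 2 +
          ENNReal.ofReal ((1 + m : ℝ) ^ (-(2 * α))) * energy α h) := by
  obtain ⟨p, hp⟩ : ∃ p : (Fin d → ℤ) → ℂ, p = fun j =>
    psiHat Sstar L K (fun u z => (u : ℂ) * basisFun j z) U Z := ⟨_, rfl⟩
  obtain ⟨a, ha⟩ : ∃ a : (Fin d → ℤ) → ℂ, a = fun j => if j ∈ freqBox d m then
    ((2 * Real.pi : ℝ) : ℂ)⁻¹ ^ d * (p j / fourierCoef fδ (-j)) else 0 := ⟨_, rfl⟩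
  have has : Summable a := by
    refine summable_of_ne_finset_zero (s := freqBox d m) fun j hj => ?_
    rw [ha]; exact if_neg hj
  have hbs : Summable (seriesCoef fun x => (h x : ℂ)) :=
    summable_seriesCoef (f := fun x => (h x : ℂ)) hreg.summable
  have hHat_eq : ∀ x, hHat Sstar fδ L K m U Z x = series a x := by
    intro x
    have h1 : series a x = ∑ j ∈ freqBox d m, a j * expFun (-intVec j) x := by
      refine tsum_eq_sum fun j hj => ?_
      rw [ha]; simp [hj]
    rw [h1, hHat, Finset.mul_sum]
    refine Finset.sum_congr rfl fun j hj => ?_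
    have hj' : j ∈ freqBox d m := hj
    rw [ha, hp]
    simp only [hj', if_true]
    rw [basisFun_eq_expFun, intVec_neg]
    ring
  have hae : ∀ᵐ x ∂(volume : Measure (Space d)), x ∈ closedCube d →
      ‖hHat Sstar fδ L K m U Z x - (h x : ℂ)‖ₑ ^ 2 =
        ‖series (fun j => a j - seriesCoef (fun x => (h x : ℂ)) j) x‖ₑ ^ 2 := by
    filter_upwards [hreg.ae_eq_series] with x hx hxc
    rw [hx hxc, hHat_eq]
    congr 2
    have h1 := (hasSum_series has x).sub (hasSum_series hbs x)
    refine (h1.tsum_eq.symm.trans ?_)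
    exact tsum_congr fun j => by ring
  rw [setLIntegral_congr_fun_ae measurableSet_closedCube hae,
    lintegral_closedCube_series_sq (has.sub hbs)]
  refine mul_le_mul_right ?_ _
  have hterm : ∀ j, ‖a j - seriesCoef (fun x => (h x : ℂ)) j‖ₑ ^ 2 ≤
      (if j ∈ freqBox d m then ENNReal.ofReal ((c ^ 2)⁻¹ * (1 + ‖intVec j‖) ^ (2 * γ)) *
          ‖p j - fourierCoef h j * fourierCoef fδ (-j)‖ₑ ^ 2 else 0) +
        ENNReal.ofReal ((1 + m : ℝ) ^ (-(2 * α))) *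
          (ENNReal.ofReal ((1 + ‖intVec j‖) ^ (2 * α)) * ‖fourierCoef h j‖ₑ ^ 2) := by
    intro j
    have hδj := hδ (-j)
    rw [intVec_neg, norm_neg] at hδj
    have hδ0 : 0 < c * (1 + ‖intVec j‖) ^ (-γ) := by positivity
    have hne : fourierCoef fδ (-j) ≠ 0 := by
      intro h0; rw [h0, norm_zero] at hδj; linarith
    by_cases hj : j ∈ freqBox d m
    · rw [if_pos hj]
      refine le_trans ?_ le_self_add
      have e : a j - seriesCoef (fun x => (h x : ℂ)) j = ((2 * Real.pi : ℝ) : ℂ)⁻¹ ^ d *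
          ((p j - fourierCoef h j * fourierCoef fδ (-j)) * (fourierCoef fδ (-j))⁻¹) := by
        rw [ha]
        simp only [hj, if_true, seriesCoef]
        rw [← fourierCoef_eq_ft]
        field_simp
      rw [e, enorm_mul, mul_pow, enorm_mul, mul_pow]
      have h1 : ‖(fourierCoef fδ (-j))⁻¹‖ₑ ^ 2
          ≤ ENNReal.ofReal ((c ^ 2)⁻¹ * (1 + ‖intVec j‖) ^ (2 * γ)) := by
        rw [← ofReal_norm, ← ENNReal.ofReal_pow (norm_nonneg _)]
        refine ENNReal.ofReal_le_ofReal ?_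
        rw [norm_inv]
        calc (‖fourierCoef fδ (-j)‖⁻¹) ^ 2 ≤ ((c * (1 + ‖intVec j‖) ^ (-γ))⁻¹) ^ 2 := by
              gcongr
          _ = _ := by
              rw [Real.rpow_neg (by positivity), mul_inv, inv_inv, mul_pow, inv_pow, mul_comm 2 γ,
                Real.rpow_mul (by positivity), Real.rpow_two]
      calc _ ≤ 1 ^ 2 * (‖p j - fourierCoef h j * fourierCoef fδ (-j)‖ₑ ^ 2 *
          ENNReal.ofReal ((c ^ 2)⁻¹ * (1 + ‖intVec j‖) ^ (2 * γ))) := by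
            gcongr
            exact norm_inv_two_pi_pow_le
        _ = _ := by rw [one_pow, one_mul, mul_comm]
    -- Outside the box the estimator has no coefficient, so the error is the coefficient of `h`
    -- itself, and `(1 + m)^{-2α} (1 + ‖j‖)^{2α} ≥ 1` there.
    · rw [if_neg hj, zero_add]
      have e : a j - seriesCoef (fun x => (h x : ℂ)) j
          = -(((2 * Real.pi : ℝ) : ℂ)⁻¹ ^ d * fourierCoef h j) := by
        rw [ha]
        simp only [hj, if_false, seriesCoef, zero_sub]
        rw [← fourierCoef_eq_ft]
      rw [e, enorm_neg, enorm_mul, mul_pow, ← mul_assoc]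
      gcongr
      refine (pow_le_one' norm_inv_two_pi_pow_le 2).trans ?_
      rw [← ENNReal.ofReal_mul (by positivity), ENNReal.one_le_ofReal,
        Real.rpow_neg (by positivity), inv_mul_eq_div, one_le_div (by positivity)]
      exact Real.rpow_le_rpow (by positivity) (by linarith [le_norm_intVec hj]) (by linarith)
  refine (ENNReal.tsum_le_tsum hterm).trans (le_of_eq ?_)
  rw [ENNReal.tsum_add, ENNReal.tsum_mul_left, energy, hp]
  congr 1
  rw [tsum_eq_sum (s := freqBox d m) fun j hj => if_neg hj]
  exact Finset.sum_congr rfl fun j hj => if_pos hj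

end IntegratedError

/-! ### Rates of convergence -/

section Rates

/-- The asymptotic relation holds only from some index on; the sums `S₁` and `S₂` absorb the
finitely many earlier ones. Using `1 + J n` keeps the lower bound valid where `J n = 0`. -/
lemma exists_bounds_of_isTheta {J : ℕ → ℕ} {s : ℝ} (hs : 0 < s)
    (hJ : (fun n : ℕ => (J n : ℝ)) =Θ[atTop] fun n : ℕ => (n : ℝ) ^ s) :
    ∃ a b : ℝ, 0 < a ∧ 0 < b ∧ ∀ n : ℕ, 1 ≤ n →
      a * (n : ℝ) ^ s ≤ 1 + J n ∧ (1 + J n : ℝ) ≤ b * (n : ℝ) ^ s := by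
  obtain ⟨c₁, hc₁, h1⟩ := hJ.1.exists_pos
  obtain ⟨c₂, hc₂, h2⟩ := hJ.2.exists_pos
  obtain ⟨N₁, hN₁⟩ := eventually_atTop.1 h1.bound
  obtain ⟨N₂, hN₂⟩ := eventually_atTop.1 h2.bound
  set S₁ : ℝ := ∑ i ∈ Finset.range N₁, (J i : ℝ) with hS₁
  set S₂ : ℝ := ∑ i ∈ Finset.range N₂, (i : ℝ) ^ s with hS₂
  have hS₁0 : 0 ≤ S₁ := Finset.sum_nonneg fun i _ => Nat.cast_nonneg _
  have hS₂0 : 0 ≤ S₂ := Finset.sum_nonneg fun i _ => by positivity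
  refine ⟨(c₂ + S₂)⁻¹, 1 + c₁ + S₁, by positivity, by positivity, fun n hn => ?_⟩
  have hX : (1 : ℝ) ≤ (n : ℝ) ^ s := Real.one_le_rpow (by exact_mod_cast hn) hs.le
  have hJ0 : (0 : ℝ) ≤ J n := Nat.cast_nonneg _
  constructor
  · rw [inv_mul_le_iff₀ (by positivity)]
    rcases le_or_gt N₂ n with h | h
    · have := hN₂ n h
      rw [Real.norm_of_nonneg (by positivity), Real.norm_of_nonneg hJ0] at this
      nlinarith
    · have : (n : ℝ) ^ s ≤ S₂ := Finset.single_le_sum (f := fun i : ℕ => (i : ℝ) ^ s)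
        (fun i _ => by positivity) (Finset.mem_range.2 h)
      nlinarith
  · rcases le_or_gt N₁ n with h | h
    · have := hN₁ n h
      rw [Real.norm_of_nonneg hJ0, Real.norm_of_nonneg (by positivity)] at this
      nlinarith
    · have : (J n : ℝ) ≤ S₁ := Finset.single_le_sum (f := fun i : ℕ => (J i : ℝ))
        (fun i _ => Nat.cast_nonneg _) (Finset.mem_range.2 h)
      nlinarith

/-- The balance of variance and bias at the optimal truncation frequency. -/
lemma exists_rate_le {d L : ℕ} (hd : 1 ≤ d) {α γ b c : ℝ} (hα : 0 < α) (hγ : 0 < γ) (hb : 0 < b)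
    (hL : (d : ℝ) * (2 * α + 2 * γ + d) ≤ 4 * L * (α + γ)) :
    ∃ C : ℝ, 0 ≤ C ∧ ∀ (n m : ℕ), 1 ≤ n →
      (1 + m : ℝ) ≤ b * (n : ℝ) ^ (1 / (2 * α + 2 * γ + d)) →
      (2 * (1 + m : ℝ)) ^ d * ((c ^ 2)⁻¹ * (d * (1 + m : ℝ)) ^ (2 * γ) *
        ((n : ℝ)⁻¹ + (d * (1 + m : ℝ)) ^ (2 * L) * (((n : ℝ) ^ (1 / (d : ℝ))) ^ (2 * L))⁻¹)) ≤
      C * (n : ℝ) ^ (-(2 * α) / (2 * α + 2 * γ + d)) := by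
  have hd' : (0 : ℝ) < d := by exact_mod_cast hd
  obtain ⟨β, hβ⟩ : ∃ β : ℝ, β = 2 * α + 2 * γ + d := ⟨_, rfl⟩
  have hβ0 : 0 < β := by rw [hβ]; positivity
  rw [← hβ] at hL ⊢
  refine ⟨(2 * b) ^ d * ((c ^ 2)⁻¹ * (d * b) ^ (2 * γ) * (1 + (d * b) ^ (2 * L))), by positivity,
    fun n m hn hm => ?_⟩
  have hn1 : (1 : ℝ) ≤ n := by exact_mod_cast hn
  have hn0 : (0 : ℝ) < n := by linarith
  obtain ⟨X, hX⟩ : ∃ X : ℝ, X = (n : ℝ) ^ (1 / β) := ⟨_, rfl⟩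
  rw [← hX] at hm
  have hX0 : 0 < X := by rw [hX]; positivity
  -- The truncation frequency is tuned to this term: `(d + 2γ)/β - 1 = -2α/β`.
  have e1 : X ^ d * X ^ (2 * γ) * (n : ℝ)⁻¹ = (n : ℝ) ^ (-(2 * α) / β) := by
    rw [hX, ← Real.rpow_natCast, ← Real.rpow_mul hn0.le, ← Real.rpow_mul hn0.le,
      ← Real.rpow_neg_one, ← Real.rpow_add hn0, ← Real.rpow_add hn0]
    congr 1
    field_simp
    rw [hβ]; ring
  have e2 : X ^ d * X ^ (2 * γ) * (X ^ (2 * L) * (((n : ℝ) ^ (1 / (d : ℝ))) ^ (2 * L))⁻¹)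
      ≤ (n : ℝ) ^ (-(2 * α) / β) := by
    have e3 : X ^ d * X ^ (2 * γ) * (X ^ (2 * L) * (((n : ℝ) ^ (1 / (d : ℝ))) ^ (2 * L))⁻¹)
        = (n : ℝ) ^ ((d + 2 * γ + 2 * L) / β - 2 * L / d) := by
      rw [hX, ← Real.rpow_natCast _ d, ← Real.rpow_natCast _ (2 * L),
        ← Real.rpow_natCast _ (2 * L), ← Real.rpow_mul hn0.le, ← Real.rpow_mul hn0.le,
        ← Real.rpow_mul hn0.le, ← Real.rpow_mul hn0.le, ← Real.rpow_neg hn0.le,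
        ← Real.rpow_add hn0, ← Real.rpow_add hn0, ← Real.rpow_add hn0]
      congr 1
      push_cast
      field_simp
      ring
    rw [e3]
    refine Real.rpow_le_rpow_of_exponent_le hn1 ?_
    rw [sub_le_iff_le_add, div_add_div _ _ hβ0.ne' hd'.ne', div_le_div_iff₀ hβ0 (by positivity)]
    -- After clearing denominators, the comparison of exponents is `d β ≤ 2L(β - d) = 4L(α + γ)`,
    -- which is the hypothesis on `L`.
    have : (d + 2 * γ + 2 * L) * (d : ℝ) ≤ -(2 * α) * d + β * (2 * L) := by
      rw [hβ] at hL ⊢; nlinarith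
    calc (d + 2 * γ + 2 * L) * (β * (d : ℝ)) = β * ((d + 2 * γ + 2 * L) * (d : ℝ)) := by ring
      _ ≤ β * (-(2 * α) * d + β * (2 * L)) := by gcongr
      _ = _ := by ring
  calc (2 * (1 + m : ℝ)) ^ d * ((c ^ 2)⁻¹ * (d * (1 + m : ℝ)) ^ (2 * γ) *
        ((n : ℝ)⁻¹ + (d * (1 + m : ℝ)) ^ (2 * L) * (((n : ℝ) ^ (1 / (d : ℝ))) ^ (2 * L))⁻¹))
      ≤ (2 * (b * X)) ^ d * ((c ^ 2)⁻¹ * (d * (b * X)) ^ (2 * γ) *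
        ((n : ℝ)⁻¹ + (d * (b * X)) ^ (2 * L) * (((n : ℝ) ^ (1 / (d : ℝ))) ^ (2 * L))⁻¹)) := by
        gcongr
    _ = (2 * b) ^ d * ((c ^ 2)⁻¹ * (d * b) ^ (2 * γ) * (X ^ d * X ^ (2 * γ) * (n : ℝ)⁻¹ +
        (d * b) ^ (2 * L) * (X ^ d * X ^ (2 * γ) *
          (X ^ (2 * L) * (((n : ℝ) ^ (1 / (d : ℝ))) ^ (2 * L))⁻¹)))) := by
        rw [← mul_assoc 2 b X, ← mul_assoc (d : ℝ) b X, mul_pow (2 * b) X,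
          mul_pow ((d : ℝ) * b) X, Real.mul_rpow (by positivity) hX0.le]
        ring
    _ ≤ (2 * b) ^ d * ((c ^ 2)⁻¹ * (d * b) ^ (2 * γ) * ((n : ℝ) ^ (-(2 * α) / β) +
        (d * b) ^ (2 * L) * (n : ℝ) ^ (-(2 * α) / β))) := by
        rw [e1]; gcongr
    _ = _ := by ring

end Rates

end Berkson

end

/-! ### Assembly of the risk bound -/

theorem theorem4 {d : ℕ} (hd : 2 ≤ d)
    {Ω : Type*} [MeasurableSpace Ω] (P : Measure Ω) [IsProbabilityMeasure P]
    (fZ fδ : Berkson.Space d → ℝ) (A S Sstar : Set (Berkson.Space d))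
    (Z δ : ℕ → Ω → Berkson.Space d) (ε : ℕ → Ω → ℝ) (α γ R : ℝ) (K : ℕ) (J : ℕ → ℕ)
    (hmodel : Berkson.ErrorsInVariables P fZ fδ Z δ ε)
    (hA : IsCompact A) (hAcube : A ⊆ Berkson.openCube d)
    (hZ : Berkson.DesignDensity fZ S Sstar)
    (hγ : (d : ℝ) / 2 < γ)
    (hδ : Berkson.OrdinarySmoothDensity fδ A γ)
    (hα : 0 < α) (hR : 0 < R)
    (hαγ : (d : ℝ) * (2 * α + 2 * γ + d) ≤ 4 * (α - 1) * (α + γ))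
    (hJ : (fun n : ℕ => (J n : ℝ)) =Θ[atTop]
      fun n : ℕ => (n : ℝ) ^ (1 / (2 * α + 2 * γ + d)))
    (hK : Berkson.AdmissibleOrder d (⌈α⌉₊ - 1) K) :
    ∃ C : ℝ, 0 < C ∧ ∀ h : Berkson.Space d → ℝ,
      Berkson.SobolevClass fδ A Sstar α R h → ∀ n : ℕ, 1 ≤ n →
        Berkson.risk P Sstar fδ (⌈α⌉₊ - 1) K (J n) n h Z δ ε
          ≤ ENNReal.ofReal (C * (n : ℝ) ^ (-(2 * α) / (2 * α + 2 * γ + d))) := by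
  have hd1 : 1 ≤ d := by omega
  have hd2 : (2 : ℝ) ≤ d := by exact_mod_cast hd
  have hγ0 : 0 < γ := by linarith
  -- If `2(α - 1) ≤ d`, the right side of `hαγ` is at most `2d(α + γ)`, which is smaller than its
  -- left side. So `α > 1 + d/2 ≥ 2`: the coefficients of `h` are summable and the case `L = 0`
  -- cannot occur.
  have hα1 : (d : ℝ) < 2 * (α - 1) := by
    by_contra hcon
    have : 4 * (α - 1) * (α + γ) ≤ 2 * d * (α + γ) := by nlinarith
    nlinarith
  have hα2 : 2 < α := by linarith
  obtain ⟨L, hLdef⟩ : ∃ L : ℕ, L = ⌈α⌉₊ - 1 := ⟨_, rfl⟩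
  rw [← hLdef] at hK ⊢
  have hceil : α ≤ ⌈α⌉₊ := Nat.le_ceil α
  have hceil2 : 2 < ⌈α⌉₊ := by
    have : (2 : ℝ) < ⌈α⌉₊ := by linarith
    exact_mod_cast this
  have hLcast : (L : ℝ) = ⌈α⌉₊ - 1 := by
    rw [hLdef, Nat.cast_sub (by omega), Nat.cast_one]
  have hL1 : 1 ≤ L := by omega
  have hLα : (L : ℝ) ≤ α := by
    have := Nat.ceil_lt_add_one hα.le
    linarith
  have hK' : 2 + (2 * Berkson.degreeSum d L + 1) * Berkson.polyDim d L ≤ K := by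
    rcases hK with h | h
    · omega
    · exact h.2
  obtain ⟨M, B, hM, hB, hreg⟩ := Berkson.exists_regressionBounds (Sstar := Sstar) (R := R) hA hAcube
    hδ (by linarith) (by linarith : (d : ℝ) < 2 * α) (L := L) (by omega) hLα
  obtain ⟨c, Cδ, hc, hsm⟩ := hδ.smooth
  obtain ⟨C₀, hC₀, hcoef⟩ := Berkson.exists_coefficient_risk_le hd1 hmodel hZ hδ.measurable
    hδ.nonneg hL1 hK' (M := M) hB
  obtain ⟨β, hβ⟩ : ∃ β : ℝ, β = 2 * α + 2 * γ + d := ⟨_, rfl⟩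
  have hβ0 : 0 < β := by rw [hβ]; positivity
  obtain ⟨a, b, ha, hb, hab⟩ := Berkson.exists_bounds_of_isTheta (s := 1 / (2 * α + 2 * γ + d))
    (by rw [← hβ]; positivity) hJ
  have hLrate : (d : ℝ) * (2 * α + 2 * γ + d) ≤ 4 * L * (α + γ) := by
    refine hαγ.trans ?_
    have : α - 1 ≤ L := by linarith
    nlinarith
  obtain ⟨C₁, hC₁, hrate⟩ := Berkson.exists_rate_le (c := c) hd1 hα hγ0 hb hLrate
  obtain ⟨V, hV⟩ : ∃ V : ENNReal, V = volume (Berkson.closedCube d) := ⟨_, rfl⟩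
  have hVfin : V ≠ ⊤ := by rw [hV]; exact Berkson.volume_closedCube_lt_top.ne
  obtain ⟨E, hE⟩ : ∃ E : ℝ, E = 2 ^ (2 * α) * R := ⟨_, rfl⟩
  have hE0 : 0 < E := by rw [hE]; positivity
  -- the constants for small and for large sample sizes
  obtain ⟨D₁, hD₁⟩ : ∃ D : ℝ, D = M ^ 2 * V.toReal * (K : ℝ) ^ (2 * α / β) := ⟨_, rfl⟩
  obtain ⟨D₂, hD₂⟩ : ∃ D : ℝ, D = (2 * Real.pi) ^ d * (C₀.toReal * C₁ + a ^ (-(2 * α)) * E) :=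
    ⟨_, rfl⟩
  have hD₁0 : 0 ≤ D₁ := by rw [hD₁]; positivity
  have hD₂0 : 0 ≤ D₂ := by rw [hD₂]; positivity
  refine ⟨1 + D₁ + D₂, by positivity, fun h hh n hn => ?_⟩
  have hn1 : (1 : ℝ) ≤ n := by exact_mod_cast hn
  have hn0 : (0 : ℝ) < n := by linarith
  have hregh := hreg h hh
  obtain ⟨r, hr⟩ : ∃ r : ℝ, r = (n : ℝ) ^ (-(2 * α) / (2 * α + 2 * γ + d)) := ⟨_, rfl⟩
  have hr0 : 0 < r := by rw [hr]; positivity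
  rw [← hr]
  -- For `n < K` there is no index set of size `K`, so the estimator is `0` and the error is at most
  -- `M²` times the volume of the cube; the factor `K ^ (2α/β)` in `D₁` makes up for the rate.
  rcases lt_or_ge n K with hnK | hnK
  · have hzero : ∀ (U : Fin n → ℝ) (Z : Fin n → Berkson.Space d) (x : Berkson.Space d),
        Berkson.hHat Sstar fδ L K (J n) U Z x = 0 := by
      intro U Z x
      have hp : Finset.powersetCard K (Finset.univ : Finset (Fin n)) = ∅ := by
        rw [Finset.powersetCard_eq_empty]; simpa using hnK
      simp [Berkson.hHat, Berkson.psiHat, hp]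
    have h1 : ∀ ω, (∫⁻ x in Berkson.closedCube d,
        ‖Berkson.hHat Sstar fδ L K (J n) (fun i : Fin n => Berkson.response h Z δ ε i ω)
          (fun i : Fin n => Z i ω) x - (h x : ℂ)‖ₑ ^ 2) ≤ ENNReal.ofReal (M ^ 2) * V := by
      intro ω
      rw [hV, ← setLIntegral_const]
      refine lintegral_mono_ae (ae_restrict_of_ae ?_)
      filter_upwards [hregh.ae_abs_le] with x hx
      rw [hzero, zero_sub, enorm_neg, ← ofReal_norm, Complex.norm_real, Real.norm_eq_abs,
        ← ENNReal.ofReal_pow (abs_nonneg _)]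
      exact ENNReal.ofReal_le_ofReal (pow_le_pow_left₀ (abs_nonneg _) hx 2)
    refine (lintegral_mono h1).trans ?_
    rw [lintegral_const, measure_univ, mul_one, ← ENNReal.ofReal_toReal hVfin,
      ← ENNReal.ofReal_mul (by positivity)]
    refine ENNReal.ofReal_le_ofReal ?_
    have h2 : 1 ≤ (K : ℝ) ^ (2 * α / β) * r := by
      have h3 : (n : ℝ) ^ (2 * α / β) * r = 1 := by
        rw [hr, ← hβ, ← Real.rpow_add hn0, neg_div, add_neg_cancel, Real.rpow_zero]
      rw [← h3]
      have : (n : ℝ) ≤ K := by exact_mod_cast hnK.le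
      gcongr
    calc M ^ 2 * V.toReal ≤ M ^ 2 * V.toReal * ((K : ℝ) ^ (2 * α / β) * r) :=
          le_mul_of_one_le_right (by positivity) h2
      _ = D₁ * r := by rw [hD₁]; ring
      _ ≤ _ := by nlinarith
  · have hd0 : (d : ℝ) ≠ 0 := by positivity
    obtain ⟨τ, hτdef⟩ : ∃ τ : ℝ, τ = (n : ℝ) ^ (1 / (d : ℝ)) := ⟨_, rfl⟩
    have hτ : 0 < τ := by rw [hτdef]; positivity
    have hτn : τ ^ d = n := by
      rw [hτdef, ← Real.rpow_natCast, ← Real.rpow_mul hn0.le, one_div_mul_cancel hd0, Real.rpow_one]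
    obtain ⟨hpsi, hmse⟩ := hcoef h hh.measurable hregh n τ hnK hτ hτn
    have hen := hh.energy_le hα.le
    rw [← hE] at hen
    obtain ⟨q, hq⟩ : ∃ q : Ω → (Fin n → Berkson.Space d) × (Fin n → Berkson.Space d × ℝ),
      q = fun ω => ((fun i : Fin n => Z i ω), fun i : Fin n => (δ i ω, ε i ω)) := ⟨_, rfl⟩
    have hqm : Measurable q := by
      rw [hq]; exact (hmodel.measurePreserving n).measurable
    have hmeas : ∀ j : Fin d → ℤ, Measurable fun ω => ‖Berkson.linEst L K Sstar h j (q ω) -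
        Berkson.fourierCoef h j * Berkson.fourierCoef fδ (-j)‖ₑ ^ 2 := fun j =>
      ((((Berkson.measurable_linEst L K hZ.compact_star.measurableSet hh.measurable j).comp
        hqm).sub_const _).enorm.pow_const 2)
    -- The estimated coefficients agree with the linear statistics outside one null set common to
    -- all frequencies.
    have hbound : ∀ᵐ ω ∂P, (∫⁻ x in Berkson.closedCube d,
        ‖Berkson.hHat Sstar fδ L K (J n) (fun i : Fin n => Berkson.response h Z δ ε i ω)
          (fun i : Fin n => Z i ω) x - (h x : ℂ)‖ₑ ^ 2) ≤
        ENNReal.ofReal ((2 * Real.pi) ^ d) *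
        (∑ j ∈ Berkson.freqBox d (J n),
          ENNReal.ofReal ((c ^ 2)⁻¹ * (1 + ‖Berkson.intVec j‖) ^ (2 * γ)) *
          ‖Berkson.linEst L K Sstar h j (q ω) -
            Berkson.fourierCoef h j * Berkson.fourierCoef fδ (-j)‖ₑ ^ 2 +
          ENNReal.ofReal ((1 + J n : ℝ) ^ (-(2 * α))) * ENNReal.ofReal E) := by
      filter_upwards [hpsi] with ω hω
      refine (Berkson.lintegral_hHat_sub_sq_le hα.le hc (fun j => (hsm j).1) hregh _ _).trans ?_
      simp_rw [hω]
      rw [hq]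
      gcongr
    have hbox : ∀ j ∈ Berkson.freqBox d (J n),
        ENNReal.ofReal ((c ^ 2)⁻¹ * (1 + ‖Berkson.intVec j‖) ^ (2 * γ)) *
          ∫⁻ ω, ‖Berkson.linEst L K Sstar h j (q ω) -
            Berkson.fourierCoef h j * Berkson.fourierCoef fδ (-j)‖ₑ ^ 2 ∂P ≤
        C₀ * ENNReal.ofReal ((c ^ 2)⁻¹ * (d * (1 + J n : ℝ)) ^ (2 * γ) *
          ((n : ℝ)⁻¹ + (d * (1 + J n : ℝ)) ^ (2 * L) * (τ ^ (2 * L))⁻¹)) := by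
      intro j hj
      have h1 := hmse j
      rw [hτn] at h1
      have h2 := Berkson.one_add_norm_intVec_le hd1 hj
      rw [hq]
      refine (mul_le_mul_right h1 _).trans ?_
      rw [mul_left_comm, ← ENNReal.ofReal_mul (by positivity)]
      gcongr
    refine (lintegral_mono_ae hbound).trans ?_
    rw [lintegral_const_mul' _ _ ENNReal.ofReal_ne_top, lintegral_add_right _ measurable_const,
      lintegral_const, measure_univ, mul_one, lintegral_finsetSum _ fun j _ => (hmeas j).const_mul _]
    simp_rw [lintegral_const_mul _ (hmeas _)]
    have hsum : ∑ j ∈ Berkson.freqBox d (J n),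
        ENNReal.ofReal ((c ^ 2)⁻¹ * (1 + ‖Berkson.intVec j‖) ^ (2 * γ)) *
          ∫⁻ ω, ‖Berkson.linEst L K Sstar h j (q ω) -
            Berkson.fourierCoef h j * Berkson.fourierCoef fδ (-j)‖ₑ ^ 2 ∂P ≤
        C₀ * ENNReal.ofReal (C₁ * r) := by
      refine (Finset.sum_le_sum hbox).trans ?_
      rw [Finset.sum_const, nsmul_eq_mul, mul_left_comm, ← ENNReal.ofReal_natCast,
        ← ENNReal.ofReal_mul (by positivity)]
      refine mul_le_mul_right (ENNReal.ofReal_le_ofReal ?_) _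
      have h1 := hrate n (J n) hn (hab n hn).2
      rw [← hr, ← hτdef] at h1
      refine le_trans ?_ h1
      refine mul_le_mul_of_nonneg_right (Berkson.card_freqBox_le d (J n)) (by positivity)
    have htail : (1 + J n : ℝ) ^ (-(2 * α)) ≤ a ^ (-(2 * α)) * r := by
      calc (1 + J n : ℝ) ^ (-(2 * α))
          ≤ (a * (n : ℝ) ^ (1 / (2 * α + 2 * γ + d))) ^ (-(2 * α)) :=
            Real.rpow_le_rpow_of_nonpos (by positivity) (hab n hn).1 (by linarith)
        _ = a ^ (-(2 * α)) * r := by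
            rw [Real.mul_rpow ha.le (by positivity), ← Real.rpow_mul hn0.le, hr]
            congr 2; ring
    calc _ ≤ ENNReal.ofReal ((2 * Real.pi) ^ d) * (C₀ * ENNReal.ofReal (C₁ * r) +
          ENNReal.ofReal (a ^ (-(2 * α)) * r) * ENNReal.ofReal E) := by gcongr
      _ = ENNReal.ofReal (D₂ * r) := by
          rw [← ENNReal.ofReal_toReal hC₀, ← ENNReal.ofReal_mul ENNReal.toReal_nonneg,
            ← ENNReal.ofReal_mul (by positivity), ← ENNReal.ofReal_add (by positivity)
              (by positivity), ← ENNReal.ofReal_mul (by positivity), hD₂]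
          congr 1; ring
      _ ≤ _ := by
          refine ENNReal.ofReal_le_ofReal ?_
          nlinarith
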